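/- Conventions. Graphs and digraphs are finite. The underlying graph $UG(D)$ of a digraph $D$ is the simple undirected graph obtained by forgetting the orientations of the arcs and discarding loops and parallel edges. An $r$-out-branching of $D$ is a spanning subdigraph $T$ of $D$ that is an oriented tree in which $r$ is the only vertex of in-degree $0$; its leaves are its vertices of out-degree $0$. Write $\mathbf{tw}$ for treewidth. Polynomial time is measured on a random access machine with unit-cost addition, truncated subtraction and indirect addressing; digraphs are given by their adjacency matrices. Statement. There are an algorithm, a polynomial $p$ and a constant $C$ such that the following holds for every graph $H$. Let $D$ be a digraph with $n$ vertices such that $UG(D)$ excludes $H$ as a minor, let $r\in V(D)$, and let $k$ be a positive integer. On input $(D,r,k)$ the algorithm halts after at most $p(n)$ steps and outputs either 1. an $r$-out-branching of $D$ with at least $k$ leaves, or 2. a digraph $D'$ with a designated root $r'\in V(D')$ (the vertex that plays the role of $r$) such that - $UG(D')$ excludes $H$ as a minor; - $D$ has an $r$-out-branching with at least $k$ leaves if and only if $D'$ has an $r'$-out-branching with at least $k$ leaves; - there exists a set $S\subseteq V(D')$ with $|S|\le C\,k$ and $\mathbf{tw}\bigl(UG(D'[V(D')\setminus S])\bigr)\le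 3$. -/

import Mathlib

/-! ## Digraphs and out-branchings -/

namespace Digraph

variable {V : Type*}

/-- The underlying undirected simple graph of a digraph. -/
abbrev underlying (D : Digraph V) : SimpleGraph V := D.toSimpleGraphInclusive

/-- The subdigraph of `D` induced by a set of vertices. -/
def inducedOn (D : Digraph V) (X : Set V) : Digraph X where
  Adj u v := D.Adj u v

/-- `T` is an out-branching of `D` rooted at `r`: a spanning subdigraph of `D` that is an
oriented tree in which `r` is the only vertex of in-degree zero. -/
structure IsOutBranching (D : Digraph V) (r : V) (T : Digraph V) : Prop where
  le : T ≤ D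
  oriented : ∀ u v, T.Adj u v → ¬ T.Adj v u
  isTree : T.underlying.IsTree
  root_iff : ∀ v, (∀ u, ¬ T.Adj u v) ↔ v = r

/-- The vertices of out-degree zero. -/
def leaves (T : Digraph V) : Set V := {v | ∀ w, ¬ T.Adj v w}

/-- `D` has an out-branching rooted at `r` with at least `k` leaves. -/
def HasLeafyOutBranching (D : Digraph V) (r : V) (k : ℕ) : Prop :=
  ∃ T : Digraph V, D.IsOutBranching r T ∧ k ≤ T.leaves.ncard

end Digraph

/-! ## Minors and treewidth of undirected graphs -/

namespace SimpleGraph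

variable {V W : Type*}

/-- `H` is a minor of `G`: the vertices of `H` are represented by pairwise disjoint connected
(in particular nonempty) vertex sets of `G`, with an edge of `G` between the sets of any two
adjacent vertices of `H`. -/
def IsMinorOf (H : SimpleGraph W) (G : SimpleGraph V) : Prop :=
  ∃ B : W → Set V,
    (∀ a, (G.induce (B a)).Connected) ∧
    (∀ a b, a ≠ b → Disjoint (B a) (B b)) ∧
    ∀ a b, H.Adj a b → ∃ u ∈ B a, ∃ v ∈ B b, G.Adj u v

/-- A tree decomposition of `G`, indexed by the nodes of a finite tree. -/
structure TreeDecomposition (G : SimpleGraph V) where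
  Node : Type
  finite_node : Finite Node
  tree : SimpleGraph Node
  isTree : tree.IsTree
  bag : Node → Set V
  exists_mem_bag : ∀ v, ∃ i, v ∈ bag i
  exists_edge_bag : ∀ v w, G.Adj v w → ∃ i, v ∈ bag i ∧ w ∈ bag i
  connected_nodes : ∀ v, (tree.induce {i | v ∈ bag i}).Connected

/-- The maximal bag size minus one (an empty bag contributes `0`). -/
noncomputable def TreeDecomposition.width {G : SimpleGraph V} (X : G.TreeDecomposition) : ℕ∞ :=
  ⨆ i, ((X.bag i).encard - 1)

/-- The minimal width of a tree decomposition of `G`. -/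
noncomputable def treewidth (G : SimpleGraph V) : ℕ∞ :=
  ⨅ X : G.TreeDecomposition, X.width

end SimpleGraph

/-! ## Random access machines

Programs of a random access machine with finitely many registers, a memory of natural numbers
with indirect addressing, and an output tape of natural numbers. The arithmetic operations are
addition and truncated subtraction. Every operation has unit cost; as there is no multiplication,
polynomial running time on this machine is the same as on a Turing machine. -/

namespace RAM

/-- A configuration: the registers, the memory, and the words output so far. -/
structure State where
  reg : ℕ → ℕ
  mem : ℕ → ℕ
  out : List ℕ

inductive Expr where
  | const (c : ℕ)
  | reg (x : ℕ)
  | mem (e : Expr)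
  | add (e f : Expr)
  | sub (e f : Expr)

namespace Expr

/-- The value of an expression; `mem e` reads the memory cell whose address is the value of `e`. -/
def eval (s : State) : Expr → ℕ
  | const c => c
  | reg x => s.reg x
  | mem e => s.mem (e.eval s)
  | add e f => e.eval s + f.eval s
  | sub e f => e.eval s - f.eval s

/-- The number of steps needed to evaluate an expression: one for each operation. -/
def cost : Expr → ℕ
  | const _ => 1
  | reg _ => 1
  | mem e => e.cost + 1
  | add e f => e.cost + f.cost + 1
  | sub e f => e.cost + f.cost + 1

end Expr

inductive Program where
  | skip
  | assign (x : ℕ) (e : Expr)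
  | store (a e : Expr)
  | emit (e : Expr)
  | seq (P Q : Program)
  | ite (e : Expr) (P Q : Program)
  | while (e : Expr) (P : Program)

/-- `Run P s t s'`: started in `s`, the program `P` halts in `s'` after exactly `t` steps.
A test `e` counts as true when its value is nonzero. -/
inductive Run : Program → State → ℕ → State → Prop
  | skip (s : State) : Run .skip s 1 s
  | assign (x : ℕ) (e : Expr) (s : State) :
      Run (.assign x e) s (e.cost + 1) { s with reg := Function.update s.reg x (e.eval s) }
  | store (a e : Expr) (s : State) :
      Run (.store a e) s (a.cost + e.cost + 1)
        { s with mem := Function.update s.mem (a.eval s) (e.eval s) }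
  | emit (e : Expr) (s : State) :
      Run (.emit e) s (e.cost + 1) { s with out := s.out ++ [e.eval s] }
  | seq {P Q : Program} {s s' s'' : State} {t t' : ℕ} :
      Run P s t s' → Run Q s' t' s'' → Run (.seq P Q) s (t + t') s''
  | ite_true {e : Expr} {P Q : Program} {s s' : State} {t : ℕ} :
      e.eval s ≠ 0 → Run P s t s' → Run (.ite e P Q) s (e.cost + 1 + t) s'
  | ite_false {e : Expr} {P Q : Program} {s s' : State} {t : ℕ} :
      e.eval s = 0 → Run Q s t s' → Run (.ite e P Q) s (e.cost + 1 + t) s'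
  | while_true {e : Expr} {P : Program} {s s' s'' : State} {t t' : ℕ} :
      e.eval s ≠ 0 → Run P s t s' → Run (.while e P) s' t' s'' →
      Run (.while e P) s (e.cost + 1 + t + t') s''
  | while_false {e : Expr} {P : Program} {s : State} :
      e.eval s = 0 → Run (.while e P) s (e.cost + 1) s

/-- The initial configuration: the input words are in the memory cells `0, 1, 2, …`,
everything else is zero and nothing has been output. -/
def init (w : List ℕ) : State where
  reg _ := 0
  mem a := w.getD a 0
  out := []

/-- On input `w`, the program `P` halts after at most `t` steps with output `v`. -/
def Program.OutputsWithin (P : Program) (w v : List ℕ) (t : ℕ) : Prop :=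
  ∃ (m : ℕ) (s : State), m ≤ t ∧ Run P (init w) m s ∧ s.out = v

end RAM

open Classical in
/-- A digraph on `0, …, n - 1` as a list of words: the number `n` of vertices, followed by the
`n ^ 2` entries of the adjacency matrix, row by row. -/
noncomputable def Digraph.encode {n : ℕ} (D : Digraph (Fin n)) : List ℕ :=
  n :: (List.finRange n).flatMap fun i =>
    (List.finRange n).map fun j => if D.Adj i j then 1 else 0

/-! Call an arc `u → v` useful if some path from `r` reaches `u` without meeting `v`. Out-branchings
consist of useful arcs, so the kernel can be `useful D r`, a subdigraph of `D` on the same vertices: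
equivalence and minor-exclusion are then immediate, and all the work lies in finding the small set
whose removal leaves treewidth at most 3. If some vertex is unreachable from `r`, there is no
out-branching, and two isolated vertices serve as output.

If everything is reachable, two out-branchings with parent maps `f` and `b` are computed that are
independent: a proper ancestor of `z` in both trees strictly dominates `z`
(`LowHigh.strictDom_of_anc`). They come from an order of low-high type, grown one vertex at a time.
The growth never gets stuck, because one can maintain that every remaining vertex is reached,
outside the current set `A`, from a strict dominator in `A` (`exists_open_insert`).

From each of the two trees a local search looks for more leaves, along arcs compatible with a
partial order that extends the ancestor relation and compares the branches below siblings; this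
keeps every intermediate parent map a tree. The order of siblings is taken in both directions, so
there are four searches. If one of them finds `k` leaves, its tree is the output. Otherwise each
local optimum has fewer than `k` leaves, hence at most `3 * k` vertices have an alternative parent
(`ncard_alternative_le`). The two orders of one tree together miss only arcs from a vertex to itself
or to an ancestor. So outside a set `S` of at most `15 * k` vertices, the arcs into `v` come from
its parent or from its descendants, in either tree. A common descendant of `v` in both trees is
dominated by `v`, so its arc to `v` is useless: only the arcs from `f v` and `b v` remain
(`Skeleton.eq_or_eq`).

The tree decomposition lives on the tree of `f`. The bag of `x` consists of `x`, `f x` and the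
vertices `v` above `x` whose arc from `b v` passes over `x`. After enlarging `S` threefold, at most
two arcs pass over any `x` (`Skeleton.ncard_passing_le`), so bags have at most four elements and the
constant is `3 * 15 = 45`.

For the running time, the algorithm is written in a language whose only loops have `n` rounds;
`exists_program` compiles it once and for all to a polynomial-time random access machine. The
remaining lemmas identify the semantics of the concrete programs with the combinatorial notions. -/

/-! ## A language of bounded loops

Programs over finitely many unbounded arrays whose only loops run over `0, …, n - 1`. They are
total, run in polynomial time, and compile to random access machines. -/

namespace BoundedLoop

/-- The names of the arrays. -/
inductive Cell where
  | input | mulTable | avoid | mark | block | inside | low | high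
  | covered | anc | order | parent | movable | result | idx | rnd
  | src | tree | vtx | stp | top | first | second | third
  | found | done | ok | acc | cc | dd | ll | flip
  deriving DecidableEq

namespace Cell

/-- The cells of the arrays are interleaved in the memory in this order. -/
def code : Cell → ℕ
  | input => 0 | mulTable => 1 | avoid => 2 | mark => 3
  | block => 4 | inside => 5 | low => 6 | high => 7
  | covered => 8 | anc => 9 | order => 10 | parent => 11
  | movable => 12 | result => 13 | idx => 14 | rnd => 15
  | src => 16 | tree => 17 | vtx => 18 | stp => 19
  | top => 20 | first => 21 | second => 22 | third => 23
  | found => 24 | done => 25 | ok => 26 | acc => 27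
  | cc => 28 | dd => 29 | ll => 30 | flip => 31

theorem code_lt (a : Cell) : a.code < 32 := by
  cases a <;> decide

theorem code_injective : Function.Injective code := by
  intro a b h
  cases a <;> cases b <;> first | rfl | exact absurd h (by decide)

end Cell

structure Store where
  arr : Cell → ℕ → ℕ
  out : List ℕ

namespace Store

/-- Write `x` into cell `i` of the array `a`. -/
def put (s : Store) (a : Cell) (i x : ℕ) : Store :=
  { s with arr := Function.update s.arr a (Function.update (s.arr a) i x) }

@[simp] theorem put_out (s : Store) (a : Cell) (i x : ℕ) : (s.put a i x).out = s.out := rfl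

@[simp] theorem put_arr (s : Store) (a b : Cell) (i j x : ℕ) :
    (s.put a i x).arr b j = if b = a ∧ j = i then x else s.arr b j := by
  by_cases h : b = a
  · subst h
    by_cases hj : j = i <;> simp [put, hj]
  · simp [put, h]

theorem put_arr_of_ne (s : Store) {a b : Cell} (h : b ≠ a) (i x : ℕ) :
    (s.put a i x).arr b = s.arr b := by
  simp [put, h]

end Store

inductive Exp where
  | const (c : ℕ)
  | size
  | get (a : Cell) (e : Exp)
  | add (e f : Exp)
  | sub (e f : Exp)

namespace Exp

def eval (n : ℕ) (s : Store) : Exp → ℕ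
  | const c => c
  | size => n
  | get a e => s.arr a (e.eval n s)
  | add e f => e.eval n s + f.eval n s
  | sub e f => e.eval n s - f.eval n s

/-- The expression reads the array `a`. -/
def reads (a : Cell) : Exp → Bool
  | const _ => false
  | size => false
  | get b e => b == a || e.reads a
  | add e f => e.reads a || f.reads a
  | sub e f => e.reads a || f.reads a

theorem eval_congr {n : ℕ} {s t : Store} (e : Exp)
    (h : ∀ a, e.reads a = true → s.arr a = t.arr a) : e.eval n s = e.eval n t := by
  induction e with
  | const c => rfl
  | size => rfl
  | get b e ih =>
    simp only [eval]
    rw [ih fun a ha => h a (by simp [reads, ha]), h b (by simp [reads])]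
  | add e f ihe ihf =>
    simp only [eval]
    rw [ihe fun a ha => h a (by simp [reads, ha]), ihf fun a ha => h a (by simp [reads, ha])]
  | sub e f ihe ihf =>
    simp only [eval]
    rw [ihe fun a ha => h a (by simp [reads, ha]), ihf fun a ha => h a (by simp [reads, ha])]

end Exp

inductive Cmd where
  | skip
  | put (a : Cell) (i e : Exp)
  | emit (e : Exp)
  | seq (P Q : Cmd)
  | ite (e : Exp) (P Q : Cmd)
  | loop (a : Cell) (P : Cmd)

/-- Apply `g 0`, …, `g (j - 1)` in this order. -/
def iter (g : ℕ → Store → Store) : ℕ → Store → Store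
  | 0, s => s
  | j + 1, s => g j (iter g j s)

namespace Cmd

/-- `loop a P` runs `P` for each value `0, …, n - 1` of the cell `0` of the array `a`. -/
def sem (n : ℕ) : Cmd → Store → Store
  | skip, s => s
  | put a i e, s => s.put a (i.eval n s) (e.eval n s)
  | emit e, s => { s with out := s.out ++ [e.eval n s] }
  | seq P Q, s => Q.sem n (P.sem n s)
  | ite e P Q, s => if e.eval n s ≠ 0 then P.sem n s else Q.sem n s
  | loop a P, s => iter (fun j s => P.sem n (s.put a 0 j)) n s

/-- The program writes to the array `a`. -/
def writes (a : Cell) : Cmd → Bool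
  | skip => false
  | put b _ _ => b == a
  | emit _ => false
  | seq P Q => P.writes a || Q.writes a
  | ite _ P Q => P.writes a || Q.writes a
  | loop b P => b == a || P.writes a

/-- The program outputs nothing. -/
def silent : Cmd → Bool
  | skip => true
  | put _ _ _ => true
  | emit _ => false
  | seq P Q => P.silent && Q.silent
  | ite _ P Q => P.silent && Q.silent
  | loop _ P => P.silent

theorem iter_invariant {g : ℕ → Store → Store} {I : ℕ → Store → Prop} {m : ℕ} {s : Store}
    (h₀ : I 0 s) (h : ∀ j < m, ∀ t, I j t → I (j + 1) (g j t)) : I m (iter g m s) := by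
  induction m with
  | zero => exact h₀
  | succ m ih => exact h m (Nat.lt_succ_self m) _ (ih fun j hj => h j (hj.trans m.lt_succ_self))

theorem loop_invariant {n : ℕ} {a : Cell} {P : Cmd} (I : ℕ → Store → Prop) {s : Store}
    (h₀ : I 0 s) (h : ∀ j < n, ∀ t, I j t → I (j + 1) (P.sem n (t.put a 0 j))) :
    I n ((loop a P).sem n s) :=
  iter_invariant (g := fun j s => P.sem n (s.put a 0 j)) h₀ h

/-- Since `writes` is computable, the frame conditions of concrete programs are settled by `decide`.
-/
theorem sem_arr_of_not_writes {n : ℕ} {a : Cell} (P : Cmd) (h : P.writes a = false)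
    (s : Store) : (P.sem n s).arr a = s.arr a := by
  induction P generalizing s with
  | skip => rfl
  | put b i e =>
    simp only [writes, beq_eq_false_iff_ne] at h
    exact Store.put_arr_of_ne _ (Ne.symm h) _ _
  | emit e => rfl
  | seq P Q ihP ihQ =>
    simp only [writes, Bool.or_eq_false_iff] at h
    simp only [sem]
    rw [ihQ h.2, ihP h.1]
  | ite e P Q ihP ihQ =>
    simp only [writes, Bool.or_eq_false_iff] at h
    simp only [sem]
    split_ifs
    · exact ihP h.1 s
    · exact ihQ h.2 s
  | loop b P ih =>
    simp only [writes, Bool.or_eq_false_iff, beq_eq_false_iff_ne] at h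
    refine loop_invariant (fun _ t => t.arr a = s.arr a) rfl fun j _ t ht => ?_
    rw [ih h.2, Store.put_arr_of_ne _ (Ne.symm h.1), ht]

theorem sem_out_of_silent {n : ℕ} (P : Cmd) (h : P.silent = true) (s : Store) :
    (P.sem n s).out = s.out := by
  induction P generalizing s with
  | skip => rfl
  | put b i e => rfl
  | emit e => simp [silent] at h
  | seq P Q ihP ihQ =>
    simp only [silent, Bool.and_eq_true] at h
    simp only [sem]
    rw [ihQ h.2, ihP h.1]
  | ite e P Q ihP ihQ =>
    simp only [silent, Bool.and_eq_true] at h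
    simp only [sem]
    split_ifs
    · exact ihP h.1 s
    · exact ihQ h.2 s
  | loop b P ih =>
    exact loop_invariant (fun _ t => t.out = s.out) rfl fun j _ t ht => by
      rw [ih h, Store.put_out, ht]

end Cmd

/-! ### Compilation to random access machines -/

open RAM

/-- `32 * e` -/
def timesWidth (e : Expr) : Expr :=
  let e₂ := Expr.add e e
  let e₄ := Expr.add e₂ e₂
  let e₈ := Expr.add e₄ e₄
  let e₁₆ := Expr.add e₈ e₈
  Expr.add e₁₆ e₁₆

theorem timesWidth_eval (e : Expr) (σ : State) : (timesWidth e).eval σ = 32 * e.eval σ := by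
  simp only [timesWidth, Expr.eval]
  omega

/-- Array cells are interleaved, above the address in register `1`. -/
def address (a : Cell) (e : Expr) : Expr :=
  .add (.reg 1) (.add (timesWidth e) (.const a.code))

theorem address_eval (a : Cell) (e : Expr) (σ : State) :
    (address a e).eval σ = σ.reg 1 + (32 * e.eval σ + a.code) := by
  simp [address, Expr.eval, timesWidth_eval]

def Exp.compile : Exp → Expr
  | const c => .const c
  | size => .reg 0
  | get a e => .mem (address a e.compile)
  | add e f => .add e.compile f.compile
  | sub e f => .sub e.compile f.compile

/-- Register `2 + d` counts the rounds of a loop at nesting depth `d`. Cell `0` of the loop's array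
only receives a copy of it, so a body that overwrites this cell cannot change the number of rounds.
-/
def Cmd.compile (d : ℕ) : Cmd → Program
  | skip => .skip
  | put a i e => .store (address a i.compile) e.compile
  | emit e => .emit e.compile
  | seq P Q => .seq (P.compile d) (Q.compile d)
  | ite e P Q => .ite e.compile (P.compile d) (Q.compile d)
  | loop a P =>
    .seq (.assign (2 + d) (.const 0))
      (.while (.sub (.reg 0) (.reg (2 + d)))
        (.seq (.store (address a (.const 0)) (.reg (2 + d)))
          (.seq (P.compile (d + 1)) (.assign (2 + d) (.add (.reg (2 + d)) (.const 1))))))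

/-- The machine state `σ` represents the store `s`. -/
structure Represents (n b : ℕ) (s : Store) (σ : State) : Prop where
  size : σ.reg 0 = n
  base : σ.reg 1 = b
  cell : ∀ a : Cell, ∀ i, σ.mem (b + (32 * i + a.code)) = s.arr a i
  out : σ.out = s.out

namespace Represents

variable {n b : ℕ} {s : Store} {σ : State}

theorem eval_compile (h : Represents n b s σ) (e : Exp) : e.compile.eval σ = e.eval n s := by
  induction e with
  | const c => rfl
  | size => exact h.size
  | get a e ih => simp only [Exp.compile, Expr.eval, Exp.eval, address_eval, h.base, ih, h.cell]
  | add e f ihe ihf => simp only [Exp.compile, Expr.eval, Exp.eval, ihe, ihf]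
  | sub e f ihe ihf => simp only [Exp.compile, Expr.eval, Exp.eval, ihe, ihf]

/-- All codes are below `32`, so distinct pairs of an array and an index have distinct addresses. -/
theorem store (h : Represents n b s σ) (a : Cell) (i x : ℕ) :
    Represents n b (s.put a i x)
      { σ with mem := Function.update σ.mem (b + (32 * i + a.code)) x } := by
  refine ⟨h.size, h.base, fun c j => ?_, h.out⟩
  simp only [Function.update_apply, Store.put_arr, h.cell]
  have hiff : (b + (32 * j + c.code) = b + (32 * i + a.code)) ↔ (c = a ∧ j = i) := by
    rw [← Cell.code_injective.eq_iff]
    have := c.code_lt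
    have := a.code_lt
    omega
  simp only [hiff]

theorem assign (h : Represents n b s σ) (d x : ℕ) :
    Represents n b s { σ with reg := Function.update σ.reg (2 + d) x } :=
  ⟨by
    have : (0 : ℕ) ≠ 2 + d := by omega
    simp [h.size, this], by
    have : (1 : ℕ) ≠ 2 + d := by omega
    simp [h.base, this], h.cell, h.out⟩

end Represents

open Polynomial in
/-- A compiled program simulates the semantics in polynomial time, and keeps the loop counters
of smaller depth. -/
theorem Cmd.compile_run (P : Cmd) (d : ℕ) :
    ∃ q : Polynomial ℕ, ∀ n b s σ, Represents n b s σ →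
      ∃ m σ', m ≤ q.eval n ∧ Run (P.compile d) σ m σ' ∧ Represents n b (P.sem n s) σ' ∧
        ∀ c < d, σ'.reg (2 + c) = σ.reg (2 + c) := by
  induction P generalizing d with
  | skip => exact ⟨1, fun n b s σ h => ⟨1, σ, by simp, .skip σ, h, fun _ _ => rfl⟩⟩
  | put a i e =>
    refine ⟨C ((address a i.compile).cost + e.compile.cost + 1), fun n b s σ h =>
      ⟨_, _, by simp, .store _ _ σ, ?_, fun _ _ => rfl⟩⟩
    have := h.store a (i.eval n s) (e.eval n s)
    simpa only [address_eval, h.base, h.eval_compile, sem] using this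
  | emit e =>
    refine ⟨C (e.compile.cost + 1), fun n b s σ h =>
      ⟨_, _, by simp, .emit _ σ, ⟨h.size, h.base, h.cell, ?_⟩, fun _ _ => rfl⟩⟩
    simp only [h.out, h.eval_compile, sem]
  | seq P Q ihP ihQ =>
    obtain ⟨q₁, h₁⟩ := ihP d
    obtain ⟨q₂, h₂⟩ := ihQ d
    refine ⟨q₁ + q₂, fun n b s σ h => ?_⟩
    obtain ⟨m, σ', hm, hr, hR, hc⟩ := h₁ n b s σ h
    obtain ⟨m', σ'', hm', hr', hR', hc'⟩ := h₂ n b _ σ' hR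
    exact ⟨m + m', σ'', by simpa using add_le_add hm hm', .seq hr hr', hR',
      fun c hcd => (hc' c hcd).trans (hc c hcd)⟩
  | ite e P Q ihP ihQ =>
    obtain ⟨q₁, h₁⟩ := ihP d
    obtain ⟨q₂, h₂⟩ := ihQ d
    refine ⟨C (e.compile.cost + 1) + (q₁ + q₂), fun n b s σ h => ?_⟩
    by_cases he : e.eval n s ≠ 0
    · obtain ⟨m, σ', hm, hr, hR, hc⟩ := h₁ n b s σ h
      refine ⟨_, σ', ?_, .ite_true (by rwa [h.eval_compile]) hr, by simpa [sem, he] using hR, hc⟩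
      simp only [eval_add, eval_C]
      omega
    · obtain ⟨m, σ', hm, hr, hR, hc⟩ := h₂ n b s σ h
      rw [not_not] at he
      refine ⟨_, σ', ?_, .ite_false (by rwa [h.eval_compile]) hr, by simpa [sem, he] using hR, hc⟩
      simp only [eval_add, eval_C]
      omega
  | loop a P ih =>
    obtain ⟨q, hq⟩ := ih (d + 1)
    obtain ⟨c₁, hc₁⟩ : ∃ c, c = (address a (.const 0)).cost := ⟨_, rfl⟩
    -- Beyond its body a round costs `4` for the test, `c₁ + 2` for the store and `4` for the
    -- increment. Resetting the counter and the final failing test cost `6` more.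
    refine ⟨X * (q + C (c₁ + 10)) + C 10, fun n b s σ h => ?_⟩
    -- Induction on the number `k` of rounds still to come; `t` is the store after the first `j`
    -- rounds.
    have key : ∀ k, ∀ j, j + k = n → ∀ t τ, Represents n b t τ → τ.reg (2 + d) = j →
        t = iter (fun j s => P.sem n (s.put a 0 j)) j s →
        ∃ m τ', m ≤ k * (q.eval n + (c₁ + 10)) + 4 ∧
          Run (.while (.sub (.reg 0) (.reg (2 + d)))
            (.seq (.store (address a (.const 0)) (.reg (2 + d)))
              (.seq (P.compile (d + 1)) (.assign (2 + d) (.add (.reg (2 + d)) (.const 1))))))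
            τ m τ' ∧
          Represents n b ((loop a P).sem n s) τ' ∧ ∀ c < d, τ'.reg (2 + c) = τ.reg (2 + c) := by
      intro k
      induction k with
      | zero =>
        intro j hj t τ hR hd ht
        refine ⟨_, τ, ?_, .while_false ?_, ?_, fun _ _ => rfl⟩
        · simp [Expr.cost]
        · simp only [Expr.eval, hR.size, hd]
          omega
        · have : j = n := by omega
          subst this
          rw [ht] at hR
          exact hR
      | succ k ihk =>
        intro j hj t τ hR hd ht
        have h₁ := hR.store a 0 j
        obtain ⟨m, τ₁, hm, hr, hR₁, hc⟩ := hq n b _ _ h₁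
        have hd₁ : τ₁.reg (2 + d) = j := (hc d d.lt_succ_self).trans hd
        have h₂ := hR₁.assign d (j + 1)
        obtain ⟨m', τ', hm', hr', hR', hc'⟩ := ihk (j + 1) (by omega) _ _ h₂ (by simp)
          (by simp only [iter]; rw [ht])
        refine ⟨_, τ', ?_, .while_true (t := c₁ + 1 + 1 + (m + (3 + 1))) ?_
          (.seq (s' := { τ with mem := Function.update τ.mem (b + (32 * 0 + a.code)) j }) ?_
            (.seq hr (s'' := { τ₁ with reg := Function.update τ₁.reg (2 + d) (j + 1) }) ?_)) hr',
          hR', fun c hcd => ?_⟩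
        · simp only [Expr.cost]
          have : (k + 1) * (q.eval n + (c₁ + 10))
            = k * (q.eval n + (c₁ + 10)) + (q.eval n + (c₁ + 10)) := by ring
          omega
        · simp only [Expr.eval, hR.size, hd]
          omega
        · have := Run.store (address a (.const 0)) (.reg (2 + d)) τ
          simp only [address_eval, Expr.eval, hR.base, hd, Expr.cost, ← hc₁] at this
          exact this
        · have := Run.assign (2 + d) (.add (.reg (2 + d)) (.const 1)) τ₁
          simp only [Expr.eval, Expr.cost, hd₁] at this
          exact this
        · rw [hc' c hcd]
          have : (2 + c : ℕ) ≠ 2 + d := by omega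
          simp only [Function.update_apply, this, if_false]
          exact hc c (by omega)
    obtain ⟨m, τ', hm, hr, hR, hc⟩ := key n 0 (by omega) s _ (h.assign d 0) (by simp) rfl
    refine ⟨_, τ', ?_, .seq (.assign _ _ σ) hr, hR, fun c hcd => ?_⟩
    · simp only [Expr.cost, eval_add, eval_mul, eval_X, eval_C]
      omega
    · rw [hc c hcd]
      exact Function.update_of_ne (by omega) _ _

/-- Put `n` into register `0` and `n ^ 2 + 3` into register `1`, and copy the input. -/
def prologue : Program :=
  .seq (.assign 0 (.mem (.const 2))) <|
  .seq (.assign 1 (.const 3)) <|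
  .seq (.assign 2 (.reg 0)) <|
  .seq (.while (.reg 2) (.seq (.assign 1 (.add (.reg 1) (.reg 0)))
    (.assign 2 (.sub (.reg 2) (.const 1))))) <|
  .while (.sub (.reg 1) (.reg 2))
    (.seq (.store (address .input (.reg 2)) (.mem (.reg 2)))
      (.assign 2 (.add (.reg 2) (.const 1))))

/-- The store in which the array `input` holds the input. -/
def inputStore (w : List ℕ) : Store where
  arr a i := if a = .input then w.getD i 0 else 0
  out := []

/-- Without multiplication, the base address is obtained by adding `n` repeatedly. Register `2` ends
at `0`, where the copying of the input starts. -/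
theorem run_square (n : ℕ) (k : ℕ) (σ : State) (h₀ : σ.reg 0 = n) (h₂ : σ.reg 2 = k) :
    ∃ m σ', m ≤ k * 10 + 2 ∧
      Run (.while (.reg 2) (.seq (.assign 1 (.add (.reg 1) (.reg 0)))
        (.assign 2 (.sub (.reg 2) (.const 1))))) σ m σ' ∧
      σ'.mem = σ.mem ∧ σ'.out = σ.out ∧ σ'.reg 0 = n ∧ σ'.reg 1 = σ.reg 1 + k * n ∧
      σ'.reg 2 = 0 := by
  induction k generalizing σ with
  | zero => exact ⟨2, σ, le_rfl, .while_false h₂, rfl, rfl, h₀, by simp, h₂⟩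
  | succ k ih =>
    obtain ⟨m, σ', hm, hr, hmem, hout, hn, hb, hc⟩ := ih
      { σ with reg := Function.update (Function.update σ.reg 1 (σ.reg 1 + σ.reg 0)) 2 k }
      (by simpa [Function.update_apply] using h₀) (by simp)
    refine ⟨_, σ', ?_, .while_true (t := 4 + 4) (by simp [Expr.eval, h₂])
      (.seq (.assign 1 (.add (.reg 1) (.reg 0)) σ) ?_) hr, hmem, hout, hn, ?_, hc⟩
    · simp only [Expr.cost]
      omega
    · have := Run.assign 2 (.sub (.reg 2) (.const 1))
        { σ with reg := Function.update σ.reg 1 (σ.reg 1 + σ.reg 0) }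
      simpa [Expr.eval, Expr.cost, h₂] using this
    · rw [hb]
      simp [h₀]
      ring

/-- The arrays occupy addresses from `b = w.length` on, so copying never overwrites the input. Cells
beyond the input hold `0`, in agreement with the default value of `getD`. -/
theorem run_copy (w : List ℕ) (n b : ℕ) (hw : w.length = b) (k : ℕ) (j : ℕ) (hj : j + k = b)
    (σ : State) (h₀ : σ.reg 0 = n) (h₁ : σ.reg 1 = b) (h₂ : σ.reg 2 = j)
    (hin : ∀ i < b, σ.mem i = w.getD i 0)
    (hcell : ∀ a : Cell, ∀ i, σ.mem (b + (32 * i + a.code)) =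
      if a = .input ∧ i < j then w.getD i 0 else 0) :
    ∃ m σ', m ≤ k * 200 + 4 ∧
      Run (.while (.sub (.reg 1) (.reg 2))
        (.seq (.store (address .input (.reg 2)) (.mem (.reg 2)))
          (.assign 2 (.add (.reg 2) (.const 1))))) σ m σ' ∧
      σ'.out = σ.out ∧ σ'.reg 0 = n ∧ σ'.reg 1 = b ∧
      ∀ a : Cell, ∀ i, σ'.mem (b + (32 * i + a.code)) = (inputStore w).arr a i := by
  induction k generalizing σ j with
  | zero =>
    refine ⟨4, σ, le_rfl, .while_false (by simp [Expr.eval, h₁, h₂]; omega), rfl, h₀, h₁,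
      fun a i => ?_⟩
    rw [hcell]
    by_cases ha : a = .input
    · by_cases hi : i < j
      · simp [inputStore, ha, hi]
      · have : w.length ≤ i := by omega
        simp [inputStore, ha, hi, this]
    · simp [inputStore, ha]
  | succ k ih =>
    obtain ⟨m, σ', hm, hr, hout, hn, hb, hc⟩ := ih (j + 1) (by omega)
      { σ with
        mem := Function.update σ.mem (b + (32 * j + Cell.input.code)) (σ.mem j)
        reg := Function.update σ.reg 2 (j + 1) }
      (by simpa [Function.update_apply] using h₀) (by simpa [Function.update_apply] using h₁)
      (by simp) (fun i hi => by
        have : i ≠ b + (32 * j + Cell.input.code) := by omega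
        simp only [Function.update_apply, this, if_false]
        exact hin i hi)
      (fun a i => by
        have hiff : (b + (32 * i + a.code) = b + (32 * j + Cell.input.code)) ↔
            (a = .input ∧ i = j) := by
          rw [← Cell.code_injective.eq_iff]
          have := a.code_lt
          have : Cell.input.code = 0 := rfl
          omega
        simp only [Function.update_apply, hiff, hcell]
        by_cases ha : a = .input
        · by_cases hi : i = j
          · simp only [ha, hi, true_and, if_true, Nat.lt_succ_self]
            exact hin j (by omega)
          · have : i < j + 1 ↔ i < j := by omega
            simp [ha, hi, this]
        · simp [ha])
    refine ⟨_, σ', ?_, .while_true (t := ((address .input (.reg 2)).cost + 2 + 1) + 4)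
      (by simp [Expr.eval, h₁, h₂]; omega)
      (.seq (s' := { σ with
          mem := Function.update σ.mem (b + (32 * j + Cell.input.code)) (σ.mem j) })
        ?_ ?_) hr, hout, hn, hb, hc⟩
    · simp only [Expr.cost, address, timesWidth]
      omega
    · have := Run.store (address .input (.reg 2)) (.mem (.reg 2)) σ
      simpa only [address_eval, Expr.eval, h₁, h₂, Expr.cost] using this
    · have := Run.assign 2 (.add (.reg 2) (.const 1))
        { σ with mem := Function.update σ.mem (b + (32 * j + Cell.input.code)) (σ.mem j) }
      simpa only [Expr.eval, h₂, Expr.cost] using this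

theorem prologue_run (w : List ℕ) (n : ℕ) (hw : w.length = n * n + 3) (hn : w.getD 2 0 = n) :
    ∃ m σ, m ≤ 200 * (n * n) + 10 * n + 700 ∧ Run prologue (init w) m σ ∧
      Represents n (n * n + 3) (inputStore w) σ := by
  obtain ⟨m₁, σ₁, hm₁, hr₁, hmem₁, hout₁, hn₁, hb₁, hc₁⟩ := run_square n n
    { init w with
      reg := Function.update (Function.update (Function.update (init w).reg 0 n) 1 3) 2 n }
    (by simp) (by simp)
  have hb : σ₁.reg 1 = n * n + 3 := by
    rw [hb₁]
    simp
    ring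
  have hmem : ∀ i, σ₁.mem i = w.getD i 0 := fun i => by rw [hmem₁]; rfl
  obtain ⟨m₂, σ₂, hm₂, hr₂, hout₂, hn₂, hb₂, hc₂⟩ := run_copy w n (n * n + 3) hw (n * n + 3) 0
    (by omega) σ₁ hn₁ hb hc₁ (fun i _ => hmem i) (fun a i => by
      have : w.length ≤ n * n + 3 + (32 * i + a.code) := by omega
      simp [hmem, this])
  refine ⟨_, σ₂, ?_, .seq (.assign _ _ _) (.seq (.assign _ _ _) (.seq (.assign _ _ _)
    (.seq (s' := σ₁) (t := m₁) ?_ hr₂))), hn₂, hb₂, hc₂, ?_⟩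
  · simp only [Expr.cost]
    omega
  · convert hr₁ using 2
    simp only [Expr.eval]
    have : (init w).mem 2 = n := hn
    simp [this]
  · rw [hout₂, hout₁]
    rfl

open Polynomial in
/-- Every bounded loop program is computed by a random access machine in polynomial time. -/
theorem exists_program (P : Cmd) :
    ∃ (Q : Program) (q : Polynomial ℕ), ∀ (w : List ℕ) (n : ℕ), w.length = n * n + 3 →
      w.getD 2 0 = n → Q.OutputsWithin w (P.sem n (inputStore w)).out (q.eval n) := by
  obtain ⟨q, hq⟩ := P.compile_run 0
  refine ⟨.seq prologue (P.compile 0), C 200 * (X * X) + C 10 * X + C 700 + q,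
    fun w n hw hn => ?_⟩
  obtain ⟨m, σ, hm, hr, hR⟩ := prologue_run w n hw hn
  obtain ⟨m', σ', hm', hr', hR', -⟩ := hq _ _ _ _ hR
  refine ⟨m + m', σ', ?_, .seq hr hr', hR'.out⟩
  simp only [eval_add, eval_mul, eval_C, eval_X]
  omega

end BoundedLoop

/-! ## Rooted trees given by parent maps -/

namespace LeafyKernel

variable {V : Type*}

/-- Iterating `p` leads from every vertex to `r`, where it stays. -/
structure IsTreeMap (r : V) (p : V → V) : Prop where
  root : p r = r
  reach : ∀ v, ∃ m, p^[m] v = r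

/-- `u` is `v` or an ancestor of `v`. -/
def Anc (p : V → V) (u v : V) : Prop := ∃ m, p^[m] v = u

section Ancestors

variable {r : V} {p : V → V} {u v w : V}

theorem Anc.refl (p : V → V) (u : V) : Anc p u u := ⟨0, rfl⟩

theorem Anc.trans (h : Anc p u v) (h' : Anc p v w) : Anc p u w := by
  obtain ⟨a, rfl⟩ := h
  obtain ⟨b, rfl⟩ := h'
  exact ⟨a + b, Function.iterate_add_apply p a b w⟩

theorem anc_parent (p : V → V) (v : V) : Anc p (p v) v := ⟨1, rfl⟩

theorem Anc.parent_of_ne (h : Anc p u v) (hne : u ≠ v) : Anc p u (p v) := by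
  obtain ⟨m, hm⟩ := h
  cases m with
  | zero => exact absurd hm.symm hne
  | succ m => exact ⟨m, hm⟩

theorem Anc.total (h : Anc p u w) (h' : Anc p v w) : Anc p u v ∨ Anc p v u := by
  obtain ⟨a, rfl⟩ := h
  obtain ⟨b, rfl⟩ := h'
  rcases le_total a b with hab | hab
  · right
    exact ⟨b - a, by rw [← Function.iterate_add_apply, Nat.sub_add_cancel hab]⟩
  · left
    exact ⟨a - b, by rw [← Function.iterate_add_apply, Nat.sub_add_cancel hab]⟩

/-- A path downwards from `x` to `y` along tree arcs. -/
theorem Anc.reflTransGen {E : V → V → Prop} (h : Anc p u v)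
    (hE : ∀ w, w ≠ u → Anc p u w → Anc p w v → E (p w) w) : Relation.ReflTransGen E u v := by
  obtain ⟨m, hm⟩ := h
  induction m generalizing v with
  | zero =>
    rw [← hm]
    exact .refl
  | succ m ih =>
    by_cases hv : v = u
    · rw [hv]
    · refine .tail (ih (fun w h₁ h₂ h₃ => hE w h₁ h₂ (h₃.trans (anc_parent p v))) hm)
        (hE v hv ⟨m + 1, hm⟩ (.refl p v))

/-- Membership propagates downwards from `u` to `v`. -/
theorem Anc.induct {Q : V → Prop} (h : Anc p u v) (hu : Q u)
    (hstep : ∀ w, w ≠ u → Anc p u w → Anc p w v → Q (p w) → Q w) : Q v := by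
  obtain ⟨m, hm⟩ := h
  induction m generalizing v with
  | zero =>
    rw [← hm] at hu
    exact hu
  | succ m ih =>
    by_cases hv : v = u
    · rwa [hv]
    · exact hstep v hv ⟨m + 1, hm⟩ (.refl p v)
        (ih (fun w h₁ h₂ h₃ => hstep w h₁ h₂ (h₃.trans (anc_parent p v))) hm)

/-- An ancestor is reached in fewer steps than there are vertices. -/
theorem Anc.exists_iterate_lt [Fintype V] (h : Anc p u v) :
    ∃ m < Fintype.card V, p^[m] v = u := by
  classical
  have hex : ∃ m, p^[m] v = u := h
  refine ⟨Nat.find hex, ?_, Nat.find_spec hex⟩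
  by_contra hlt
  rw [not_lt] at hlt
  have hinj : ¬ Function.Injective fun i : Fin (Nat.find hex + 1) => p^[(i : ℕ)] v := by
    intro hi
    have := Fintype.card_le_of_injective _ hi
    simp only [Fintype.card_fin] at this
    omega
  have : ∃ i j : ℕ, i < j ∧ j ≤ Nat.find hex ∧ p^[i] v = p^[j] v := by
    simp only [Function.Injective, not_forall] at hinj
    obtain ⟨i, j, hij, hne⟩ := hinj
    have hne' : (i : ℕ) ≠ j := fun h => hne (Fin.ext h)
    rcases lt_or_gt_of_ne hne' with h₁ | h₁
    · exact ⟨i, j, h₁, by omega, hij⟩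
    · exact ⟨j, i, h₁, by omega, hij.symm⟩
  obtain ⟨i, j, hij, hj, he⟩ := this
  -- Cutting the repetition between `i` and `j` out of the shortest climb would shorten it.
  refine Nat.find_min hex (m := Nat.find hex - j + i) (by omega) ?_
  rw [Function.iterate_add_apply, he, ← Function.iterate_add_apply, Nat.sub_add_cancel hj]
  exact Nat.find_spec hex

namespace IsTreeMap

theorem iterate_root (hp : IsTreeMap r p) (m : ℕ) : p^[m] r = r := Function.iterate_fixed hp.root m

theorem root_anc (hp : IsTreeMap r p) (v : V) : Anc p r v := hp.reach v

theorem eq_root_of_anc (hp : IsTreeMap r p) (h : Anc p u r) : u = r := by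
  obtain ⟨m, rfl⟩ := h
  exact hp.iterate_root m

/-- If `v` reaches the root in `m` steps, then `m` turns around the cycle end both in `v` and, since
the root is fixed and `c * m ≥ m`, in the root. -/
theorem eq_root_of_periodic (hp : IsTreeMap r p) {c : ℕ} (hc : 0 < c) (h : p^[c] v = v) :
    v = r := by
  obtain ⟨m, hm⟩ := hp.reach v
  have h₁ : p^[c * m] v = v := by
    rw [Function.iterate_mul]
    exact Function.iterate_fixed h m
  have h₂ : p^[c * m] v = r := by
    have : c * m = (c * m - m) + m := by
      have : m ≤ c * m := Nat.le_mul_of_pos_left m hc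
      omega
    rw [this, Function.iterate_add_apply, hm, hp.iterate_root]
  exact h₁.symm.trans h₂

theorem antisymm (hp : IsTreeMap r p) (h : Anc p u v) (h' : Anc p v u) : u = v := by
  obtain ⟨a, rfl⟩ := h
  obtain ⟨b, hb⟩ := h'
  rw [← Function.iterate_add_apply] at hb
  rcases Nat.eq_zero_or_pos (b + a) with h0 | h0
  · have : a = 0 := by omega
    rw [this]
    rfl
  · have := hp.eq_root_of_periodic h0 hb
    rw [this, hp.iterate_root]

theorem eq_root_of_fixed (hp : IsTreeMap r p) (h : p v = v) : v = r :=
  hp.eq_root_of_periodic one_pos h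

theorem parent_ne (hp : IsTreeMap r p) (hv : v ≠ r) : p v ≠ v := fun h => hv (hp.eq_root_of_fixed h)

theorem not_anc_parent (hp : IsTreeMap r p) (hv : v ≠ r) : ¬ Anc p v (p v) := fun h =>
  hp.parent_ne hv (hp.antisymm (anc_parent p v) h)

/-- Distinct siblings have no common descendants. -/
theorem sibling_eq (hp : IsTreeMap r p) {c d : V} (hc : c ≠ r) (hd : d ≠ r) (hcd : p c = p d)
    (h : Anc p c v)
    (h' : Anc p d v) : c = d := by
  by_contra hne
  rcases h.total h' with h₁ | h₁
  · have := h₁.parent_of_ne hne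
    rw [← hcd] at this
    exact hp.not_anc_parent hc this
  · have := h₁.parent_of_ne (Ne.symm hne)
    rw [hcd] at this
    exact hp.not_anc_parent hd this

end IsTreeMap

/-- A parent map along a well-founded relation is a tree map. -/
theorem IsTreeMap.of_wellFounded {R : V → V → Prop} (hR : WellFounded R) (hr : p r = r)
    (h : ∀ v, v ≠ r → R (p v) v) : IsTreeMap r p := by
  refine ⟨hr, fun v => ?_⟩
  induction v using hR.induction with
  | _ v ih =>
    by_cases hv : v = r
    · exact ⟨0, hv⟩
    · obtain ⟨m, hm⟩ := ih _ (h v hv)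
      exact ⟨m + 1, hm⟩

end Ancestors

/-! ### Out-branchings and parent maps -/

/-- The arcs from the parents to their children. -/
def branching (r : V) (p : V → V) : Digraph V where
  Adj u v := v ≠ r ∧ p v = u

theorem branching_leaves (r : V) (p : V → V) :
    (branching r p).leaves = {v | ∀ w, w ≠ r → p w ≠ v} := by
  ext v
  simp [Digraph.leaves, branching]

theorem underlying_adj {D : Digraph V} {u v : V} :
    D.underlying.Adj u v ↔ u ≠ v ∧ (D.Adj u v ∨ D.Adj v u) := Iff.rfl

/-- The graph is connected through the root, and sending `v` to the edge between `p v` and `v` maps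
the vertices other than `r` onto the edges, so there are at most `|V| - 1` of them. -/
theorem IsTreeMap.isTree_branching [Finite V] {r : V} {p : V → V} (hp : IsTreeMap r p) :
    (branching r p).underlying.IsTree := by
  have hreach : ∀ v, (branching r p).underlying.Reachable v r := by
    intro v
    obtain ⟨m, hm⟩ := hp.reach v
    induction m generalizing v with
    | zero =>
      rw [← hm]
      exact SimpleGraph.Reachable.refl _
    | succ m ih =>
      by_cases hv : v = r
      · rw [hv]
      · have : (branching r p).underlying.Adj v (p v) :=
          underlying_adj.2 ⟨(hp.parent_ne hv).symm, Or.inr ⟨hv, rfl⟩⟩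
        exact this.reachable.trans (ih _ hm)
  have hconn : (branching r p).underlying.Connected :=
    { preconnected := fun u v => (hreach u).trans (hreach v).symm
      nonempty := ⟨r⟩ }
  rw [SimpleGraph.isTree_iff_connected_and_card]
  refine ⟨hconn, le_antisymm ?_ hconn.card_vert_le_card_edgeSet_add_one⟩
  let φ : {v // v ≠ r} → (branching r p).underlying.edgeSet := fun v =>
    ⟨s(p v, v), underlying_adj.2 ⟨hp.parent_ne v.2, Or.inl ⟨v.2, rfl⟩⟩⟩
  have hφ : Function.Surjective φ := by
    rintro ⟨e, he⟩
    induction e with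
    | _ u v =>
      rcases (underlying_adj.1 he).2 with h | h
      · exact ⟨⟨v, h.1⟩, Subtype.ext (by simp [φ, h.2])⟩
      · exact ⟨⟨u, h.1⟩, Subtype.ext (by simp [φ, h.2, Sym2.eq_swap])⟩
  have h₁ := Nat.card_le_card_of_surjective φ hφ
  have h₂ : Nat.card {v // v ≠ r} + 1 = Nat.card V := by
    classical
    have := Fintype.ofFinite V
    have h₃ : Fintype.card {v // v ≠ r} = Fintype.card V - 1 := by
      simp
    have : 0 < Fintype.card V := Fintype.card_pos_iff.2 ⟨r⟩
    simp only [Nat.card_eq_fintype_card]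
    omega
  omega

theorem IsTreeMap.isOutBranching [Finite V] {D : Digraph V} {r : V} {p : V → V}
    (hp : IsTreeMap r p) (hD : ∀ v, v ≠ r → D.Adj (p v) v) :
    D.IsOutBranching r (branching r p) where
  le := fun u v h => by
    obtain ⟨hv, rfl⟩ := h
    exact hD v hv
  oriented := fun u v h h' => by
    obtain ⟨hv, rfl⟩ := h
    obtain ⟨hu, h'⟩ := h'
    have : p^[2] v = v := h'
    exact hv (hp.eq_root_of_periodic two_pos this)
  isTree := hp.isTree_branching
  root_iff := fun v => by
    constructor
    · intro h
      by_contra hv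
      exact h (p v) ⟨hv, rfl⟩
    · rintro rfl u ⟨h, -⟩
      exact h rfl

/-- Choose an arc into each vertex other than `r`. As `T` is oriented, distinct vertices receive
distinct edges, and a tree has only `|V| - 1` edges, so every arc of `T` is a chosen one. -/
theorem exists_parent_of_isOutBranching [Finite V] {D T : Digraph V} {r : V}
    (hT : D.IsOutBranching r T) :
    ∃ p, IsTreeMap r p ∧ ∀ u v, T.Adj u v ↔ v ≠ r ∧ p v = u := by
  classical
  have hin : ∀ v, v ≠ r → ∃ u, T.Adj u v := fun v hv => by
    by_contra h
    exact hv ((hT.root_iff v).1 (by simpa using h))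
  choose q hq using hin
  let p : V → V := fun v => if hv : v = r then r else q v hv
  have hpr : p r = r := by simp [p]
  have hpa : ∀ v, v ≠ r → T.Adj (p v) v := fun v hv => by simpa [p, hv] using hq v hv
  have hirr : ∀ v, ¬ T.Adj v v := fun v h => hT.oriented v v h h
  let φ : {v // v ≠ r} → T.underlying.edgeSet := fun v =>
    ⟨s(p v, v), underlying_adj.2 ⟨fun h => hirr v (by
      have h' := hpa v v.2
      rwa [show p v = v from h] at h'), Or.inl (hpa v v.2)⟩⟩
  have hinj : Function.Injective φ := by
    rintro ⟨v, hv⟩ ⟨w, hw⟩ h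
    have h' : s(p v, v) = s(p w, w) := congrArg Subtype.val h
    rw [Sym2.eq_iff] at h'
    rcases h' with ⟨-, h'⟩ | ⟨h₁, h₂⟩
    · exact Subtype.ext h'
    · exact absurd (h₁ ▸ hpa v hv) (hT.oriented _ _ (h₂ ▸ hpa w hw))
  have := Fintype.ofFinite V
  have hcard := (SimpleGraph.isTree_iff_connected_and_card.1 hT.isTree).2
  have h₂ : Nat.card {v // v ≠ r} + 1 = Nat.card V := by
    have h₃ : Fintype.card {v // v ≠ r} = Fintype.card V - 1 := by
      simp
    have : 0 < Fintype.card V := Fintype.card_pos_iff.2 ⟨r⟩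
    simp only [Nat.card_eq_fintype_card]
    omega
  have hbij := (Nat.bijective_iff_injective_and_card φ).2 ⟨hinj, by omega⟩
  have huniq : ∀ u v, T.Adj u v ↔ v ≠ r ∧ p v = u := by
    refine fun u v => ⟨fun h => ?_, fun h => h.2 ▸ hpa v h.1⟩
    have hv : v ≠ r := fun hv => (hT.root_iff v).2 hv u h
    refine ⟨hv, ?_⟩
    obtain ⟨⟨w, hw⟩, hφ⟩ := hbij.2
      ⟨s(u, v), underlying_adj.2 ⟨fun he => hirr v (by rwa [show u = v from he] at h), Or.inl h⟩⟩
    have h' : s(p w, w) = s(u, v) := congrArg Subtype.val hφ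
    rw [Sym2.eq_iff] at h'
    rcases h' with ⟨h₁, h₂⟩ | ⟨h₁, h₂⟩
    · rw [← h₂, h₁]
    · have := hpa w hw
      rw [h₁, h₂] at this
      exact absurd h (hT.oriented _ _ this)
  refine ⟨p, ⟨hpr, fun v => ?_⟩, huniq⟩
  obtain ⟨W⟩ := hT.isTree.connected.preconnected r v
  -- Undirected walks suffice: reaching the root under `p` passes along an edge in either direction.
  suffices H : ∀ a b, T.underlying.Walk a b → (∃ m, p^[m] a = r) → ∃ m, p^[m] b = r from
    H r v W ⟨0, rfl⟩
  intro a b W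
  induction W with
  | nil => exact id
  | cons hab _ ih =>
    rintro ⟨m, hm⟩
    refine ih ?_
    rcases hab.2 with h | h
    · exact ⟨m + 1, by rw [Function.iterate_succ_apply, ((huniq _ _).1 h).2, hm]⟩
    · obtain ⟨h₁, h₂⟩ := (huniq _ _).1 h
      cases m with
      | zero => exact absurd hm h₁
      | succ m => exact ⟨m, by rwa [Function.iterate_succ_apply, h₂] at hm⟩

/-! ### Counting leaves -/

section Count

open Finset

variable [Fintype V] {r : V} {p : V → V}

open Classical in
/-- The number of children of `u`. -/
noncomputable def outdeg (r : V) (p : V → V) (u : V) : ℕ := #{v | v ≠ r ∧ p v = u}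

open Classical in
theorem sum_outdeg (r : V) (p : V → V) : ∑ u, outdeg r p u + 1 = Fintype.card V := by
  have h : #({v | v ≠ r} : Finset V) = ∑ u, outdeg r p u := by
    rw [card_eq_sum_card_fiberwise (f := p) (t := univ) (fun _ _ => by simp)]
    exact sum_congr rfl fun u _ => by rw [outdeg, filter_filter]
  rw [← h, filter_ne', card_erase_of_mem (mem_univ r), card_univ]
  have : 0 < Fintype.card V := Fintype.card_pos_iff.2 ⟨r⟩
  omega

open Classical in
/-- The number of leaves. -/
noncomputable def numLeaves (r : V) (p : V → V) : ℕ := #{u | outdeg r p u = 0}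

theorem outdeg_eq_zero {u : V} : outdeg r p u = 0 ↔ ∀ w, w ≠ r → p w ≠ u := by
  classical
  simp [outdeg, filter_eq_empty_iff]

theorem outdeg_eq_one {u : V} :
    outdeg r p u = 1 ↔ ∃ v, (v ≠ r ∧ p v = u) ∧ ∀ w, w ≠ r → p w = u → w = v := by
  classical
  rw [outdeg, card_eq_one]
  constructor
  · rintro ⟨v, hv⟩
    have h : ∀ w, (w ≠ r ∧ p w = u) ↔ w = v := fun w => by
      have := Finset.ext_iff.1 hv w
      simpa using this
    exact ⟨v, (h v).2 rfl, fun w h₁ h₂ => (h w).1 ⟨h₁, h₂⟩⟩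
  · rintro ⟨v, h₁, h₂⟩
    refine ⟨v, ?_⟩
    ext w
    simp only [mem_filter, mem_univ, true_and, mem_singleton]
    exact ⟨fun h => h₂ w h.1 h.2, fun h => h ▸ h₁⟩

theorem numLeaves_eq_ncard : numLeaves r p = (branching r p).leaves.ncard := by
  classical
  rw [branching_leaves, numLeaves, ← Set.ncard_coe_finset]
  congr 1
  ext v
  simp [outdeg_eq_zero]

theorem numLeaves_le : numLeaves r p ≤ Fintype.card V := by
  classical
  exact card_le_univ _

-- Sum the inequality `[d ≠ 1] + 1 ≤ d + 2 * [d = 0]` over the outdegrees `d`, whose sum is `|V| -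
-- 1`.
open Classical in
theorem card_outdeg_ne_one : #{u | outdeg r p u ≠ 1} ≤ 2 * numLeaves r p := by
  have h : ∀ u ∈ (univ : Finset V), (if outdeg r p u ≠ 1 then 1 else 0) + 1 ≤
      outdeg r p u + 2 * (if outdeg r p u = 0 then 1 else 0) := fun u _ => by
    split_ifs <;> omega
  have := sum_le_sum h
  rw [sum_add_distrib, sum_add_distrib, ← mul_sum, ← card_filter, ← card_filter] at this
  simp only [sum_const, card_univ, smul_eq_mul, mul_one] at this
  have h' := sum_outdeg r p
  unfold numLeaves
  omega

-- A vertex of outdegree `d` has `0` children with siblings if `d ≤ 1` and `d` otherwise; this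
-- number plus `2` is at most `2 * d + 2 * [d = 0]`. Summing over all vertices gives the bound.
open Classical in
theorem card_siblings :
    #{v | v ≠ r ∧ ∃ w, w ≠ r ∧ w ≠ v ∧ p w = p v} ≤ 2 * numLeaves r p := by
  rw [card_eq_sum_card_fiberwise (f := p) (t := univ) (fun _ _ => by simp)]
  have h : ∀ u ∈ (univ : Finset V),
      #{v ∈ ({v | v ≠ r ∧ ∃ w, w ≠ r ∧ w ≠ v ∧ p w = p v} : Finset V) | p v = u} + 2 ≤
      2 * outdeg r p u + 2 * (if outdeg r p u = 0 then 1 else 0) := fun u _ => by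
    have hle : #{v ∈ ({v | v ≠ r ∧ ∃ w, w ≠ r ∧ w ≠ v ∧ p w = p v} : Finset V) | p v = u} ≤
        outdeg r p u := card_le_card fun v hv => by
      simp only [mem_filter, mem_univ, true_and] at hv ⊢
      exact ⟨hv.1.1, hv.2⟩
    by_cases h1 : outdeg r p u = 1
    · obtain ⟨v, hv, huniq⟩ := outdeg_eq_one.1 h1
      have : #{v ∈ ({v | v ≠ r ∧ ∃ w, w ≠ r ∧ w ≠ v ∧ p w = p v} : Finset V) | p v = u} = 0 := by
        rw [card_eq_zero, filter_eq_empty_iff]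
        intro x hx hxu
        simp only [mem_filter, mem_univ, true_and] at hx
        obtain ⟨hxr, w, hwr, hwx, hpw⟩ := hx
        exact hwx ((huniq w hwr (hpw.trans hxu)).trans (huniq x hxr hxu).symm)
      rw [this, h1]
      simp
    · split_ifs <;> omega
  have := sum_le_sum h
  rw [sum_add_distrib, sum_add_distrib, ← mul_sum, ← mul_sum, ← card_filter] at this
  simp only [sum_const, card_univ, smul_eq_mul] at this
  have h' := sum_outdeg r p
  unfold numLeaves
  omega

end Count

/-! ### Local search -/

section LocalSearch

variable {E : V → V → Prop} {r : V} {p : V → V}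

/-- `v` is an only child that could be moved below `l`. -/
def Movable (E : V → V → Prop) (r : V) (p : V → V) (l v : V) : Prop :=
  v ≠ r ∧ E l v ∧ p v ≠ l ∧ ∀ w, w ≠ r → p w = p v → w = v

/-- Moving all movable vertices below `l` creates a new leaf. -/
def Improvable (E : V → V → Prop) (r : V) (p : V → V) (l : V) : Prop :=
  ∃ v, Movable E r p l v ∧ ∃ w, w ≠ v ∧ w ≠ r ∧ (Movable E r p l w ∨ p w = l)

open Classical in
noncomputable def move (E : V → V → Prop) (r : V) (p : V → V) (l v : V) : V :=
  if Movable E r p l v then l else p v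

theorem move_adj {l : V} (h : ∀ v, v ≠ r → E (p v) v) :
    ∀ v, v ≠ r → E (move E r p l v) v := fun v hv => by
  unfold move
  split_ifs with hm
  · exact hm.2.1
  · exact h v hv

theorem move_root {l : V} (h : p r = r) : move E r p l r = r := by
  unfold move
  rw [if_neg fun hm => hm.1 rfl, h]

-- The old parents of the moved vertices become leaves; they are distinct, because only children are
-- moved, and were not leaves before. At most the leaf `l` is lost. Hence two moved vertices
-- suffice, or one if `l` already had a child and so was not a leaf.
open Finset in
theorem numLeaves_lt_move [Fintype V] {l : V} (h : Improvable E r p l) :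
    numLeaves r p < numLeaves r (move E r p l) := by
  classical
  let Q : Finset V := {v | Movable E r p l v}
  have hmove : ∀ v, ¬ Movable E r p l v → move E r p l v = p v := fun v hv => if_neg hv
  have hmove' : ∀ v, Movable E r p l v → move E r p l v = l := fun v hv => if_pos hv
  have hsub : (({u | outdeg r p u = 0} : Finset V).erase l) ∪ Q.image p ⊆
      ({u | outdeg r (move E r p l) u = 0} : Finset V) := by
    intro x hx
    rw [mem_union, mem_erase, mem_image] at hx
    simp only [mem_filter, mem_univ, true_and, Q, outdeg_eq_zero] at hx ⊢
    intro w hw hxw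
    by_cases hm : Movable E r p l w
    · rw [hmove' w hm] at hxw
      rcases hx with ⟨hne, -⟩ | ⟨v, hv, rfl⟩
      · exact hne hxw.symm
      · exact hv.2.2.1 hxw.symm
    · rw [hmove w hm] at hxw
      rcases hx with ⟨-, h0⟩ | ⟨v, hv, rfl⟩
      · exact h0 w hw hxw
      · exact hm (hv.2.2.2 w hw hxw ▸ hv)
  have hdisj : Disjoint (({u | outdeg r p u = 0} : Finset V).erase l) (Q.image p) := by
    rw [disjoint_left]
    intro x hx hx'
    rw [mem_image] at hx'
    obtain ⟨v, hv, rfl⟩ := hx'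
    simp only [mem_erase, mem_filter, mem_univ, true_and, outdeg_eq_zero, Q] at hx hv
    exact hx.2 v hv.1 rfl
  have hinj : #(Q.image p) = #Q := card_image_of_injOn fun v hv w hw h => by
    simp only [coe_filter, mem_univ, true_and, Set.mem_ofPred_eq, Q] at hv hw
    exact hw.2.2.2 v hv.1 h
  have hle := card_le_card hsub
  rw [card_union_of_disjoint hdisj, hinj] at hle
  obtain ⟨v, hv, w, hwv, hwr, hw⟩ := h
  have hvQ : v ∈ Q := by simpa [Q] using hv
  have hmain : #({u | outdeg r p u = 0} : Finset V) <
      #(({u | outdeg r p u = 0} : Finset V).erase l) + #Q := by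
    rcases hw with hw | hw
    · have hwQ : w ∈ Q := by simpa [Q] using hw
      have h₁ : 1 < #Q := one_lt_card.2 ⟨w, hwQ, v, hvQ, hwv⟩
      have h₂ := pred_card_le_card_erase (s := ({u | outdeg r p u = 0} : Finset V)) (a := l)
      omega
    · have h₁ : 0 < #Q := card_pos.2 ⟨v, hvQ⟩
      rw [erase_eq_of_notMem]
      · omega
      · simp only [mem_filter, mem_univ, true_and, outdeg_eq_zero]
        exact fun h0 => h0 w hwr hw
  exact hmain.trans_le hle

/-- In a local optimum few vertices have an alternative parent. -/
theorem ncard_alternative_le [Fintype V] (h : ∀ l, ¬ Improvable E r p l) :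
    {v | v ≠ r ∧ ∃ l, E l v ∧ l ≠ p v}.ncard ≤ 3 * numLeaves r p := by
  classical
  have hsub : {v | v ≠ r ∧ ∃ l, E l v ∧ l ≠ p v} ⊆
      {v | v ≠ r ∧ ∃ w, w ≠ r ∧ w ≠ v ∧ p w = p v} ∪ {v | ∃ l, Movable E r p l v} := by
    rintro v ⟨hv, l, hl, hlp⟩
    by_cases hs : ∃ w, w ≠ r ∧ w ≠ v ∧ p w = p v
    · exact Or.inl ⟨hv, hs⟩
    · refine Or.inr ⟨l, hv, hl, hlp.symm, fun w hw hwv => ?_⟩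
      by_contra hne
      exact hs ⟨w, hw, hne, hwv⟩
  have h₁ := Set.ncard_le_ncard hsub (Set.toFinite _)
  have h₂ := Set.ncard_union_le {v | v ≠ r ∧ ∃ w, w ≠ r ∧ w ≠ v ∧ p w = p v}
    {v | ∃ l, Movable E r p l v}
  have h₃ : {v | v ≠ r ∧ ∃ w, w ≠ r ∧ w ≠ v ∧ p w = p v}.ncard ≤ 2 * numLeaves r p := by
    rw [Set.ncard_eq_toFinset_card']
    convert card_siblings (r := r) (p := p) using 2
    ext v
    simp
  -- Choose for every movable vertex a target `l`. By local optimality `l` has no child, so it is a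
  -- leaf, and no two vertices share a target.
  have h₄ : {v | ∃ l, Movable E r p l v}.ncard ≤ numLeaves r p := by
    have hch : ∀ v : {v | ∃ l, Movable E r p l v}, ∃ l, Movable E r p l v := fun v => v.2
    choose g hg using hch
    have hnum : numLeaves r p = {u | outdeg r p u = 0}.ncard := by
      rw [numLeaves, ← Set.ncard_coe_finset]
      simp
    rw [hnum]
    refine Set.ncard_le_ncard_of_injOn
      (fun v => if hv : ∃ l, Movable E r p l v then g ⟨v, hv⟩ else v) ?_ ?_ (Set.toFinite _)
    · rintro v hv
      have hv' : ∃ l, Movable E r p l v := hv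
      simp only [hv', dif_pos, Set.mem_ofPred_eq, outdeg_eq_zero]
      intro w hw hwl
      have hm := hg ⟨v, hv⟩
      by_cases hwv : w = v
      · exact hm.2.2.1 (hwv ▸ hwl)
      · exact h _ ⟨v, hm, w, hwv, hw, Or.inr hwl⟩
    · intro v hv w hw hvw
      have hv' : ∃ l, Movable E r p l v := hv
      have hw' : ∃ l, Movable E r p l w := hw
      simp only [hv', hw', dif_pos] at hvw
      by_contra hne
      have hm := hg ⟨v, hv⟩
      have hm' := hg ⟨w, hw⟩
      rw [← hvw] at hm'
      exact h _ ⟨v, hm, w, Ne.symm hne, hm'.1, Or.inl hm'⟩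
  omega

end LocalSearch

/-! ### Orders that extend the ancestor relation -/

section SiblingOrder

variable {lt : V → V → Prop} {r : V} {p : V → V}

/-- `u` is a proper ancestor of `v`, or `u` and `v` lie below siblings in this order. -/
def SiblingOrder (lt : V → V → Prop) (r : V) (p : V → V) (u v : V) : Prop :=
  (u ≠ v ∧ Anc p u v) ∨
    ∃ c d, lt c d ∧ c ≠ r ∧ d ≠ r ∧ p c = p d ∧ Anc p c u ∧ Anc p d v

theorem siblingOrder_irrefl (hp : IsTreeMap r p) (hlt : ∀ a, ¬ lt a a) (u : V) :
    ¬ SiblingOrder lt r p u u := by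
  rintro (⟨h, -⟩ | ⟨c, d, hcd, hc, hd, hpcd, h₁, h₂⟩)
  · exact h rfl
  · rw [hp.sibling_eq hc hd hpcd h₁ h₂] at hcd
    exact hlt d hcd

/-- When both comparisons are between siblings, their branching points lie above `v` and are
comparable. If `d = c'`, transitivity of `lt` applies; otherwise one of the pairs branches off
higher up and already separates `u` from `w`. -/
theorem siblingOrder_trans (hp : IsTreeMap r p) (hlt : ∀ a b c, lt a b → lt b c → lt a c)
    {u v w : V} (h : SiblingOrder lt r p u v) (h' : SiblingOrder lt r p v w) :
    SiblingOrder lt r p u w := by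
  rcases h with ⟨hne, h⟩ | ⟨c, d, hcd, hc, hd, hpcd, h₁, h₂⟩
  · rcases h' with ⟨hne', h'⟩ | ⟨c, d, hcd, hc, hd, hpcd, h₁, h₂⟩
    · refine Or.inl ⟨?_, h.trans h'⟩
      rintro rfl
      exact hne (hp.antisymm h h')
    · rcases h₁.total h with h₃ | h₃
      · exact Or.inr ⟨c, d, hcd, hc, hd, hpcd, h₃, h₂⟩
      · by_cases huc : u = c
        · exact Or.inr ⟨c, d, hcd, hc, hd, hpcd, huc ▸ .refl p _, h₂⟩
        · have h₄ := h₃.parent_of_ne huc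
          rw [hpcd] at h₄
          refine Or.inl ⟨?_, h₄.trans ((anc_parent p d).trans h₂)⟩
          rintro rfl
          exact hp.not_anc_parent hd (h₂.trans h₄)
  · rcases h' with ⟨hne', h'⟩ | ⟨c', d', hcd', hc', hd', hpcd', h₁', h₂'⟩
    · exact Or.inr ⟨c, d, hcd, hc, hd, hpcd, h₁, h₂.trans h'⟩
    · by_cases hdc : d = c'
      · subst hdc
        exact Or.inr ⟨c, d', hlt _ _ _ hcd hcd', hc, hd', hpcd.trans hpcd', h₁, h₂'⟩
      · rcases h₂.total h₁' with h₃ | h₃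
        · have h₄ := h₃.parent_of_ne hdc
          rw [hpcd'] at h₄
          exact Or.inr ⟨c, d, hcd, hc, hd, hpcd, h₁, h₄.trans ((anc_parent p d').trans h₂')⟩
        · have h₄ := h₃.parent_of_ne (Ne.symm hdc)
          rw [← hpcd] at h₄
          exact Or.inr ⟨c', d', hcd', hc', hd', hpcd', h₄.trans ((anc_parent p c).trans h₁), h₂'⟩

theorem siblingOrder_wellFounded [Finite V] (hp : IsTreeMap r p) (hirr : ∀ a, ¬ lt a a)
    (hlt : ∀ a b c, lt a b → lt b c → lt a c) : WellFounded (SiblingOrder lt r p) := by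
  have : IsTrans V (SiblingOrder lt r p) := ⟨fun _ _ _ => siblingOrder_trans hp hlt⟩
  have : Std.Irrefl (SiblingOrder lt r p) := ⟨siblingOrder_irrefl hp hirr⟩
  exact Finite.wellFounded_of_trans_of_irrefl _

theorem siblingOrder_parent (hp : IsTreeMap r p) {v : V} (hv : v ≠ r) :
    SiblingOrder lt r p (p v) v := Or.inl ⟨hp.parent_ne hv, anc_parent p v⟩

/-- Two vertices neither of which is an ancestor of the other lie below distinct siblings. -/
theorem exists_siblings (hp : IsTreeMap r p) {u v : V} (huv : ¬ Anc p u v) (hvu : ¬ Anc p v u) :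
    ∃ c d, c ≠ d ∧ c ≠ r ∧ d ≠ r ∧ p c = p d ∧ Anc p c u ∧ Anc p d v := by
  classical
  -- Climb from `x` until the next step would reach an ancestor of `y`. Doing this from both sides
  -- ends just below the lowest common ancestor.
  have hcross : ∀ x y, ¬ Anc p x y →
      ∃ c, c ≠ r ∧ Anc p c x ∧ ¬ Anc p c y ∧ Anc p (p c) y := by
    intro x y hxy
    obtain ⟨m, hm⟩ := hp.reach x
    induction m generalizing x with
    | zero =>
      have hx : x = r := hm
      exact absurd (hp.root_anc y) (hx ▸ hxy)
    | succ m ih =>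
      by_cases h : Anc p (p x) y
      · refine ⟨x, ?_, .refl p x, hxy, h⟩
        rintro rfl
        exact hxy (hp.root_anc y)
      · obtain ⟨c, h₁, h₂, h₃⟩ := ih (p x) h hm
        exact ⟨c, h₁, h₂.trans (anc_parent p x), h₃⟩
  obtain ⟨c, hc, hcu, hcv, hcp⟩ := hcross u v huv
  obtain ⟨d, hd, hdv, hdu, hdp⟩ := hcross v u hvu
  refine ⟨c, d, fun h => hcv (h ▸ hdv), hc, hd, ?_, hcu, hdv⟩
  refine hp.antisymm ?_ ?_
  · rcases hcp.total hdv with h | h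
    · exact h.parent_of_ne (fun h' => hdu (h' ▸ (anc_parent p c).trans hcu))
    · exact absurd (h.trans ((anc_parent p c).trans hcu)) hdu
  · rcases hdp.total hcu with h | h
    · exact h.parent_of_ne (fun h' => hcv (h' ▸ (anc_parent p d).trans hdv))
    · exact absurd (h.trans ((anc_parent p d).trans hdv)) hcv

end SiblingOrder

end LeafyKernel

/-! ## Domination -/

namespace LeafyKernel

open Relation

variable {V : Type*} {E : V → V → Prop} {r : V}

theorem _root_.Relation.ReflTransGen.imp {E F : V → V → Prop} {a b : V}
    (h : ReflTransGen E a b) (hEF : ∀ x y, E x y → F x y) : ReflTransGen F a b :=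
  ReflTransGen.mono hEF _ _ h

/-- There is a path from `r` to `w` that avoids `c`. -/
def ReachAvoiding (E : V → V → Prop) (r c w : V) : Prop :=
  r ≠ c ∧ ReflTransGen (fun a b => E a b ∧ b ≠ c) r w

/-- `c ≠ w` and every path from `r` to `w` contains `c`. -/
def StrictDom (E : V → V → Prop) (r c w : V) : Prop := c ≠ w ∧ ¬ ReachAvoiding E r c w

theorem ReachAvoiding.extend {c u w : V} (h : ReachAvoiding E r c u)
    (h' : ReflTransGen (fun a b => E a b ∧ b ≠ c) u w) : ReachAvoiding E r c w :=
  ⟨h.1, h.2.trans h'⟩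

theorem ReachAvoiding.ne {c w : V} (h : ReachAvoiding E r c w) : w ≠ c := by
  obtain ⟨hr, h⟩ := h
  cases h with
  | refl => exact hr
  | tail _ h => exact h.2

/-- The path to `c` without `a` must meet `b`; its initial part up to `b` still avoids `a`. -/
theorem reachAvoiding_of_strictDom_of_reachAvoiding {a b c : V} (h : ReachAvoiding E r a c)
    (hb : ¬ ReachAvoiding E r b c) : ReachAvoiding E r a b := by
  obtain ⟨hr, h⟩ := h
  by_cases hrb : r = b
  · exact ⟨hr, hrb ▸ .refl⟩
  have key : ∀ w, ReflTransGen (fun x y => E x y ∧ y ≠ a) r w →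
      ReachAvoiding E r a b ∨ ReachAvoiding E r b w := by
    intro w hw
    induction hw with
    | refl => exact Or.inr ⟨hrb, .refl⟩
    | @tail u w huv hw ih =>
      rcases ih with ih | ih
      · exact Or.inl ih
      · by_cases hwb : w = b
        · subst hwb
          exact Or.inl ⟨hr, huv.tail hw⟩
        · exact Or.inr ⟨hrb, ih.2.tail ⟨hw.1, hwb⟩⟩
  exact (key c h).resolve_right hb

/-- Stop a path to `a` at its first visit to `a` or `b`. This makes strict domination antisymmetric
on reachable vertices. -/
theorem reachAvoiding_or {a b : V} (ha : ReflTransGen E r a) (hne : a ≠ b) :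
    ReachAvoiding E r b a ∨ ReachAvoiding E r a b := by
  by_cases hra : r = a
  · subst hra
    exact Or.inl ⟨hne, .refl⟩
  by_cases hrb : r = b
  · subst hrb
    exact Or.inr ⟨Ne.symm hne, .refl⟩
  have key : ∀ w, ReflTransGen E r w →
      (ReachAvoiding E r b a ∨ ReachAvoiding E r a b) ∨
        ReflTransGen (fun x y => E x y ∧ y ≠ a ∧ y ≠ b) r w := by
    intro w hw
    induction hw with
    | refl => exact Or.inr .refl
    | @tail u w huv hw ih =>
      rcases ih with ih | ih
      · exact Or.inl ih
      · by_cases hwa : w = a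
        · subst hwa
          exact Or.inl (Or.inl ⟨hrb, (ih.imp fun _ _ h => ⟨h.1, h.2.2⟩).tail ⟨hw, hne⟩⟩)
        · by_cases hwb : w = b
          · subst hwb
            exact Or.inl (Or.inr ⟨hra, (ih.imp fun _ _ h => ⟨h.1, h.2.1⟩).tail ⟨hw, hwa⟩⟩)
          · exact Or.inr (ih.tail ⟨hw, hwa, hwb⟩)
  rcases key a ha with h | h
  · exact h
  · cases h with
    | refl => exact absurd rfl hra
    | tail _ h => exact absurd rfl h.2.1

theorem StrictDom.trans {a b c : V} (ha : ReflTransGen E r a) (h : StrictDom E r a b)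
    (h' : StrictDom E r b c) : StrictDom E r a c := by
  refine ⟨?_, fun hac => h.2 (reachAvoiding_of_strictDom_of_reachAvoiding hac h'.2)⟩
  rintro rfl
  rcases reachAvoiding_or ha h.1 with h₁ | h₁
  · exact h'.2 h₁
  · exact h.2 h₁

/-- Ancestors of `v` in a tree of arcs include its dominators. -/
theorem StrictDom.anc {p : V → V} (hp : IsTreeMap r p) (hE : ∀ v, v ≠ r → E (p v) v) {c v : V}
    (h : StrictDom E r c v) : Anc p c v := by
  by_contra hc
  refine h.2 ⟨fun hr => hc (hr ▸ hp.root_anc v), (hp.root_anc v).reflTransGen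
    fun w hw _ hwv => ⟨hE w hw, ?_⟩⟩
  rintro rfl
  exact hc hwv

theorem IsTreeMap.reflTransGen {p : V → V} (hp : IsTreeMap r p) (hE : ∀ v, v ≠ r → E (p v) v)
    (v : V) : ReflTransGen E r v :=
  (hp.root_anc v).reflTransGen fun w hw _ _ => hE w hw

/-- An arc that occurs in an out-branching avoids its head. -/
theorem IsTreeMap.reachAvoiding_parent {p : V → V} (hp : IsTreeMap r p)
    (hE : ∀ v, v ≠ r → E (p v) v) {v : V} (hv : v ≠ r) : ReachAvoiding E r v (p v) :=
  ⟨Ne.symm hv, (hp.root_anc _).reflTransGen fun w hw _ hwv => ⟨hE w hw, by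
    rintro rfl
    exact hp.not_anc_parent hv hwv⟩⟩

/-! ### Growing a low-high order -/

section Growth

variable {A : Set V}

/-- `x ∈ A` strictly dominates `w` and reaches it outside `A`. -/
def Witness (E : V → V → Prop) (r : V) (A : Set V) (x w : V) : Prop :=
  x ∈ A ∧ StrictDom E r x w ∧ ReflTransGen (fun a b => E a b ∧ b ∉ A) x w

/-- Every vertex outside `A` has a witness. -/
def Open (E : V → V → Prop) (r : V) (A : Set V) : Prop := ∀ w, w ∉ A → ∃ x, Witness E r A x w

theorem open_singleton (h : ∀ v, ReflTransGen E r v) : Open E r {r} := by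
  intro w hw
  refine ⟨r, rfl, ⟨fun h => hw h.symm, fun h => h.1 rfl⟩, ?_⟩
  have key : ∀ v, ReflTransGen E r v → ReflTransGen (fun a b => E a b ∧ b ∉ ({r} : Set V)) r v := by
    intro v hv
    induction hv with
    | refl => exact .refl
    | @tail u v _ huv ih =>
      by_cases hvr : v = r
      · subst hvr
        exact .refl
      · exact ih.tail ⟨huv, hvr⟩
  exact key w (h w)

/-- Of two distinct witnesses one is reached without the other, and its path to `v` outside `A` also
avoids the other, which therefore does not dominate `v`. -/
theorem Witness.unique (h : ∀ v, ReflTransGen E r v) {x y v : V} (hx : Witness E r A x v)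
    (hy : Witness E r A y v) : x = y := by
  by_contra hne
  rcases reachAvoiding_or (h x) hne with h₁ | h₁
  · exact hy.2.1.2 (h₁.extend (hx.2.2.imp fun a b hab => ⟨hab.1, fun h => hab.2 (h ▸ hy.1)⟩))
  · exact hx.2.1.2 (h₁.extend (hy.2.2.imp fun a b hab => ⟨hab.1, fun h => hab.2 (h ▸ hx.1)⟩))

/-- The witness of the end of a path outside `A` strictly dominates the start of the path. -/
theorem Witness.strictDom_of_reach {x u w : V} (hw : Witness E r A x w) (hu : u ∉ A)
    (h : ReflTransGen (fun a b => E a b ∧ b ∉ A) u w) : StrictDom E r x u :=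
  ⟨fun hxu => hu (hxu ▸ hw.1), fun hr => hw.2.1.2
    (hr.extend (h.imp fun _ _ hab => ⟨hab.1, fun h => hab.2 (h ▸ hw.1)⟩))⟩

/-- Stop the path at its first visit to `v`. The vertex `y` before it becomes the second parent of
`v`. -/
theorem exists_last_arc {x v : V} (h : ReflTransGen (fun a b => E a b ∧ b ∉ A) x v)
    (hne : x ≠ v) : ∃ y, ReflTransGen (fun a b => E a b ∧ b ∉ insert v A) x y ∧ E y v := by
  have key : ∀ w, ReflTransGen (fun a b => E a b ∧ b ∉ A) x w →
      ReflTransGen (fun a b => E a b ∧ b ∉ insert v A) x w ∨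
        ∃ y, ReflTransGen (fun a b => E a b ∧ b ∉ insert v A) x y ∧ E y v := by
    intro w hw
    induction hw with
    | refl => exact Or.inl .refl
    | @tail u w _ huw ih =>
      rcases ih with ih | ih
      · by_cases hwv : w = v
        · subst hwv
          exact Or.inr ⟨u, ih, huw.1⟩
        · exact Or.inl (ih.tail ⟨huw.1, by simp [hwv, huw.2]⟩)
      · exact Or.inr ih
  rcases key v h with h' | h'
  · cases h' with
    | refl => exact absurd rfl hne
    | tail _ h' => exact absurd (Set.mem_insert v A) h'.2
  · exact h'

/-- The choice of `v` is extremal twice: its witness `x` lies deepest for domination, and among the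
vertices witnessed by `x` that are entered directly from `A`, `v` dominates no other one in the flow
from `x` outside `A`. A vertex `w` that loses its old witness is reached only through `v`, and the
two choices force `v` to dominate it. -/
theorem exists_open_insert [Finite V] (hreach : ∀ v, ReflTransGen E r v) (hr : r ∈ A)
    (hA : Open E r A) (hne : ∃ w, w ∉ A) :
    ∃ v, v ∉ A ∧ (∃ u ∈ A, E u v) ∧ Open E r (insert v A) := by
  let X : Set V := {x | ∃ w, w ∉ A ∧ Witness E r A x w}
  have hX : X.Nonempty := by
    obtain ⟨w, hw⟩ := hne
    obtain ⟨x, hx⟩ := hA w hw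
    exact ⟨x, w, hw, hx⟩
  have hwf : WellFounded fun a b => StrictDom E r b a := by
    have : IsTrans V fun a b => StrictDom E r b a :=
      ⟨fun a b c hab hbc => StrictDom.trans (hreach c) hbc hab⟩
    have : Std.Irrefl fun a b => StrictDom E r b a := ⟨fun a h => h.1 rfl⟩
    exact Finite.wellFounded_of_trans_of_irrefl _
  -- The relation is reversed domination, so no witness in use is strictly dominated by `x`.
  obtain ⟨x, ⟨w₀, hw₀, hxw₀⟩, hxmin⟩ := hwf.has_min X hX
  let F : V → V → Prop := fun a b => E a b ∧ b ∉ A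
  let Z : Set V := {v | v ∉ A ∧ Witness E r A x v ∧ ∃ u ∈ A, E u v}
  have hZ : Z.Nonempty := by
    rcases hxw₀.2.2.cases_head with h | ⟨y, hy, hyw⟩
    · exact absurd (h ▸ hxw₀.1) hw₀
    · exact ⟨y, hy.2, ⟨hxw₀.1, hxw₀.strictDom_of_reach hy.2 hyw, .single hy⟩, x, hxw₀.1, hy.1⟩
  have hwf' : WellFounded fun a b => ReflTransGen F x b ∧ StrictDom F x b a := by
    have : IsTrans V fun a b => ReflTransGen F x b ∧ StrictDom F x b a :=
      ⟨fun a b c hab hbc => ⟨hbc.1, StrictDom.trans hbc.1 hbc.2 hab.2⟩⟩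
    have : Std.Irrefl fun a b => ReflTransGen F x b ∧ StrictDom F x b a :=
      ⟨fun a h => h.2.1 rfl⟩
    exact Finite.wellFounded_of_trans_of_irrefl _
  obtain ⟨v, ⟨hvA, hxv, u, huA, huv⟩, hvmin⟩ := hwf'.has_min Z hZ
  refine ⟨v, hvA, ⟨u, huA, huv⟩, fun w hw => ?_⟩
  rw [Set.mem_insert_iff, not_or] at hw
  obtain ⟨x', hx'⟩ := hA w hw.2
  by_cases hpath : ReflTransGen (fun a b => E a b ∧ b ∉ insert v A) x' w
  · exact ⟨x', Or.inr hx'.1, hx'.2.1, hpath⟩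
  have hsplit : ReflTransGen (fun a b => E a b ∧ b ∉ A) x' v ∧
      ReflTransGen (fun a b => E a b ∧ b ∉ insert v A) v w := by
    have key : ∀ z, ReflTransGen (fun a b => E a b ∧ b ∉ A) x' z →
        ReflTransGen (fun a b => E a b ∧ b ∉ insert v A) x' z ∨
        (ReflTransGen (fun a b => E a b ∧ b ∉ A) x' v ∧
          ReflTransGen (fun a b => E a b ∧ b ∉ insert v A) v z) := by
      intro z hz
      induction hz with
      | refl => exact Or.inl .refl
      | @tail a z haz hz ih =>
        by_cases hzv : z = v
        · subst hzv
          exact Or.inr ⟨haz.tail hz, .refl⟩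
        · have hz' : z ∉ insert v A := by simp [hzv, hz.2]
          rcases ih with ih | ih
          · exact Or.inl (ih.tail ⟨hz.1, hz'⟩)
          · exact Or.inr ⟨ih.1, ih.2.tail ⟨hz.1, hz'⟩⟩
    exact (key w hx'.2.2).resolve_left hpath
  have hweak : ∀ a b, ReflTransGen (fun a b => E a b ∧ b ∉ insert v A) a b →
      ReflTransGen (fun a b => E a b ∧ b ∉ A) a b := fun a b h =>
    h.imp fun _ _ hab => ⟨hab.1, fun hb => hab.2 (Or.inr hb)⟩
  have hxx : x' = x := Witness.unique hreach
    ⟨hx'.1, hx'.strictDom_of_reach hvA (hweak _ _ hsplit.2), hsplit.1⟩ hxv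
  subst hxx
  refine ⟨v, Or.inl rfl, ⟨Ne.symm hw.1, fun hrv => ?_⟩, hsplit.2⟩
  -- Suppose that `w` is reached without `v`, and let `p → q` be the last arc of such a path that
  -- leaves `A`. Then `q` also has the witness `x'` by the depth of `x'`, so the choice of `v` gives
  -- a path from `x'` to `q`, and on to `w`, avoiding `v` and `A`, contrary to `hpath`.
  have hlast : ∀ z, ReflTransGen (fun a b => E a b ∧ b ≠ v) r z → z ∉ A →
      ∃ p ∈ A, ∃ q, q ∉ A ∧ E p q ∧ q ≠ v ∧
        ReflTransGen (fun a b => E a b ∧ b ∉ insert v A) q z := by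
    intro z hz
    induction hz with
    | refl => exact fun h => absurd hr h
    | @tail a z _ haz ih =>
      intro hzA
      by_cases haA : a ∈ A
      · exact ⟨a, haA, z, hzA, haz.1, haz.2, .refl⟩
      · obtain ⟨p, hp, q, h₁, h₂, h₃, h₄⟩ := ih haA
        exact ⟨p, hp, q, h₁, h₂, h₃, h₄.tail ⟨haz.1, by simp [haz.2, hzA]⟩⟩
  obtain ⟨p, hp, q, hqA, hpq, hqv, hqw⟩ := hlast w hrv.2 hw.2
  obtain ⟨y, hy⟩ := hA q hqA
  have hxq : StrictDom E r x' q := hx'.strictDom_of_reach hqA (hweak _ _ hqw)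
  have hyx : y = x' := by
    by_contra hyx
    refine hxmin y ⟨q, hqA, hy⟩ ⟨Ne.symm hyx, fun h => hxq.2 (h.extend
      (hy.2.2.imp fun a b hab => ⟨hab.1, fun h => hab.2 (h ▸ hx'.1)⟩))⟩
  subst hyx
  have hav : ReachAvoiding F y v q := by
    by_contra hav
    exact hvmin q ⟨hqA, hy, p, hp, hpq⟩ ⟨hsplit.1, Ne.symm hqv, hav⟩
  refine hpath (ReflTransGen.trans (hav.2.imp fun a b hab => ⟨hab.1.1, ?_⟩) hqw)
  simp [hab.2, hab.1.2]

end Growth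

/-! ### Independent trees -/

/-- Parent maps `f` and `b` that go backwards and forwards in an order compatible with
domination. -/
structure LowHigh (E : V → V → Prop) (r : V) (f b : V → V) (t : V → ℕ) : Prop where
  inj : Function.Injective t
  f_root : f r = r
  b_root : b r = r
  f_adj : ∀ v, v ≠ r → E (f v) v
  b_adj : ∀ v, v ≠ r → E (b v) v
  f_lt : ∀ v, v ≠ r → t (f v) < t v
  b_path : ∀ v, v ≠ r → ∃ x, StrictDom E r x v ∧ t x < t v ∧
    ReflTransGen (fun a c => E a c ∧ t v < t c) x (b v)

namespace LowHigh

variable {f b : V → V} {t : V → ℕ}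

theorem isTreeMap_f (h : LowHigh E r f b t) : IsTreeMap r f :=
  .of_wellFounded (measure t).wf h.f_root h.f_lt

theorem le_of_anc (h : LowHigh E r f b t) {u v : V} (huv : Anc f u v) : t u ≤ t v := by
  obtain ⟨m, rfl⟩ := huv
  induction m with
  | zero => exact le_rfl
  | succ m ih =>
    rw [Function.iterate_succ_apply']
    by_cases hr : f^[m] v = r
    · rw [hr] at ih ⊢
      rwa [h.f_root]
    · exact (h.f_lt _ hr).le.trans ih

/-- The path to `x` in the tree of `f` only uses vertices that are not later than `x`. -/
theorem reachAvoiding_of_lt (h : LowHigh E r f b t) {x c : V} (hxc : t x < t c) :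
    ReachAvoiding E r c x := by
  refine ⟨?_, (h.isTreeMap_f.root_anc x).reflTransGen fun w hw _ hwx => ⟨h.f_adj w hw, ?_⟩⟩
  · rintro rfl
    exact absurd (h.le_of_anc (h.isTreeMap_f.root_anc x)) (not_le.2 hxc)
  · rintro rfl
    exact absurd (h.le_of_anc hwx) (not_le.2 hxc)

theorem strictDom_b (h : LowHigh E r f b t) {m : ℕ} {z : V} (hz : m < t z) (hb : t (b z) ≤ m) :
    StrictDom E r (b z) z := by
  by_cases hzr : z = r
  · subst hzr
    rw [h.b_root] at hb
    omega
  obtain ⟨x, hx, -, hpath⟩ := h.b_path z hzr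
  cases hpath with
  | refl => exact hx
  | tail _ hlt =>
    have := hlt.2
    omega

theorem strictDom_of_b (h : LowHigh E r f b t) {m : ℕ} {z d : V} (hz : m < t z) (hd : t d ≤ m)
    (hdb : StrictDom E r d (b z)) : StrictDom E r d z := by
  by_cases hzr : z = r
  · subst hzr
    rwa [h.b_root] at hdb
  obtain ⟨x, hx, -, hpath⟩ := h.b_path z hzr
  refine ⟨?_, fun hdz => hdb.2 ?_⟩
  · rintro rfl
    omega
  · refine (reachAvoiding_of_strictDom_of_reachAvoiding hdz hx.2).extend
      (hpath.imp fun a c hac => ⟨hac.1, ?_⟩)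
    rintro rfl
    have := hac.2
    omega

/-- Take for `y` the first vertex with time at most `m` on the climb along `b`. A step of `b` to an
earlier vertex always goes to a strict dominator (`strictDom_b`), and this domination is inherited
back down the later vertices (`strictDom_of_b`). -/
theorem exists_strictDom (h : LowHigh E r f b t) (m : ℕ) (i : ℕ) (z : V) (hz : m < t z)
    (hi : t (b^[i] z) ≤ m) :
    ∃ y, StrictDom E r y z ∧ t y ≤ m ∧ Anc b y z ∧ Anc b (b^[i] z) y := by
  induction i generalizing z with
  | zero =>
    simp only [Function.iterate_zero, id_eq] at hi
    omega
  | succ i ih =>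
    rw [Function.iterate_succ_apply] at hi ⊢
    by_cases hb : t (b z) ≤ m
    · exact ⟨b z, h.strictDom_b hz hb, hb, anc_parent b z, i, rfl⟩
    · obtain ⟨y, h₁, h₂, h₃, h₄⟩ := ih (b z) (not_le.1 hb) hi
      exact ⟨y, h.strictDom_of_b hz h₂ h₁, h₂, h₃.trans (anc_parent b z), h₄⟩

/-- Otherwise `b` has a cycle outside `r`. Let `c` be its earliest vertex. Climbing from `b c`
returns to `c`, which by `exists_strictDom` then strictly dominates `b c`. But `b_path` leads to `b
c` from a vertex earlier than `c` through vertices later than `c`, so `b c` is reached without `c`.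
-/
theorem isTreeMap_b [Finite V] (h : LowHigh E r f b t) : IsTreeMap r b := by
  refine ⟨h.b_root, fun z => ?_⟩
  by_contra hz
  simp only [not_exists] at hz
  obtain ⟨i, j, hij, he⟩ := Finite.exists_ne_map_eq_of_infinite fun i : ℕ => b^[i] z
  obtain ⟨i, l, hl, he⟩ : ∃ i l, 0 < l ∧ b^[l] (b^[i] z) = b^[i] z := by
    rcases lt_or_gt_of_ne hij with hlt | hlt
    · exact ⟨i, j - i, by omega, by
        rw [← Function.iterate_add_apply, Nat.sub_add_cancel hlt.le]
        exact he.symm⟩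
    · exact ⟨j, i - j, by omega, by
        rw [← Function.iterate_add_apply, Nat.sub_add_cancel hlt.le]
        exact he⟩
  obtain ⟨e, hmin⟩ : ∃ e, ∀ e', t (b^[e] (b^[i] z)) ≤ t (b^[e'] (b^[i] z)) :=
    ⟨Function.argmin fun e => t (b^[e] (b^[i] z)), fun e' =>
      Function.argmin_le (fun e => t (b^[e] (b^[i] z))) e'⟩
  obtain ⟨c, hc⟩ : ∃ c, c = b^[e] (b^[i] z) := ⟨_, rfl⟩
  have hcr : c ≠ r := by
    rw [hc, ← Function.iterate_add_apply]
    exact hz _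
  have hper : b^[l] c = c := by
    rw [hc, ← Function.iterate_add_apply, add_comm, Function.iterate_add_apply, he]
  have hminc : ∀ e', t c ≤ t (b^[e'] c) := fun e' => by
    have := hmin (e' + e)
    rwa [Function.iterate_add_apply, ← hc] at this
  obtain ⟨x, hx, hxc, hpath⟩ := h.b_path c hcr
  have hyc : ReachAvoiding E r c (b c) := (h.reachAvoiding_of_lt hxc).extend
    (hpath.imp fun a d had => ⟨had.1, by
      rintro rfl
      exact lt_irrefl _ had.2⟩)
  have hlt : t c < t (b c) :=
    lt_of_le_of_ne (hminc 1) fun he => hyc.ne (h.inj he).symm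
  have hret : b^[l - 1] (b c) = c := by
    rw [← Function.iterate_succ_apply, show (l - 1).succ = l by omega, hper]
  obtain ⟨y, h₁, h₂, ⟨e', h₃⟩, -⟩ := h.exists_strictDom (t c) (l - 1) (b c) hlt (by rw [hret])
  have hy : y = c := h.inj (le_antisymm h₂ (by
    rw [← h₃, ← Function.iterate_succ_apply]
    exact hminc _))
  exact h₁.2 (hy ▸ hyc)

/-- A common ancestor in both trees is a dominator. -/
theorem strictDom_of_anc [Finite V] (h : LowHigh E r f b t) {y z : V} (hne : y ≠ z)
    (hf : Anc f y z) (hb : Anc b y z) : StrictDom E r y z := by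
  have hlt : t y < t z := lt_of_le_of_ne (h.le_of_anc hf) fun he => hne (h.inj he)
  obtain ⟨i, hi⟩ := hb
  obtain ⟨y', h₁, h₂, -, h₄⟩ := h.exists_strictDom (t y) i z hlt (by rw [hi])
  by_cases hy : y' = y
  · exact hy ▸ h₁
  exfalso
  have hlt' : t y' < t y := lt_of_le_of_ne h₂ fun he => hy (h.inj he)
  -- The path from `y` to `z` in the tree of `f` avoids the earlier vertex `y'`, so `y'` dominates
  -- `y` along with `z`. This makes `y'` an ancestor of `y` in the tree of `b`, whereas it lies
  -- below `y` there.
  have hdom : StrictDom E r y' y := ⟨hy, fun hr => h₁.2 (hr.extend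
    (hf.reflTransGen fun w hw hyw _ => ⟨h.f_adj w fun hwr => ?_, ?_⟩))⟩
  · rw [hi] at h₄
    exact hy (h.isTreeMap_b.antisymm (hdom.anc h.isTreeMap_b h.b_adj) h₄)
  · subst hwr
    exact hw (h.isTreeMap_f.eq_root_of_anc hyw).symm
  · rintro rfl
    have := h.le_of_anc hyw
    omega

end LowHigh

/-! ### The structure outside a small set -/

/-- Two independent trees, and a set outside of which the arcs into a vertex come from its parent
or its descendants in either tree. -/
structure Skeleton [Fintype V] (E : V → V → Prop) (r : V) (f b : V → V) (S : Set V) : Prop where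
  hf : IsTreeMap r f
  hb : IsTreeMap r b
  f_adj : ∀ v, v ≠ r → E (f v) v
  b_adj : ∀ v, v ≠ r → E (b v) v
  indep : ∀ y z, y ≠ z → Anc f y z → Anc b y z → StrictDom E r y z
  root_mem : r ∈ S
  b_outdeg : ∀ v, v ∉ S → outdeg r b v = 1
  f_desc : ∀ v, v ∉ S → ∀ u, E u v → u ≠ f v → Anc f v u
  b_desc : ∀ v, v ∉ S → ∀ u, E u v → u ≠ b v → Anc b v u

/-- The vertices of `S` and those with different parents in the two trees. -/
def Marked (f b : V → V) (S : Set V) (v : V) : Prop := v ∈ S ∨ f v ≠ b v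

/-- `m x` is the nearest marked proper ancestor of `x`. -/
def IsNearestMarked (f b : V → V) (S : Set V) (m : V → V) : Prop :=
  ∀ x, Marked f b S (m x) ∧ Anc f (m x) (f x) ∧
    ∀ w, Marked f b S w → Anc f w (f x) → Anc f w (m x)

theorem exists_child_toward {p : V → V} (hp : IsTreeMap r p) {u w : V} (h : Anc p u w)
    (hne : u ≠ w) : ∃ c, c ≠ r ∧ p c = u ∧ Anc p c w := by
  obtain ⟨m, hm⟩ := h
  induction m generalizing w with
  | zero => exact absurd hm.symm hne
  | succ m ih =>
    by_cases hw : p w = u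
    · refine ⟨w, ?_, hw, .refl p w⟩
      rintro rfl
      exact hne (hw.symm.trans hp.root)
    · obtain ⟨c, h₁, h₂, h₃⟩ := ih (Ne.symm hw) hm
      exact ⟨c, h₁, h₂, h₃.trans (anc_parent p w)⟩

namespace Skeleton

variable [Fintype V] {f b : V → V} {S : Set V} {m : V → V}

theorem exists_isNearestMarked (h : Skeleton E r f b S) : ∃ m, IsNearestMarked f b S m := by
  classical
  have : ∀ x, ∃ y, Marked f b S y ∧ Anc f y (f x) ∧
      ∀ w, Marked f b S w → Anc f w (f x) → Anc f w y := by
    intro x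
    have hex : ∃ i, Marked f b S (f^[i] (f x)) := by
      obtain ⟨i, hi⟩ := h.hf.reach (f x)
      exact ⟨i, hi ▸ Or.inl h.root_mem⟩
    refine ⟨_, Nat.find_spec hex, ⟨_, rfl⟩, ?_⟩
    rintro w hw ⟨j, rfl⟩
    have hj := Nat.find_min' hex hw
    exact ⟨j - Nat.find hex, by rw [← Function.iterate_add_apply, Nat.sub_add_cancel hj]⟩
  exact ⟨fun x => (this x).choose, fun x => (this x).choose_spec⟩

theorem ne_root (h : Skeleton E r f b S) {v : V} (hv : v ∉ S) : v ≠ r := fun e =>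
  hv (e ▸ h.root_mem)

/-- The vertices strictly between `x` and its nearest marked ancestor are not marked. -/
theorem not_marked (h : Skeleton E r f b S) (hm : IsNearestMarked f b S m) {x w : V}
    (h₁ : Anc f (m x) w) (h₂ : Anc f w (f x)) (hne : w ≠ m x) : w ∉ S ∧ f w = b w := by
  have : ¬ Marked f b S w := fun hw => hne (h.hf.antisymm ((hm x).2.2 w hw h₂) h₁)
  simpa [Marked] using this

/-- The arc from `f z` to `z` does not come from the parent `b z`, so `f z` lies below `z` in the
tree of `b`. From `m z` down to `f z` the two trees share their arcs, hence `z` lies above this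
whole path in the tree of `b`. -/
theorem anc_b_nearest (h : Skeleton E r f b S) (hm : IsNearestMarked f b S m) {z : V}
    (hz : z ∉ S) (hzb : f z ≠ b z) :
    Anc b z (m z) ∧ z ≠ m z ∧ Anc b (m z) (f z) := by
  have hzr := h.ne_root hz
  have hanc := (hm z).2.1
  have hun : ∀ w, w ≠ m z → Anc f (m z) w → Anc f w (f z) → f w = b w := fun w h₁ h₂ h₃ =>
    (h.not_marked hm h₂ h₃ h₁).2
  refine ⟨?_, ?_, ?_⟩
  · refine hanc.induct (Q := fun w => Anc b z w → Anc b z (m z)) id (fun w h₁ h₂ h₃ ih hzw => ?_)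
      (h.b_desc z hz _ (h.f_adj z hzr) hzb)
    refine ih ?_
    rw [hun w h₁ h₂ h₃]
    refine hzw.parent_of_ne ?_
    rintro rfl
    exact h.hf.not_anc_parent hzr h₃
  · intro he
    rw [← he] at hanc
    exact h.hf.not_anc_parent hzr hanc
  · refine hanc.induct (Q := fun w => Anc b (m z) w) (.refl b _) fun w h₁ h₂ h₃ ih => ?_
    rw [hun w h₁ h₂ h₃] at ih
    exact ih.trans (anc_parent b w)

/-- Otherwise `f y` would be above `w = b (m z)` in both trees, so it would dominate `w`. Since `w`
is reached from `y` below `f y`, it would also dominate `y` and lie above `y` in the tree of `b`,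
where by `anc_b_nearest` it lies below. -/
theorem not_anc_b (h : Skeleton E r f b S) (hm : IsNearestMarked f b S m) {y z : V}
    (hy : y ∉ S) (hyb : f y ≠ b y) (hz : z ∉ S) (hzb : f z ≠ b z) (hzy : m y = z) :
    ¬ Anc f y (b (m z)) := by
  intro hyw
  obtain ⟨w, hw⟩ : ∃ w, w = b (m z) := ⟨_, rfl⟩
  rw [← hw] at hyw
  have hyr := h.ne_root hy
  obtain ⟨hzv, hzne, -⟩ := h.anc_b_nearest hm hz hzb
  have hzw : Anc b z w := hw ▸ hzv.parent_of_ne hzne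
  obtain ⟨hyz, -, hze⟩ := h.anc_b_nearest hm hy hyb
  have hzf := (hm y).2.1
  rw [hzy] at hyz hze hzf
  have hne : ∀ c, Anc f c (f y) → c ≠ w := by
    rintro c hc rfl
    exact h.hf.not_anc_parent hyr (hyw.trans hc)
  have hew : Anc b (f y) w := by
    refine hzf.induct (Q := fun c => Anc b c w) hzw fun c h₁ h₂ h₃ ih => ?_
    have hc := h.not_marked hm (x := y) (hzy ▸ h₂) h₃ (hzy ▸ h₁)
    have hfcS : f c ∉ S := by
      by_cases hfc : f c = z
      · rwa [hfc]
      · exact (h.not_marked hm (x := y) (hzy ▸ h₂.parent_of_ne (Ne.symm h₁))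
          ((anc_parent f c).trans h₃) (hzy ▸ hfc)).1
    -- With a single child at each vertex, the path from `z` to `w` in the tree of `b` has to follow
    -- the shared path down to `f y`.
    obtain ⟨d, -, huniq⟩ := outdeg_eq_one.1 (h.b_outdeg _ hfcS)
    obtain ⟨c', hc'r, hc'p, hc'w⟩ := exists_child_toward h.hb ih (hne _ ((anc_parent f c).trans h₃))
    have : c = c' := (huniq c (h.ne_root hc.1) hc.2.symm).trans (huniq c' hc'r hc'p).symm
    rwa [this]
  have hdom := h.indep (f y) w (hne _ (.refl f _)) ((anc_parent f y).trans hyw) hew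
  have hdom' : StrictDom E r (f y) y := ⟨h.hf.parent_ne hyr, fun hr => hdom.2 (hr.extend
    (hyw.reflTransGen fun c h₁ h₂ _ => ⟨h.f_adj c ?_, ?_⟩))⟩
  · exact h.hf.parent_ne hyr (h.hb.antisymm (hdom'.anc h.hb h.b_adj) (hyz.trans hze))
  · rintro rfl
    exact hyr (h.hf.eq_root_of_anc h₂)
  · rintro rfl
    exact h.hf.not_anc_parent hyr h₂

/-- Any other in-neighbour lies below `v` in both trees, so `v` dominates it by independence. -/
theorem eq_or_eq (h : Skeleton E r f b S) {u v : V} (hv : v ∉ S) (huv : E u v)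
    (hu : ReachAvoiding E r v u) : u = f v ∨ u = b v := by
  by_contra hne
  rw [not_or] at hne
  exact (h.indep v u hu.ne.symm (h.f_desc v hv u huv hne.1) (h.b_desc v hv u huv hne.2)).2 hu

/-- The set to be removed. -/
def modulator (S : Set V) (m : V → V) : Set V := S ∪ m '' S ∪ m '' (m '' S)

theorem ncard_modulator_le (S : Set V) (m : V → V) :
    (modulator S m).ncard ≤ 3 * S.ncard := by
  have h₁ := Set.ncard_union_le (S ∪ m '' S) (m '' (m '' S))
  have h₂ := Set.ncard_union_le S (m '' S)
  have h₃ := Set.ncard_image_le (f := m) (Set.toFinite S)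
  have h₄ := Set.ncard_image_le (f := m) (Set.toFinite (m '' S))
  unfold modulator
  omega

/-- The vertices `v` above `x` for which the arc from `b v` to `v` passes over `x`. -/
def passing (f b : V → V) (S : Set V) (x : V) : Set V :=
  {v | v ∉ S ∧ f v ≠ b v ∧ v ≠ x ∧ Anc f v x ∧ Anc f x (b v)}

theorem exists_next_marked (h : Skeleton E r f b S) (hm : IsNearestMarked f b S m) {v u : V}
    (hv : Marked f b S v) (hu : Marked f b S u) (hvu : Anc f v u) (hne : v ≠ u) :
    ∃ z, Marked f b S z ∧ m z = v ∧ Anc f z u := by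
  -- Without comparisons of siblings this order is the proper ancestor relation.
  have hwf := siblingOrder_wellFounded (lt := fun _ _ => False) h.hf (fun _ => id)
    (fun _ _ _ h _ => h)
  induction u using hwf.induction with
  | _ u ih =>
    have hvm := (hm u).2.2 v hv (hvu.parent_of_ne hne)
    by_cases hmu : m u = v
    · exact ⟨u, hu, hmu, .refl f u⟩
    · have hur : u ≠ r := by
        rintro rfl
        exact hne (h.hf.eq_root_of_anc hvu)
      have hanc : Anc f (m u) u := (hm u).2.1.trans (anc_parent f u)
      have hmne : m u ≠ u := fun he => h.hf.not_anc_parent hur (by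
        have := (hm u).2.1
        rwa [he] at this)
      obtain ⟨z, h₁, h₂, h₃⟩ := ih (m u) (Or.inl ⟨hmne, hanc⟩) (hm u).1 hvm (Ne.symm hmu)
      exact ⟨z, h₁, h₂, h₃.trans hanc⟩

/-- Three passing vertices would form a chain `v₁`, `v₂`, `v₃` above `x`. Below `v₁` there would be
successive marked vertices `z` and `y`, with `m z = v₁` and `m y = z`, such that `y` is above `v₃`.
They are not in `S`, because `v₁` is outside the images `m '' S` and `m '' (m '' S)`. Then
`not_anc_b` forbids `y` to lie above `b v₁`, which is below `x`. -/
theorem ncard_passing_le (h : Skeleton E r f b S) (hm : IsNearestMarked f b S m) (x : V) :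
    (passing f b (modulator S m) x).ncard ≤ 2 := by
  by_contra hlt
  rw [not_le, Set.two_lt_ncard_iff] at hlt
  obtain ⟨a, c, d, ha, hc, hd, hac, had, hcd⟩ := hlt
  have key : ∀ v₁ v₂ v₃, v₁ ∈ passing f b (modulator S m) x →
      v₂ ∈ passing f b (modulator S m) x → v₃ ∈ passing f b (modulator S m) x →
      v₁ ≠ v₂ → v₂ ≠ v₃ → Anc f v₁ v₂ → Anc f v₂ v₃ → False := by
    intro v₁ v₂ v₃ h₁ h₂ h₃ hne hne' h₁₂ h₂₃
    obtain ⟨z, hz, hzm, hz₂⟩ := h.exists_next_marked hm (Or.inr h₁.2.1) (Or.inr h₂.2.1) h₁₂ hne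
    have hz₃ : z ≠ v₃ := by
      rintro rfl
      exact hne' (h.hf.antisymm h₂₃ hz₂)
    obtain ⟨y, hy, hym, hy₃⟩ := h.exists_next_marked hm hz (Or.inr h₃.2.1) (hz₂.trans h₂₃) hz₃
    have hzS : z ∉ S := fun hzS => h₁.1 (Or.inl (Or.inr ⟨z, hzS, hzm⟩))
    have hyS : y ∉ S := fun hyS => h₁.1 (Or.inr ⟨z, ⟨y, hyS, hym⟩, hzm⟩)
    refine h.not_anc_b hm hyS (hy.resolve_left hyS) hzS (hz.resolve_left hzS) hym ?_
    rw [hzm]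
    exact hy₃.trans (h₃.2.2.2.1.trans h₁.2.2.2.2)
  -- All three are ancestors of `x`, hence comparable; each case sorts them.
  rcases ha.2.2.2.1.total hc.2.2.2.1 with h₁ | h₁ <;>
  rcases hc.2.2.2.1.total hd.2.2.2.1 with h₂ | h₂ <;>
  rcases ha.2.2.2.1.total hd.2.2.2.1 with h₃ | h₃
  · exact key a c d ha hc hd hac hcd h₁ h₂
  · exact key a c d ha hc hd hac hcd h₁ h₂
  · exact key a d c ha hd hc had hcd.symm h₃ h₂
  · exact key d a c hd ha hc had.symm hac h₃ h₁
  · exact key c a d hc ha hd hac.symm had h₁ h₃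
  · exact key c d a hc hd ha hcd had.symm h₂ h₃
  · exact key d c a hd hc ha hcd.symm hac.symm h₂ h₁
  · exact key d c a hd hc ha hcd.symm hac.symm h₂ h₁

end Skeleton

/-! ### The tree decomposition -/

/-- Climbing from any vertex of `s` stays in `s` until it meets `v`. -/
theorem connected_induce_branching [Finite V] {f : V → V} (s : Set V) {v : V} (hv : v ∈ s)
    (hs : ∀ x ∈ s, x ≠ v → x ≠ r ∧ f x ∈ s ∧ f x ≠ x) (hanc : ∀ x ∈ s, Anc f v x) :
    ((branching r f).underlying.induce s).Connected := by
  have hreach : ∀ x : s, ((branching r f).underlying.induce s).Reachable x ⟨v, hv⟩ := by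
    rintro ⟨x, hx⟩
    obtain ⟨i, hi⟩ := hanc x hx
    induction i generalizing x with
    | zero =>
      have : x = v := hi
      subst this
      exact .refl _
    | succ i ih =>
      by_cases hxv : x = v
      · subst hxv
        exact .refl _
      · obtain ⟨h₁, h₂, h₃⟩ := hs x hx hxv
        have hadj : ((branching r f).underlying.induce s).Adj ⟨x, hx⟩ ⟨f x, h₂⟩ :=
          underlying_adj.2 ⟨Ne.symm h₃, Or.inr ⟨h₁, rfl⟩⟩
        exact hadj.reachable.trans (ih (f x) h₂ hi)
  exact { preconnected := fun x y => (hreach x).trans (hreach y).symm, nonempty := ⟨⟨v, hv⟩⟩ }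

theorem treewidth_le_of_bags {W : Type*} {G : SimpleGraph W} (X : G.TreeDecomposition) {k : ℕ}
    (h : ∀ i, (X.bag i).encard ≤ k + 1) : G.treewidth ≤ k :=
  (iInf_le _ X).trans (iSup_le fun i => tsub_le_iff_right.2 (h i))

/-- The arcs that occur on a path from `r`. -/
def useful (D : Digraph V) (r : V) : Digraph V where
  Adj u v := D.Adj u v ∧ ReachAvoiding D.Adj r v u

theorem Skeleton.exists_modulator {V : Type} [Fintype V] {D : Digraph V} {r : V} {f b : V → V}
    {S : Set V} (h : Skeleton D.Adj r f b S) :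
    ∃ S' : Set V, S'.ncard ≤ 3 * S.ncard ∧
      ((useful D r).inducedOn S'ᶜ).underlying.treewidth ≤ 3 := by
  obtain ⟨m, hm⟩ := h.exists_isNearestMarked
  refine ⟨modulator S m, ncard_modulator_le S m, ?_⟩
  have hSS : ∀ v, v ∉ modulator S m → v ∉ S := fun v hv hS => hv (Or.inl (Or.inl hS))
  let bag : V → Set ↥(modulator S m)ᶜ := fun x =>
    {v | (v : V) = x ∨ (v : V) = f x ∨ (v : V) ∈ passing f b (modulator S m) x}
  have harc : ∀ u v : ↥(modulator S m)ᶜ, ((useful D r).inducedOn (modulator S m)ᶜ).Adj u v →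
      ∃ i, u ∈ bag i ∧ v ∈ bag i := by
    rintro ⟨u, hu⟩ ⟨v, hv⟩ ⟨h₁, h₂⟩
    have hvS := hSS v hv
    have huv : u = f v ∨ u = b v := h.eq_or_eq hvS h₁ h₂
    by_cases huf : u = f v
    · exact ⟨v, Or.inr (Or.inl huf), Or.inl rfl⟩
    · have hub := huv.resolve_left huf
      -- The arc comes from `b v`, which lies below `v` in the tree of `f`, so `v` passes over `u =
      -- b v` itself.
      refine ⟨u, Or.inl rfl, Or.inr (Or.inr ⟨hv, fun he => huf (hub.trans he.symm), h₂.ne.symm,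
        h.f_desc v hvS u h₁ huf, ?_⟩)⟩
      rw [hub]
      exact .refl f _
  let X : ((useful D r).inducedOn (modulator S m)ᶜ).underlying.TreeDecomposition :=
    { Node := V
      finite_node := inferInstance
      tree := (branching r f).underlying
      isTree := h.hf.isTree_branching
      bag := bag
      exists_mem_bag := fun v => ⟨v, Or.inl rfl⟩
      exists_edge_bag := fun v w hvw => by
        rcases (underlying_adj.1 hvw).2 with h' | h'
        · exact harc v w h'
        · obtain ⟨i, h₁, h₂⟩ := harc w v h'
          exact ⟨i, h₂, h₁⟩
      connected_nodes := fun v => by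
        have hvr := h.ne_root (hSS v v.2)
        refine connected_induce_branching (v := (v : V)) _ (Or.inl rfl) ?_ ?_
        · rintro x (hx | hx | hx) hxv
          · exact absurd hx.symm hxv
          · have hxr : x ≠ r := by
              rintro rfl
              exact hvr (hx.trans h.hf.root)
            exact ⟨hxr, Or.inl hx, h.hf.parent_ne hxr⟩
          · have hxr : x ≠ r := by
              rintro rfl
              exact hvr (h.hf.eq_root_of_anc hx.2.2.2.1)
            refine ⟨hxr, ?_, h.hf.parent_ne hxr⟩
            by_cases hfx : (v : V) = f x
            · exact Or.inl hfx
            · exact Or.inr (Or.inr ⟨hx.1, hx.2.1, hfx, hx.2.2.2.1.parent_of_ne hx.2.2.1,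
                (anc_parent f x).trans hx.2.2.2.2⟩)
        · rintro x (hx | hx | hx)
          · exact hx ▸ .refl f _
          · exact hx ▸ anc_parent f x
          · exact hx.2.2.2.1 }
  refine treewidth_le_of_bags X fun x => ?_
  have hle : (Subtype.val '' bag x) ⊆ {x, f x} ∪ passing f b (modulator S m) x := by
    rintro _ ⟨v, hv, rfl⟩
    rcases hv with hv | hv | hv
    · exact Or.inl (Or.inl hv)
    · exact Or.inl (Or.inr hv)
    · exact Or.inr hv
  have h₁ : (bag x).encard = (Subtype.val '' bag x).encard :=
    (Subtype.val_injective.encard_image _).symm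
  have h₂ : (passing f b (modulator S m) x).encard ≤ 2 := by
    rw [← (Set.toFinite _).cast_ncard_eq]
    exact_mod_cast h.ncard_passing_le hm x
  calc (bag x).encard ≤ ({x, f x} ∪ passing f b (modulator S m) x).encard := by
        rw [h₁]
        exact Set.encard_le_encard hle
    _ ≤ ({x, f x} : Set V).encard + (passing f b (modulator S m) x).encard :=
        Set.encard_union_le _ _
    _ ≤ 2 + 2 := add_le_add ((Set.encard_insert_le _ _).trans (by simp [one_add_one_eq_two])) h₂
    _ = (3 : ℕ) + 1 := by norm_num

end LeafyKernel

/-! ## The combinatorial core of the kernel -/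

namespace LeafyKernel

open Relation

section Outcome

variable {V : Type*} [Fintype V] {E : V → V → Prop} {r : V} {k : ℕ}

/-- A local search from `p₀`, along arcs that are compatible with a sibling order, ended in a tree
with fewer than `k` leaves. -/
def Stuck (E : V → V → Prop) (r : V) (k : ℕ) (lt : V → V → Prop) (p₀ : V → V) : Prop :=
  ∃ p, numLeaves r p₀ ≤ numLeaves r p ∧ numLeaves r p < k ∧
    ∀ l, ¬ Improvable (fun u v => E u v ∧ SiblingOrder lt r p₀ u v) r p l

theorem Stuck.ncard_le {lt : V → V → Prop} {p₀ : V → V} (h : Stuck E r k lt p₀)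
    (hp : IsTreeMap r p₀) (hE : ∀ v, v ≠ r → E (p₀ v) v) :
    {v | v ≠ r ∧ ∃ u, E u v ∧ u ≠ p₀ v ∧ SiblingOrder lt r p₀ u v}.ncard ≤ 3 * k := by
  obtain ⟨p, -, hlt, hopt⟩ := h
  refine (Set.ncard_le_ncard ?_ (Set.toFinite _)).trans
    ((ncard_alternative_le hopt).trans (Nat.mul_le_mul_left 3 hlt.le))
  rintro v ⟨hv, u, huv, hne, hs⟩
  -- The search may have replaced the parent `p₀ v` by `u`; then `p₀ v` is the alternative at the
  -- end.
  by_cases hu : u = p v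
  · exact ⟨hv, p₀ v, ⟨hE v hv, siblingOrder_parent hp hv⟩, fun he => hne (hu.trans he.symm)⟩
  · exact ⟨hv, u, ⟨huv, hs⟩, hu⟩

/-- If `u` is not below `v`, then it is above `v` or below a sibling branch, so one of the two
directions puts `u` before `v`. Each direction contributes `3 * k`. -/
theorem ncard_not_desc_le [LinearOrder V] {p : V → V} (h : Stuck E r k (· < ·) p)
    (h' : Stuck E r k (fun a b => b < a) p) (hp : IsTreeMap r p)
    (hE : ∀ v, v ≠ r → E (p v) v) :
    {v | v ≠ r ∧ ∃ u, E u v ∧ u ≠ p v ∧ ¬ Anc p v u}.ncard ≤ 6 * k := by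
  have hsub : {v | v ≠ r ∧ ∃ u, E u v ∧ u ≠ p v ∧ ¬ Anc p v u} ⊆
      {v | v ≠ r ∧ ∃ u, E u v ∧ u ≠ p v ∧ SiblingOrder (· < ·) r p u v} ∪
      {v | v ≠ r ∧ ∃ u, E u v ∧ u ≠ p v ∧ SiblingOrder (fun a b => b < a) r p u v} := by
    rintro v ⟨hv, u, huv, hne, hanc⟩
    by_cases hua : Anc p u v
    · refine Or.inl ⟨hv, u, huv, hne, Or.inl ⟨?_, hua⟩⟩
      rintro rfl
      exact hanc (.refl p u)
    · obtain ⟨c, d, hcd, hc, hd, hpcd, hcu, hdv⟩ := exists_siblings hp hua hanc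
      rcases lt_or_gt_of_ne hcd with hlt | hlt
      · exact Or.inl ⟨hv, u, huv, hne, Or.inr ⟨c, d, hlt, hc, hd, hpcd, hcu, hdv⟩⟩
      · exact Or.inr ⟨hv, u, huv, hne, Or.inr ⟨c, d, hlt, hc, hd, hpcd, hcu, hdv⟩⟩
  have h₁ := Set.ncard_le_ncard hsub (Set.toFinite _)
  have h₂ := Set.ncard_union_le
    {v | v ≠ r ∧ ∃ u, E u v ∧ u ≠ p v ∧ SiblingOrder (· < ·) r p u v}
    {v | v ≠ r ∧ ∃ u, E u v ∧ u ≠ p v ∧ SiblingOrder (fun a b => b < a) r p u v}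
  have h₃ := h.ncard_le hp hE
  have h₄ := h'.ncard_le hp hE
  omega

/-- The constant is `1 ≤ k` for the root, `2 * k` for the outdegrees in the tree of `b`, which has
fewer than `k` leaves, and `6 * k` for each of the two trees. -/
theorem exists_skeleton [LinearOrder V] {f b : V → V} {t : V → ℕ} (h : LowHigh E r f b t)
    (hk : 0 < k) (hf : Stuck E r k (· < ·) f) (hf' : Stuck E r k (fun a b => b < a) f)
    (hb : Stuck E r k (· < ·) b) (hb' : Stuck E r k (fun a b => b < a) b) :
    ∃ S, Skeleton E r f b S ∧ S.ncard ≤ 15 * k := by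
  classical
  have h₁ := ncard_not_desc_le hf hf' h.isTreeMap_f h.f_adj
  have h₂ := ncard_not_desc_le hb hb' h.isTreeMap_b h.b_adj
  have h₃ : {v | outdeg r b v ≠ 1}.ncard ≤ 2 * k := by
    obtain ⟨p, hle, hlt, -⟩ := hb
    have := card_outdeg_ne_one (r := r) (p := b)
    have he : {v | outdeg r b v ≠ 1}.ncard =
        (Finset.univ.filter fun v => outdeg r b v ≠ 1).card := by
      rw [← Set.ncard_coe_finset]
      simp
    omega
  refine ⟨({r} ∪ {v | outdeg r b v ≠ 1}) ∪
    ({v | v ≠ r ∧ ∃ u, E u v ∧ u ≠ f v ∧ ¬ Anc f v u} ∪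
      {v | v ≠ r ∧ ∃ u, E u v ∧ u ≠ b v ∧ ¬ Anc b v u}), ?_, ?_⟩
  · refine ⟨h.isTreeMap_f, h.isTreeMap_b, h.f_adj, h.b_adj,
      fun y z hne h₁ h₂ => h.strictDom_of_anc hne h₁ h₂, Or.inl (Or.inl rfl),
      fun v hv => ?_, fun v hv u huv hne => ?_, fun v hv u huv hne => ?_⟩
    · by_contra hd
      exact hv (Or.inl (Or.inr hd))
    · by_contra hd
      exact hv (Or.inr (Or.inl ⟨fun hr => hv (Or.inl (Or.inl hr)), u, huv, hne, hd⟩))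
    · by_contra hd
      exact hv (Or.inr (Or.inr ⟨fun hr => hv (Or.inl (Or.inl hr)), u, huv, hne, hd⟩))
  · refine (Set.ncard_union_le _ _).trans ?_
    have h₄ := Set.ncard_union_le {r} {v | outdeg r b v ≠ 1}
    have h₅ := Set.ncard_union_le {v | v ≠ r ∧ ∃ u, E u v ∧ u ≠ f v ∧ ¬ Anc f v u}
      {v | v ≠ r ∧ ∃ u, E u v ∧ u ≠ b v ∧ ¬ Anc b v u}
    rw [Set.ncard_singleton] at h₄
    omega

end Outcome

/-! ### Useless arcs and minors -/

theorem useful_le {V : Type*} (D : Digraph V) (r : V) : useful D r ≤ D := fun _ _ h => h.1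

theorem isMinorOf_mono {V W : Type*} {H : SimpleGraph W} {G G' : SimpleGraph V} (hG : G ≤ G')
    (h : H.IsMinorOf G) : H.IsMinorOf G' := by
  obtain ⟨B, h₁, h₂, h₃⟩ := h
  refine ⟨B, fun a => (h₁ a).mono fun u v huv => hG huv, h₂, fun a b hab => ?_⟩
  obtain ⟨u, hu, v, hv, huv⟩ := h₃ a b hab
  exact ⟨u, hu, v, hv, hG huv⟩

/-- The tree path from the root to the parent of `v` avoids `v`. -/
theorem isOutBranching_useful {V : Type*} [Finite V] {D T : Digraph V} {r : V}
    (hT : D.IsOutBranching r T) : (useful D r).IsOutBranching r T := by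
  obtain ⟨p, hp, hpT⟩ := exists_parent_of_isOutBranching hT
  refine ⟨fun u v huv => ⟨hT.le huv, ?_⟩, hT.oriented, hT.isTree, hT.root_iff⟩
  obtain ⟨hv, rfl⟩ := (hpT u v).1 huv
  exact hp.reachAvoiding_parent (fun w hw => hT.le ((hpT _ _).2 ⟨hw, rfl⟩)) hv

theorem hasLeafyOutBranching_useful {V : Type*} [Finite V] {D : Digraph V} {r : V} {k : ℕ} :
    D.HasLeafyOutBranching r k ↔ (useful D r).HasLeafyOutBranching r k := by
  constructor
  · rintro ⟨T, hT, hk⟩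
    exact ⟨T, isOutBranching_useful hT, hk⟩
  · rintro ⟨T, hT, hk⟩
    exact ⟨T, ⟨hT.le.trans (useful_le D r), hT.oriented, hT.isTree, hT.root_iff⟩, hk⟩

theorem reflTransGen_of_hasLeafyOutBranching {V : Type*} [Finite V] {D : Digraph V} {r : V}
    {k : ℕ} (h : D.HasLeafyOutBranching r k) (v : V) : ReflTransGen D.Adj r v := by
  obtain ⟨T, hT, -⟩ := h
  obtain ⟨p, hp, hpT⟩ := exists_parent_of_isOutBranching hT
  exact hp.reflTransGen (fun w hw => hT.le ((hpT _ _).2 ⟨hw, rfl⟩)) v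

/-! ### The trivial instance -/

/-- The digraph on two vertices without arcs. -/
def twoIsolated : Digraph (Fin 2) where
  Adj _ _ := False

theorem not_hasLeafyOutBranching_twoIsolated (k : ℕ) :
    ¬ twoIsolated.HasLeafyOutBranching 0 k := fun h => by
  have := reflTransGen_of_hasLeafyOutBranching h 1
  rcases this.cases_tail with h | ⟨c, -, h⟩
  · exact absurd h (by decide)
  · exact h

/-- Such an `H` has no edges and at most two vertices, which can be placed on `u` and `v`. -/
theorem isMinorOf_of_twoIsolated {V W : Type*} {H : SimpleGraph W} {G : SimpleGraph V} {u v : V}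
    (huv : u ≠ v) (h : H.IsMinorOf twoIsolated.underlying) : H.IsMinorOf G := by
  obtain ⟨B, h₁, h₂, h₃⟩ := h
  have hne : ∀ a, ∃ x, x ∈ B a := fun a => by
    obtain ⟨x⟩ := (h₁ a).nonempty
    exact ⟨x, x.2⟩
  choose x hx using hne
  let g : Fin 2 → V := fun i => if i = 0 then u else v
  have hg : Function.Injective g := by
    intro i j hij
    fin_cases i <;> fin_cases j <;> simp_all [g]
  refine ⟨fun a => {g (x a)}, fun a => ?_, fun a b hab => ?_, fun a b hab => ?_⟩
  · exact { preconnected := fun y z => by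
              have : y = z := Subsingleton.elim y z
              rw [this]
            nonempty := ⟨⟨_, rfl⟩⟩ }
  · rw [Set.disjoint_singleton]
    intro he
    have hxx : x a = x b := hg he
    exact Set.disjoint_left.1 (h₂ a b hab) (hx a) (hxx ▸ hx b)
  · obtain ⟨y, -, z, -, hyz⟩ := h₃ a b hab
    exact absurd (underlying_adj.1 hyz).2 (by simp [twoIsolated])

theorem treewidth_le_of_isEmpty {W : Type*} [IsEmpty W] (G : SimpleGraph W) (k : ℕ) :
    G.treewidth ≤ k := by
  let X : G.TreeDecomposition :=
    { Node := Unit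
      finite_node := inferInstance
      tree := ⊥
      isTree := SimpleGraph.IsTree.of_subsingleton
      bag := fun _ => ∅
      exists_mem_bag := fun v => isEmptyElim v
      exists_edge_bag := fun v => isEmptyElim v
      connected_nodes := fun v => isEmptyElim v }
  exact treewidth_le_of_bags X fun i => by simp [X]

end LeafyKernel

/-! ## Programming with bounded loops -/

namespace BoundedLoop

namespace Exp

/-- The cell `0` of an array, used as a variable. -/
def var (a : Cell) : Exp := get a (const 0)

protected def eq (e f : Exp) : Exp := sub (const 1) (add (sub e f) (sub f e))

protected def lt (e f : Exp) : Exp := sub f e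

protected def not (e : Exp) : Exp := sub (const 1) e

/-- Unlike those of `or`, its values are only `0` and `1`, so a conjunction can be output as a
matrix entry. -/
protected def and (e f : Exp) : Exp := sub (const 1) (add (sub (const 1) e) (sub (const 1) f))

protected def or (e f : Exp) : Exp := add e f

/-- An entry of a matrix. -/
def entry (a : Cell) (u v : Exp) : Exp := get a (add (get .mulTable u) v)

/-- An entry of the adjacency matrix. -/
def arc (u v : Exp) : Exp := get .input (add (const 3) (add (get .mulTable u) v))

def root : Exp := get .input (const 0)

/-- The value is not zero. -/
def Holds (n : ℕ) (s : Store) (e : Exp) : Prop := e.eval n s ≠ 0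

variable {n : ℕ} {s : Store}

@[simp] theorem holds_eq {e f : Exp} : Holds n s (.eq e f) ↔ e.eval n s = f.eval n s := by
  simp only [Holds, Exp.eq, eval]
  omega

@[simp] theorem holds_lt {e f : Exp} : Holds n s (.lt e f) ↔ e.eval n s < f.eval n s := by
  simp only [Holds, Exp.lt, eval]
  omega

@[simp] theorem holds_not {e : Exp} : Holds n s (.not e) ↔ ¬ Holds n s e := by
  simp only [Holds, Exp.not, eval]
  omega

@[simp] theorem holds_and {e f : Exp} : Holds n s (.and e f) ↔ Holds n s e ∧ Holds n s f := by
  simp only [Holds, Exp.and, eval]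
  omega

@[simp] theorem holds_or {e f : Exp} : Holds n s (.or e f) ↔ Holds n s e ∨ Holds n s f := by
  simp only [Holds, Exp.or, eval]
  omega

@[simp] theorem holds_get {a : Cell} {e : Exp} :
    Holds n s (get a e) ↔ s.arr a (e.eval n s) ≠ 0 := Iff.rfl

@[simp] theorem holds_var {a : Cell} : Holds n s (var a) ↔ s.arr a 0 ≠ 0 := Iff.rfl

@[simp] theorem holds_entry {a : Cell} {u v : Exp} :
    Holds n s (entry a u v) ↔ s.arr a (s.arr .mulTable (u.eval n s) + v.eval n s) ≠ 0 := Iff.rfl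

@[simp] theorem holds_arc {u v : Exp} : Holds n s (arc u v) ↔
    s.arr .input (3 + (s.arr .mulTable (u.eval n s) + v.eval n s)) ≠ 0 := Iff.rfl

@[simp] theorem eval_var {a : Cell} : (var a).eval n s = s.arr a 0 := rfl

@[simp] theorem eval_root : root.eval n s = s.arr .input 0 := rfl

@[simp] theorem eval_get {a : Cell} {e : Exp} : (get a e).eval n s = s.arr a (e.eval n s) := rfl

@[simp] theorem eval_const {c : ℕ} : (const c).eval n s = c := rfl

@[simp] theorem eval_size : size.eval n s = n := rfl

@[simp] theorem eval_add {e f : Exp} : (add e f).eval n s = e.eval n s + f.eval n s := rfl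

end Exp

namespace Cmd

variable {n : ℕ}

theorem sem_seq (P Q : Cmd) (s : Store) : (seq P Q).sem n s = Q.sem n (P.sem n s) := rfl

theorem sem_put (a : Cell) (i e : Exp) (s : Store) :
    (put a i e).sem n s = s.put a (i.eval n s) (e.eval n s) := rfl

theorem sem_ite_of {e : Exp} {s : Store} (h : e.Holds n s) (P Q : Cmd) :
    (ite e P Q).sem n s = P.sem n s := if_pos h

theorem sem_ite_of_not {e : Exp} {s : Store} (h : ¬ e.Holds n s) (P Q : Cmd) :
    (ite e P Q).sem n s = Q.sem n s := if_neg h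

theorem sem_skip (s : Store) : skip.sem n s = s := rfl

/-- `t` differs from `s` at most in the array `a` and in the loop variable `i`. -/
def Agree (a i : Cell) (s t : Store) : Prop :=
  ∀ b j, b ≠ a → ¬ (b = i ∧ j = 0) → t.arr b j = s.arr b j

theorem Agree.refl (a i : Cell) (s : Store) : Agree a i s s := fun _ _ _ _ => rfl

theorem Agree.step {a i : Cell} {s t : Store} (h : Agree a i s t) (v j x : ℕ) :
    Agree a i s ((t.put i 0 v).put a j x) := by
  intro b l hb hl
  rw [Store.put_arr, if_neg fun hh => hb hh.1, Store.put_arr, if_neg hl, h b l hb hl]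

theorem Agree.step_index {a i : Cell} {s t : Store} (h : Agree a i s t) (v : ℕ) :
    Agree a i s (t.put i 0 v) := by
  intro b l hb hl
  rw [Store.put_arr, if_neg hl, h b l hb hl]

theorem Agree.eval_eq {a i : Cell} {s t : Store} (h : Agree a i s t) {e : Exp}
    (he : e.reads a = false) (v : ℕ) : e.eval n (t.put i 0 v) = e.eval n (s.put i 0 v) := by
  refine Exp.eval_congr e fun b hb => ?_
  have hba : b ≠ a := by
    rintro rfl
    rw [hb] at he
    exact absurd he (by decide)
  funext j
  by_cases hl : b = i ∧ j = 0
  · rw [Store.put_arr, if_pos hl, Store.put_arr, if_pos hl]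
  · rw [Store.put_arr, if_neg hl, Store.put_arr, if_neg hl, h b j hba hl]

/-- `a[idx] := e` for every index. -/
def fill (a : Cell) (e : Exp) : Cmd := loop .idx (put a (.var .idx) e)

/-- Here `e` may read the entry of `a` that is about to be overwritten, as `fillOr` does. -/
theorem fill_arr_of_local {a : Cell} {e : Exp} {s : Store} (ha : a ≠ .idx)
    (hloc : ∀ t v, Agree a .idx s t → t.arr a v = s.arr a v →
      e.eval n (t.put .idx 0 v) = e.eval n (s.put .idx 0 v)) (v : ℕ) (hv : v < n) :
    ((fill a e).sem n s).arr a v = e.eval n (s.put .idx 0 v) := by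
  have := loop_invariant (n := n) (a := .idx) (P := put a (.var .idx) e)
    (fun j t => Agree a .idx s t ∧
      ∀ v, t.arr a v = if v < j then e.eval n (s.put .idx 0 v) else s.arr a v)
    (s := s) ⟨.refl _ _ s, fun v => by simp⟩ (fun j hj t ht => by
      have he : e.eval n (t.put .idx 0 j) = e.eval n (s.put .idx 0 j) :=
        hloc t j ht.1 (by simp [ht.2])
      refine ⟨?_, fun v => ?_⟩
      · exact ht.1.step _ _ _
      · simp only [sem_put, Exp.eval_var, Store.put_arr, and_self, if_true, he, true_and, ha,
          false_and, if_false, ht.2]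
        by_cases hvj : v = j
        · simp [hvj]
        · have : v < j + 1 ↔ v < j := by omega
          simp [hvj, this])
  rw [fill, this.2, if_pos hv]

theorem fill_arr {a : Cell} {e : Exp} (s : Store) (ha : a ≠ .idx) (he : e.reads a = false)
    (v : ℕ) (hv : v < n) : ((fill a e).sem n s).arr a v = e.eval n (s.put .idx 0 v) :=
  fill_arr_of_local ha (fun _ v ht _ => ht.eval_eq he v) v hv

/-- Add to `a` the indices for which `c` holds. -/
def fillOr (a : Cell) (c : Exp) : Cmd := fill a (.or (.get a (.var .idx)) c)

theorem fillOr_arr {a : Cell} {c : Exp} (s : Store) (ha : a ≠ .idx) (hc : c.reads a = false)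
    (v : ℕ) (hv : v < n) :
    ((fillOr a c).sem n s).arr a v ≠ 0 ↔ s.arr a v ≠ 0 ∨ c.Holds n (s.put .idx 0 v) := by
  rw [fillOr, fill_arr_of_local ha _ v hv]
  · rw [← Exp.Holds, Exp.holds_or, Exp.holds_get, Exp.eval_var]
    simp [ha]
  · intro t v ht h
    rw [Exp.or, Exp.eval_add, Exp.eval_add, ht.eval_eq hc v]
    simp [ha, h]

/-- Store in `w` an index for which `c` holds, or `n` if there is none. -/
def search (w : Cell) (c : Exp) : Cmd :=
  seq (put w (.const 0) .size) (loop .idx (ite c (put w (.const 0) (.var .idx)) skip))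

theorem search_arr {w : Cell} {c : Exp} (s : Store) (hw : w ≠ .idx) (hc : c.reads w = false) :
    (((search w c).sem n s).arr w 0 < n ∧
      c.Holds n (s.put .idx 0 (((search w c).sem n s).arr w 0))) ∨
    (((search w c).sem n s).arr w 0 = n ∧ ∀ v < n, ¬ c.Holds n (s.put .idx 0 v)) := by
  have := loop_invariant (n := n) (a := .idx) (P := ite c (put w (.const 0) (.var .idx)) skip)
    (fun j t => Agree w .idx s t ∧
      ((t.arr w 0 < n ∧ c.Holds n (s.put .idx 0 (t.arr w 0))) ∨
        (t.arr w 0 = n ∧ ∀ v < j, ¬ c.Holds n (s.put .idx 0 v))))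
    (s := s.put w 0 n) ⟨fun b j hb hl => by simp [hb], Or.inr (by simp)⟩ (fun j hj t ht => by
      have he : c.Holds n (t.put .idx 0 j) ↔ c.Holds n (s.put .idx 0 j) := by
        rw [Exp.Holds, Exp.Holds, ht.1.eval_eq hc]
      by_cases hh : c.Holds n (t.put .idx 0 j)
      · rw [sem_ite_of hh]
        refine ⟨ht.1.step _ _ _, Or.inl ?_⟩
        simpa [sem_put, hj] using he.1 hh
      · rw [sem_ite_of_not hh, sem_skip]
        refine ⟨ht.1.step_index _, ?_⟩
        have hww : (t.put .idx 0 j).arr w 0 = t.arr w 0 := by simp [hw]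
        rw [hww]
        rcases ht.2 with h | h
        · exact Or.inl h
        · refine Or.inr ⟨h.1, fun v hv => ?_⟩
          rcases Nat.lt_succ_iff_lt_or_eq.1 hv with h' | h'
          · exact h.2 v h'
          · exact h' ▸ fun hx => hh (he.2 hx))
  exact this.2

end Cmd

theorem index_eq_iff {n u v u' v' : ℕ} (hv : v < n) (hv' : v' < n) :
    u * n + v = u' * n + v' ↔ u = u' ∧ v = v' := by
  constructor
  · intro h
    have h₁ : (u * n + v) / n = u := by
      rw [mul_comm, Nat.mul_add_div (by omega), Nat.div_eq_of_lt hv, add_zero]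
    have h₂ : (u' * n + v') / n = u' := by
      rw [mul_comm, Nat.mul_add_div (by omega), Nat.div_eq_of_lt hv', add_zero]
    have hu : u = u' := by rw [← h₁, ← h₂, h]
    subst hu
    exact ⟨rfl, by omega⟩
  · rintro ⟨rfl, rfl⟩
    rfl

end BoundedLoop

/-! ## The kernelization algorithm -/

namespace LeafyKernel

open BoundedLoop Cmd Relation

variable {n : ℕ}

/-- The input and the multiplication table are in place. -/
structure Ctx (D : Digraph (Fin n)) (r : Fin n) (k : ℕ) (s : Store) : Prop where
  mul : ∀ u : Fin n, s.arr .mulTable u = u * n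
  root : s.arr .input 0 = r
  bound : s.arr .input 1 = k
  arc : ∀ u v : Fin n, s.arr .input (3 + (u * n + v)) ≠ 0 ↔ D.Adj u v

/-- The vertices whose entry in the array is not zero. -/
def flags (n : ℕ) (s : Store) (a : Cell) : Set (Fin n) := {v | s.arr a v ≠ 0}

theorem mem_flags {s : Store} {a : Cell} {v : Fin n} : v ∈ flags n s a ↔ s.arr a v ≠ 0 := Iff.rfl

variable {D : Digraph (Fin n)} {r : Fin n} {k : ℕ} {s t : Store}

theorem Ctx.congr (h : Ctx D r k s) (h₁ : t.arr .mulTable = s.arr .mulTable)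
    (h₂ : t.arr .input = s.arr .input) : Ctx D r k t :=
  ⟨by rw [h₁]; exact h.mul, by rw [h₂]; exact h.root, by rw [h₂]; exact h.bound,
    by rw [h₂]; exact h.arc⟩

theorem Ctx.sem (h : Ctx D r k s) (P : Cmd) (h₁ : P.writes .mulTable = false)
    (h₂ : P.writes .input = false) : Ctx D r k (P.sem n s) :=
  h.congr (P.sem_arr_of_not_writes h₁ s) (P.sem_arr_of_not_writes h₂ s)

theorem Ctx.put (h : Ctx D r k s) {a : Cell} (h₁ : a ≠ .mulTable) (h₂ : a ≠ .input) (i x : ℕ) :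
    Ctx D r k (s.put a i x) :=
  h.congr (Store.put_arr_of_ne _ h₁.symm _ _) (Store.put_arr_of_ne _ h₂.symm _ _)

theorem flags_congr {a : Cell} (h : t.arr a = s.arr a) : flags n t a = flags n s a := by
  simp only [flags, h]

/-! ### Reachability -/

/-- Mark the out-neighbours of `src` outside `block` if `src` is marked. -/
def relax : Cmd :=
  .ite (.get .mark (.var .src))
    (fillOr .mark (.and (.arc (.var .src) (.var .idx)) (.not (.get .block (.var .idx))))) .skip

def relaxAll : Cmd := .loop .src relax

/-- Extend `mark` to the vertices that are reachable from it outside `block`. -/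
def reach : Cmd := .loop .rnd relaxAll

/-- The vertices reachable from `M` outside `B`. -/
def closureOutside (D : Digraph (Fin n)) (B M : Set (Fin n)) : Set (Fin n) :=
  {w | ∃ u ∈ M, ReflTransGen (fun a b => D.Adj a b ∧ b ∉ B) u w}

theorem relax_spec (hs : Ctx D r k s) {u : Fin n} (hu : s.arr .src 0 = u) :
    flags n (relax.sem n s) .mark = flags n s .mark ∪
      {w | u ∈ flags n s .mark ∧ D.Adj u w ∧ w ∉ flags n s .block} := by
  by_cases h : s.arr .mark u = 0
  · rw [relax, sem_ite_of_not (by simp [hu, h]), sem_skip]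
    ext w
    simp [mem_flags, h]
  · rw [relax, sem_ite_of (by simp [hu, h])]
    ext w
    rw [mem_flags, fillOr_arr _ (by decide) (by decide) _ w.2]
    simp [mem_flags, h, hu, hs.mul, ← hs.arc]

theorem relaxAll_spec (hs : Ctx D r k s) :
    flags n s .mark ⊆ flags n (relaxAll.sem n s) .mark ∧
    flags n (relaxAll.sem n s) .mark ⊆ closureOutside D (flags n s .block) (flags n s .mark) ∧
    ∀ u ∈ flags n s .mark, ∀ w, D.Adj u w → w ∉ flags n s .block →
      w ∈ flags n (relaxAll.sem n s) .mark := by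
  have := loop_invariant (n := n) (a := .src) (P := relax)
    (fun j t => Ctx D r k t ∧ flags n t .block = flags n s .block ∧
      flags n s .mark ⊆ flags n t .mark ∧
      flags n t .mark ⊆ closureOutside D (flags n s .block) (flags n s .mark) ∧
      ∀ u ∈ flags n s .mark, (u : ℕ) < j → ∀ w, D.Adj u w → w ∉ flags n s .block →
        w ∈ flags n t .mark)
    (s := s) ⟨hs, rfl, le_rfl, fun w hw => ⟨w, hw, .refl⟩, by simp⟩ (fun j hj t ht => by
      obtain ⟨h₁, h₂, h₃, h₄, h₅⟩ := ht
      have hctx : Ctx D r k (t.put .src 0 j) := h₁.put (by decide) (by decide) _ _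
      have hb : flags n (t.put .src 0 j) .block = flags n s .block := by
        rw [flags_congr (Store.put_arr_of_ne _ (by decide) _ _), h₂]
      have hm : flags n (t.put .src 0 j) .mark = flags n t .mark :=
        flags_congr (Store.put_arr_of_ne _ (by decide) _ _)
      have hrow := relax_spec (u := ⟨j, hj⟩) hctx (by simp)
      rw [hb, hm] at hrow
      refine ⟨hctx.sem _ (by decide) (by decide), ?_, ?_, ?_, ?_⟩
      · rw [flags_congr (sem_arr_of_not_writes _ (by decide) _), hb]
      · rw [hrow]
        exact h₃.trans Set.subset_union_left
      · rw [hrow]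
        rintro w (hw | ⟨hw₁, hw₂⟩)
        · exact h₄ hw
        · obtain ⟨u, hu, hpath⟩ := h₄ hw₁
          exact ⟨u, hu, hpath.tail hw₂⟩
      · intro u hu huj w huw hwb
        rw [hrow]
        rcases Nat.lt_succ_iff_lt_or_eq.1 huj with h | h
        · exact Or.inl (h₅ u hu h w huw hwb)
        · have : u = ⟨j, hj⟩ := Fin.ext h
          subst this
          exact Or.inr ⟨h₃ hu, huw, hwb⟩)
  exact ⟨this.2.2.1, this.2.2.2.1, fun u hu w => this.2.2.2.2 u hu u.2 w⟩

theorem closureOutside_closed {B M : Set (Fin n)}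
    (h : ∀ u ∈ M, ∀ w, D.Adj u w → w ∉ B → w ∈ M) : closureOutside D B M = M := by
  ext w
  constructor
  · rintro ⟨u, hu, hpath⟩
    induction hpath with
    | refl => exact hu
    | tail _ h' ih => exact h _ ih _ h'.1 h'.2
  · exact fun hw => ⟨w, hw, .refl⟩

theorem closureOutside_subset {B M N : Set (Fin n)} (h : M ⊆ closureOutside D B N) :
    closureOutside D B M ⊆ closureOutside D B N := by
  rintro w ⟨u, hu, hpath⟩
  obtain ⟨x, hx, hpath'⟩ := h hu
  exact ⟨x, hx, hpath'.trans hpath⟩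

/-- A round that does not complete the closure marks a new vertex, so after `j` rounds the marked
set is closed or has at least `j` elements; with `n` elements it is everything. -/
theorem reach_spec (hs : Ctx D r k s) :
    flags n (reach.sem n s) .mark = closureOutside D (flags n s .block) (flags n s .mark) := by
  have := loop_invariant (n := n) (a := .rnd) (P := relaxAll)
    (fun j t => Ctx D r k t ∧ flags n t .block = flags n s .block ∧
      flags n s .mark ⊆ flags n t .mark ∧
      flags n t .mark ⊆ closureOutside D (flags n s .block) (flags n s .mark) ∧
      ((∀ u ∈ flags n t .mark, ∀ w, D.Adj u w → w ∉ flags n s .block → w ∈ flags n t .mark) ∨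
        j ≤ (flags n t .mark).ncard))
    (s := s) ⟨hs, rfl, le_rfl, fun w hw => ⟨w, hw, .refl⟩, Or.inr (Nat.zero_le _)⟩
    (fun j hj t ht => by
      obtain ⟨h₁, h₂, h₃, h₄, h₅⟩ := ht
      have hctx : Ctx D r k (t.put .rnd 0 j) := h₁.put (by decide) (by decide) _ _
      have hb : flags n (t.put .rnd 0 j) .block = flags n s .block := by
        rw [flags_congr (Store.put_arr_of_ne _ (by decide) _ _), h₂]
      have hm : flags n (t.put .rnd 0 j) .mark = flags n t .mark :=
        flags_congr (Store.put_arr_of_ne _ (by decide) _ _)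
      obtain ⟨e₁, e₂, e₃⟩ := relaxAll_spec hctx
      rw [hb, hm] at e₂
      rw [hm] at e₁
      rw [hb, hm] at e₃
      refine ⟨hctx.sem _ (by decide) (by decide), ?_, h₃.trans e₁,
        e₂.trans (closureOutside_subset h₄), ?_⟩
      · rw [flags_congr (sem_arr_of_not_writes _ (by decide) _), hb]
      · by_cases heq : flags n (relaxAll.sem n (t.put .rnd 0 j)) .mark = flags n t .mark
        · left
          rw [heq] at e₃ ⊢
          exact e₃
        · rcases h₅ with h₅ | h₅
          · rw [closureOutside_closed h₅] at e₂
            exact absurd (e₂.antisymm e₁) heq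
          · right
            have := Set.ncard_lt_ncard (e₁.ssubset_of_ne (Ne.symm heq)) (Set.toFinite _)
            omega)
  obtain ⟨-, -, h₃, h₄, h₅⟩ := this
  have hclosed : ∀ u ∈ flags n (reach.sem n s) .mark, ∀ w, D.Adj u w → w ∉ flags n s .block →
      w ∈ flags n (reach.sem n s) .mark := by
    rcases h₅ with h₅ | h₅
    · exact h₅
    · change n ≤ (flags n (reach.sem n s) .mark).ncard at h₅
      have huniv : flags n (reach.sem n s) .mark = Set.univ := by
        exact Set.eq_of_subset_of_ncard_le (Set.subset_univ _) (by simpa [Set.ncard_univ] using h₅)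
      intro u _ w _ _
      rw [huniv]
      trivial
  refine h₄.antisymm ?_
  change _ ⊆ flags n (reach.sem n s) .mark
  rw [← closureOutside_closed hclosed]
  exact closureOutside_subset fun w hw => ⟨w, h₃ hw, .refl⟩

end LeafyKernel

/-! ### Loop invariants with frame conditions -/

namespace BoundedLoop.Cmd

variable {n : ℕ}

/-- `t` agrees with `s` on the arrays that `P` does not write to. -/
def Frame (P : Cmd) (s t : Store) : Prop := ∀ b, P.writes b = false → t.arr b = s.arr b

theorem Frame.put_sem {a : Cell} {P : Cmd} {s t : Store} (h : Frame (loop a P) s t) (j : ℕ) :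
    Frame (loop a P) s (P.sem n (t.put a 0 j)) := by
  intro b hb
  rw [writes, Bool.or_eq_false_iff, beq_eq_false_iff_ne] at hb
  rw [sem_arr_of_not_writes P hb.2, Store.put_arr_of_ne _ hb.1.symm, h b]
  rw [writes, Bool.or_eq_false_iff, beq_eq_false_iff_ne]
  exact hb

theorem Frame.put {a : Cell} {P : Cmd} {s t : Store} (h : Frame (loop a P) s t) (j : ℕ) :
    Frame (loop a P) s (t.put a 0 j) := by
  intro b hb
  have hb' := hb
  rw [writes, Bool.or_eq_false_iff, beq_eq_false_iff_ne] at hb'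
  rw [Store.put_arr_of_ne _ hb'.1.symm, h b hb]

theorem loop_frame {a : Cell} {P : Cmd} (I : ℕ → Store → Prop) {s : Store} (h₀ : I 0 s)
    (h : ∀ j : Fin n, ∀ t, Frame (loop a P) s t → I j t → I (j + 1) (P.sem n (t.put a 0 j))) :
    I n ((loop a P).sem n s) :=
  (loop_invariant (fun j t => Frame (loop a P) s t ∧ I j t) ⟨fun _ _ => rfl, h₀⟩
    fun j hj t ht => ⟨ht.1.put_sem j, h ⟨j, hj⟩ t ht.1 ht.2⟩).2

end BoundedLoop.Cmd

namespace LeafyKernel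

open BoundedLoop Cmd Relation

variable {n : ℕ} {D : Digraph (Fin n)} {r : Fin n} {k : ℕ} {s t : Store}

theorem Ctx.frame (h : Ctx D r k s) {P : Cmd} (ht : Frame P s t) (h₁ : P.writes .mulTable = false)
    (h₂ : P.writes .input = false) : Ctx D r k t :=
  h.congr (ht _ h₁) (ht _ h₂)

theorem flags_put_of_ne {a b : Cell} (h : b ≠ a) (i x : ℕ) :
    flags n (s.put a i x) b = flags n s b :=
  flags_congr (Store.put_arr_of_ne _ h _ _)

theorem flags_sem {a : Cell} (P : Cmd) (h : P.writes a = false) :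
    flags n (P.sem n s) a = flags n s a :=
  flags_congr (P.sem_arr_of_not_writes h s)

theorem flags_fill {a : Cell} {e : Exp} (ha : a ≠ .idx) (he : e.reads a = false) :
    flags n ((fill a e).sem n s) a = {v : Fin n | e.Holds n (s.put .idx 0 v)} := by
  ext v
  rw [mem_flags, fill_arr _ ha he _ v.2]
  rfl

theorem flags_fillOr {a : Cell} {e : Exp} (ha : a ≠ .idx) (he : e.reads a = false) :
    flags n ((fillOr a e).sem n s) a = flags n s a ∪
      {v : Fin n | e.Holds n (s.put .idx 0 v)} := by
  ext v
  rw [mem_flags, fillOr_arr _ ha he _ v.2]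
  rfl

/-- A loop each round of which adds a set to the array `a`. -/
theorem flags_loop {i a : Cell} {P : Cmd} (ha : a ≠ i) (Q : Fin n → Set (Fin n))
    (h : ∀ j : Fin n, ∀ t, Frame (loop i P) s t → t.arr i 0 = j →
      flags n (P.sem n t) a = flags n t a ∪ Q j) :
    flags n ((loop i P).sem n s) a = flags n s a ∪ ⋃ j, Q j := by
  have := loop_frame (n := n) (a := i) (P := P) (s := s)
    (fun j t => flags n t a = flags n s a ∪ {w | ∃ i : Fin n, (i : ℕ) < j ∧ w ∈ Q i})
    (by simp) (fun j t hf ht => by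
      rw [h j _ (hf.put _) (by simp), flags_put_of_ne ha, ht, Set.union_assoc]
      congr 1
      ext w
      simp only [Set.mem_union, Set.mem_ofPred_eq, Nat.lt_succ_iff_lt_or_eq, ← Fin.ext_iff]
      constructor
      · rintro (⟨i, hi, hw⟩ | hw)
        · exact ⟨i, Or.inl hi, hw⟩
        · exact ⟨j, Or.inr rfl, hw⟩
      · rintro ⟨i, hi | rfl, hw⟩
        · exact Or.inl ⟨i, hi, hw⟩
        · exact Or.inr hw)
  rw [this]
  congr 1
  ext w
  simp

/-! ### Tables -/

/-- Copy `mark` into the row `vtx` of the matrix `a`. -/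
def copyRow (a : Cell) : Cmd :=
  .loop .idx (.put a (.add (.get .mulTable (.var .vtx)) (.var .idx)) (.get .mark (.var .idx)))

theorem copyRow_spec {a : Cell} (hs : Ctx D r k s) {u : Fin n} (hu : s.arr .vtx 0 = u)
    (ha : (copyRow a).writes .mark = false) (ha' : (copyRow a).writes .vtx = false)
    (ha'' : (copyRow a).writes .mulTable = false) (hidx : a ≠ .idx) (x y : Fin n) :
    ((copyRow a).sem n s).arr a (x * n + y) =
      if x = u then s.arr .mark y else s.arr a (x * n + y) := by
  have := loop_frame (n := n) (a := .idx) (P := .put a (.add (.get .mulTable (.var .vtx))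
      (.var .idx)) (.get .mark (.var .idx))) (s := s)
    (fun j t => ∀ x y : Fin n, t.arr a (x * n + y) =
      if x = u ∧ (y : ℕ) < j then s.arr .mark y else s.arr a (x * n + y))
    (by simp) (fun j t hf ht x y => by
      have h₁ := hf _ ha
      have h₂ : t.arr .vtx 0 = u := by rw [hf _ ha', hu]
      have h₃ : t.arr .mulTable u = u * n := by rw [hf _ ha'', hs.mul]
      have h₄ : (x * n + y : ℕ) = u * n + j ↔ x = u ∧ y = j := by
        rw [index_eq_iff y.2 j.2, Fin.ext_iff, Fin.ext_iff]
      simp only [sem_put, Exp.eval_add, Exp.eval_get, Exp.eval_var, Store.put_arr, reduceCtorEq,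
        false_and, if_false, and_self, if_true, h₁, h₂, h₃, true_and, hidx, h₄, ht,
        Nat.lt_succ_iff_lt_or_eq]
      by_cases hx : x = u <;> by_cases hy : y = j <;> simp [hx, hy, Fin.val_inj])
  rw [copyRow, this]
  simp

/-- The relation stored in a matrix. -/
def rel (n : ℕ) (s : Store) (a : Cell) (u v : Fin n) : Prop := s.arr a (u * n + v) ≠ 0

/-- The matrix `a` whose row `vtx` is the array `mark` computed by `P`. -/
def table (a : Cell) (P : Cmd) : Cmd := .loop .vtx (.seq P (copyRow a))

theorem table_spec {a : Cell} {P : Cmd} (hs : Ctx D r k s) (R : Fin n → Fin n → Prop)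
    (ha : (copyRow a).writes .mark = false) (ha' : (copyRow a).writes .vtx = false)
    (ha'' : (table a P).writes .mulTable = false) (hi : (table a P).writes .input = false)
    (hidx : a ≠ .idx) (hP : P.writes a = false) (hv : P.writes .vtx = false)
    (h : ∀ u : Fin n, ∀ t, Frame (table a P) s t → t.arr .vtx 0 = u →
      flags n (P.sem n t) .mark = {v | R u v}) (u v : Fin n) :
    rel n ((table a P).sem n s) a u v ↔ R u v := by
  have hav : a ≠ .vtx := by
    rintro rfl
    simp [copyRow, writes] at ha'
  have hmul : (copyRow a).writes .mulTable = false := by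
    simp only [table, writes, Bool.or_eq_false_iff] at ha''
    exact ha''.2.2
  have := loop_frame (n := n) (a := .vtx) (P := .seq P (copyRow a)) (s := s)
    (fun j t => ∀ u v : Fin n, (u : ℕ) < j → (rel n t a u v ↔ R u v)) (by simp)
    (fun j t hf ht x y hx => by
      have hf' := hf.put j
      have hctx : Ctx D r k (t.put .vtx 0 j) := hs.frame hf' ha'' hi
      have hPm : P.writes .mulTable = false := by
        simp only [table, writes, Bool.or_eq_false_iff] at ha''
        exact ha''.2.1
      have hPi : P.writes .input = false := by
        simp only [table, writes, Bool.or_eq_false_iff] at hi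
        exact hi.2.1
      rw [rel, sem_seq, copyRow_spec (hctx.sem P hPm hPi) (u := j)
        (by rw [sem_arr_of_not_writes P hv]; simp) ha ha' hmul hidx]
      by_cases hxj : x = j
      · subst hxj
        rw [if_pos rfl, ← mem_flags, h x _ hf' (by simp)]
        rfl
      · rw [if_neg hxj, sem_arr_of_not_writes P hP, Store.put_arr_of_ne _ hav, ← rel, ht]
        have : (x : ℕ) ≠ j := fun h => hxj (Fin.ext h)
        omega)
  exact this u v u.2

/-! ### Domination -/

/-- Tabulate in `avoid` which vertices are reachable from the root when one vertex is removed. -/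
def computeAvoid : Cmd :=
  table .avoid (.seq (fill .block (.eq (.var .idx) (.var .vtx)))
    (.seq (fill .mark (.and (.eq (.var .idx) .root) (.not (.eq (.var .idx) (.var .vtx))))) reach))

theorem computeAvoid_spec (hs : Ctx D r k s) (u v : Fin n) :
    rel n (computeAvoid.sem n s) .avoid u v ↔ ReachAvoiding D.Adj r u v := by
  refine table_spec hs _ (by decide) (by decide) (by decide) (by decide) (by decide) (by decide)
    (by decide) (fun u t hf hu => ?_) u v
  have hctx : Ctx D r k t := hs.frame hf (by decide) (by decide)
  set t₁ := (fill .block (.eq (.var .idx) (.var .vtx))).sem n t with ht₁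
  have hctx₁ : Ctx D r k t₁ := hctx.sem _ (by decide) (by decide)
  have hb : flags n t₁ .block = {u} := by
    rw [ht₁, flags_fill (by decide) (by decide)]
    ext v
    simp [hu, Fin.ext_iff]
  have hu₁ : t₁.arr .vtx 0 = u := by rw [ht₁, sem_arr_of_not_writes _ (by decide), hu]
  rw [sem_seq, sem_seq, ← ht₁, reach_spec (hctx₁.sem _ (by decide) (by decide)),
    flags_sem _ (by decide), hb, flags_fill (by decide) (by decide)]
  ext w
  simp only [closureOutside, ReachAvoiding, Exp.holds_and, Exp.holds_not, Exp.holds_eq,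
    Exp.eval_var, Exp.eval_root, Store.put_arr, reduceCtorEq, false_and, if_false, and_self,
    if_true, hctx₁.root, hu₁, Fin.val_inj, Set.mem_ofPred_eq, Set.mem_singleton_iff]
  constructor
  · rintro ⟨x, ⟨rfl, hx⟩, h⟩
    exact ⟨hx, h⟩
  · rintro ⟨hx, h⟩
    exact ⟨r, ⟨rfl, hx⟩, h⟩

/-- Mark the vertices reachable from the root. -/
def reachRoot : Cmd :=
  .seq (fill .block (.const 0)) (.seq (fill .mark (.eq (.var .idx) .root)) reach)

theorem reachRoot_spec (hs : Ctx D r k s) :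
    flags n (reachRoot.sem n s) .mark = {v | ReflTransGen D.Adj r v} := by
  set t₁ := (fill .block (.const 0)).sem n s with ht₁
  have hctx₁ : Ctx D r k t₁ := hs.sem _ (by decide) (by decide)
  have hb : flags n t₁ .block = ∅ := by
    rw [ht₁, flags_fill (by decide) (by decide)]
    ext v
    simp [Exp.Holds]
  rw [reachRoot, sem_seq, sem_seq, ← ht₁, reach_spec (hctx₁.sem _ (by decide) (by decide)),
    flags_sem _ (by decide), hb, flags_fill (by decide) (by decide)]
  ext w
  simp [closureOutside, hctx₁.root, Fin.val_inj]

/-- Set up the table of the multiples of `n`. -/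
def multiples : Cmd :=
  .loop .idx (.seq (.put .mulTable (.var .idx) (.var .acc))
    (.put .acc (.const 0) (.add (.var .acc) .size)))

theorem multiples_spec (hs : s.arr .acc 0 = 0) (u : Fin n) :
    (multiples.sem n s).arr .mulTable u = u * n := by
  have := loop_frame (n := n) (a := .idx) (P := .seq (.put .mulTable (.var .idx) (.var .acc))
    (.put .acc (.const 0) (.add (.var .acc) .size))) (s := s)
    (fun j t => t.arr .acc 0 = j * n ∧ ∀ u < j, t.arr .mulTable u = u * n) (by simp [hs])
    (fun j t _ ht => by
      refine ⟨by simp [sem_seq, sem_put, ht.1, add_mul], fun u hu => ?_⟩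
      by_cases huj : u = j
      · simp [sem_seq, sem_put, huj, ht.1]
      · simp [sem_seq, sem_put, huj, ht.2 u (by omega)])
  exact this.2 u u.2

end LeafyKernel

/-! ### Adding a vertex to the growing pair of trees -/

namespace LeafyKernel

open BoundedLoop Cmd Relation

section PartialOrder

variable {V : Type*} {E : V → V → Prop} {r : V}

/-- A pair of trees as in `LowHigh` on a set of vertices that is still growing. -/
structure PartialLowHigh (E : V → V → Prop) (r : V) (A : Set V) (f b : V → V) (t : V → ℕ) :
    Prop where
  root_mem : r ∈ A
  isOpen : Open E r A
  inj : Set.InjOn t A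
  f_root : f r = r
  b_root : b r = r
  f_adj : ∀ v ∈ A, v ≠ r → E (f v) v
  b_adj : ∀ v ∈ A, v ≠ r → E (b v) v
  f_lt : ∀ v ∈ A, v ≠ r → f v ∈ A ∧ t (f v) < t v
  b_path : ∀ v ∈ A, v ≠ r → ∃ x ∈ A, StrictDom E r x v ∧ t x < t v ∧
    ReflTransGen (fun a c => E a c ∧ (c ∈ A → t v < t c)) x (b v)

theorem PartialLowHigh.lowHigh {f b : V → V} {t : V → ℕ}
    (h : PartialLowHigh E r Set.univ f b t) : LowHigh E r f b t where
  inj := Set.injOn_univ.1 h.inj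
  f_root := h.f_root
  b_root := h.b_root
  f_adj v hv := h.f_adj v trivial hv
  b_adj v hv := h.b_adj v trivial hv
  f_lt v hv := (h.f_lt v trivial hv).2
  b_path v hv := by
    obtain ⟨x, -, h₁, h₂, h₃⟩ := h.b_path v trivial hv
    exact ⟨x, h₁, h₂, h₃.imp fun a c hac => ⟨hac.1, hac.2 trivial⟩⟩

/-- The new vertex is placed after all others. The paths of the earlier vertices are constrained
only on `A`, so a path that runs through `v` remains admissible: `v` is now later than every member
of `A`. -/
theorem PartialLowHigh.insert [Finite V] [DecidableEq V] {A : Set V} {f b : V → V} {t : V → ℕ}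
    (h : PartialLowHigh E r A f b t) {v u x y : V} (hv : v ∉ A) (hu : u ∈ A) (huv : E u v)
    (hx : x ∈ A) (hdom : StrictDom E r x v)
    (hpath : ReflTransGen (fun a c => E a c ∧ c ∉ insert v A) x y) (hyv : E y v)
    (hopen : Open E r (insert v A)) :
    ∃ t', PartialLowHigh E r (insert v A) (Function.update f v u) (Function.update b v y) t' := by
  obtain ⟨τ, hτ⟩ : ∃ τ, ∀ w, t w < τ := by
    obtain ⟨m, hm⟩ := (Set.finite_range t).bddAbove
    exact ⟨m + 1, fun w => Nat.lt_succ_of_le (hm ⟨w, rfl⟩)⟩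
  have hrv : r ≠ v := fun hh => hv (hh ▸ h.root_mem)
  have hne : ∀ w ∈ A, w ≠ v := fun w hw hh => hv (hh ▸ hw)
  have told : ∀ w ∈ A, Function.update t v τ w = t w :=
    fun w hw => Function.update_of_ne (hne w hw) _ _
  have tnew : Function.update t v τ v = τ := Function.update_self _ _ _
  refine ⟨Function.update t v τ, ⟨Or.inr h.root_mem, hopen, ?_, ?_, ?_, ?_, ?_, ?_, ?_⟩⟩
  · rintro a (rfl | ha) c (rfl | hc) hac
    · rfl
    · rw [tnew, told c hc] at hac
      exact absurd hac (hτ c).ne'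
    · rw [tnew, told a ha] at hac
      exact absurd hac (hτ a).ne
    · rw [told a ha, told c hc] at hac
      exact h.inj ha hc hac
  · rw [Function.update_of_ne hrv, h.f_root]
  · rw [Function.update_of_ne hrv, h.b_root]
  · rintro w (rfl | hw) hwr
    · rwa [Function.update_self]
    · rw [Function.update_of_ne (hne w hw)]
      exact h.f_adj w hw hwr
  · rintro w (rfl | hw) hwr
    · rwa [Function.update_self]
    · rw [Function.update_of_ne (hne w hw)]
      exact h.b_adj w hw hwr
  · rintro w (rfl | hw) hwr
    · rw [Function.update_self, tnew, told u hu]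
      exact ⟨Or.inr hu, hτ u⟩
    · obtain ⟨h₁, h₂⟩ := h.f_lt w hw hwr
      rw [Function.update_of_ne (hne w hw), told _ h₁, told w hw]
      exact ⟨Or.inr h₁, h₂⟩
  · rintro w (rfl | hw) hwr
    · refine ⟨x, Or.inr hx, hdom, ?_, ?_⟩
      · rw [tnew, told x hx]
        exact hτ x
      · rw [Function.update_self (f := b)]
        exact hpath.imp fun a c hac => ⟨hac.1, fun hc => absurd hc hac.2⟩
    · obtain ⟨z, hz, h₁, h₂, h₃⟩ := h.b_path w hw hwr
      refine ⟨z, Or.inr hz, h₁, ?_, ?_⟩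
      · rwa [told z hz, told w hw]
      · rw [Function.update_of_ne (f := b) (hne w hw), told w hw]
        refine h₃.imp fun a c hac => ⟨hac.1, ?_⟩
        rintro (rfl | hc)
        · rw [tnew]
          exact hτ w
        · rw [told c hc]
          exact hac.2 hc

end PartialOrder

variable {n : ℕ} {D : Digraph (Fin n)} {r : Fin n} {k : ℕ} {s t : Store}

/-- The table `avoid` is in place, too. -/
structure Env (D : Digraph (Fin n)) (r : Fin n) (k : ℕ) (s : Store) : Prop extends
    Ctx D r k s where
  avoid : ∀ u v, rel n s .avoid u v ↔ ReachAvoiding D.Adj r u v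

theorem Env.congr (h : Env D r k s) (h₁ : t.arr .mulTable = s.arr .mulTable)
    (h₂ : t.arr .input = s.arr .input) (h₃ : t.arr .avoid = s.arr .avoid) : Env D r k t :=
  ⟨h.toCtx.congr h₁ h₂, by simpa only [rel, h₃] using h.avoid⟩

theorem Env.sem (h : Env D r k s) (P : Cmd) (h₁ : P.writes .mulTable = false)
    (h₂ : P.writes .input = false) (h₃ : P.writes .avoid = false) : Env D r k (P.sem n s) :=
  h.congr (P.sem_arr_of_not_writes h₁ s) (P.sem_arr_of_not_writes h₂ s)
    (P.sem_arr_of_not_writes h₃ s)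

theorem Env.put (h : Env D r k s) {a : Cell} (h₁ : a ≠ .mulTable) (h₂ : a ≠ .input)
    (h₃ : a ≠ .avoid) (i x : ℕ) : Env D r k (s.put a i x) :=
  h.congr (Store.put_arr_of_ne _ h₁.symm _ _) (Store.put_arr_of_ne _ h₂.symm _ _)
    (Store.put_arr_of_ne _ h₃.symm _ _)

theorem Env.frame (h : Env D r k s) {P : Cmd} (ht : Frame P s t) (h₁ : P.writes .mulTable = false)
    (h₂ : P.writes .input = false) (h₃ : P.writes .avoid = false) : Env D r k t :=
  h.congr (ht _ h₁) (ht _ h₂) (ht _ h₃)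

/-- Strict domination. -/
def sdom (x w : Exp) : Exp := .and (.not (.eq x w)) (.not (.entry .avoid x w))

theorem holds_sdom (h : Env D r k s) {e e' : Exp} {x w : Fin n} (he : e.eval n s = x)
    (he' : e'.eval n s = w) : (sdom e e').Holds n s ↔ StrictDom D.Adj r x w := by
  rw [StrictDom, ← h.avoid, rel]
  simp [sdom, he, he', h.mul, Fin.val_inj]

/-! ### Growing the trees -/

/-- Mark what is reachable from `top` outside `block`. -/
def markTop : Cmd := .seq (fill .mark (.eq (.var .idx) (.var .top))) reach

theorem markTop_spec (hs : Ctx D r k s) {x : Fin n} (hx : s.arr .top 0 = x) :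
    flags n (markTop.sem n s) .mark =
      {w | ReflTransGen (fun a b => D.Adj a b ∧ b ∉ flags n s .block) x w} := by
  rw [markTop, sem_seq, reach_spec (hs.sem _ (by decide) (by decide)), flags_sem _ (by decide),
    flags_fill (by decide) (by decide)]
  ext w
  simp [closureOutside, hx, Fin.val_inj]

/-- Store in `found` a marked in-neighbour of `vtx`, if there is one. -/
def findEntry : Cmd :=
  .seq (search .second (.and (.get .mark (.var .idx)) (.arc (.var .idx) (.var .vtx))))
    (.ite (.lt (.var .second) .size) (.put .found (.const 0) (.var .second)) .skip)

theorem findEntry_spec (hs : Ctx D r k s) {v : Fin n} (hv : s.arr .vtx 0 = v) :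
    (∃ y : Fin n, (findEntry.sem n s).arr .found 0 = y ∧ y ∈ flags n s .mark ∧ D.Adj y v) ∨
    ((findEntry.sem n s).arr .found 0 = s.arr .found 0 ∧
      ∀ y ∈ flags n s .mark, ¬ D.Adj y v) := by
  have hc : ∀ y : Fin n, (Exp.and (.get .mark (.var .idx)) (.arc (.var .idx) (.var .vtx))).Holds n
      (s.put .idx 0 y) ↔ y ∈ flags n s .mark ∧ D.Adj y v := by
    intro y
    rw [mem_flags, ← hs.arc]
    simp [hv, hs.mul]
  rcases search_arr (n := n) (w := .second)
    (c := .and (.get .mark (.var .idx)) (.arc (.var .idx) (.var .vtx))) s (by decide) (by decide)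
    with ⟨h₁, h₂⟩ | ⟨h₁, h₂⟩
  · refine Or.inl ⟨⟨_, h₁⟩, ?_, (hc ⟨_, h₁⟩).1 h₂⟩
    rw [findEntry, sem_seq, sem_ite_of (by simpa using h₁), sem_put]
    simp
  · refine Or.inr ⟨?_, fun y hy hyv => h₂ y y.2 ((hc y).2 ⟨hy, hyv⟩)⟩
    rw [findEntry, sem_seq, sem_ite_of_not (by simpa using h₁.ge), sem_skip,
      sem_arr_of_not_writes _ (by decide)]

/-- Add to `covered` the vertices for which `top` is a witness, and look for an entry to `vtx`. -/
def probe : Cmd :=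
  .seq markTop (.seq
    (fillOr .covered (.and (.get .mark (.var .idx)) (sdom (.var .top) (.var .idx))))
    (.ite (.and (.get .inside (.var .top)) (sdom (.var .top) (.var .vtx))) findEntry .skip))

theorem probe_covered (hs : Env D r k s) {x : Fin n} (hx : s.arr .top 0 = x) :
    flags n (probe.sem n s) .covered = flags n s .covered ∪ {w | StrictDom D.Adj r x w ∧
      ReflTransGen (fun a b => D.Adj a b ∧ b ∉ flags n s .block) x w} := by
  have hs₁ : Env D r k (markTop.sem n s) := hs.sem _ (by decide) (by decide) (by decide)
  have hx₁ : (markTop.sem n s).arr .top 0 = x := by rw [sem_arr_of_not_writes _ (by decide), hx]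
  rw [probe, sem_seq, sem_seq, flags_sem _ (by decide), flags_fillOr (by decide) (by decide),
    flags_sem _ (by decide)]
  congr 1
  ext w
  have h₁ := markTop_spec hs.toCtx hx
  have h₂ : (sdom (.var .top) (.var .idx)).Holds n ((markTop.sem n s).put .idx 0 w) ↔
      StrictDom D.Adj r x w :=
    holds_sdom (hs₁.put (by decide) (by decide) (by decide) _ _) (by simpa using hx₁) (by simp)
  rw [Set.mem_ofPred_eq, Exp.holds_and, h₂, and_comm]
  have h₃ : (Exp.get .mark (.var .idx)).Holds n ((markTop.sem n s).put .idx 0 w) ↔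
      w ∈ flags n (markTop.sem n s) .mark := by
    simp [mem_flags]
  rw [h₃, h₁]
  rfl

/-- A candidate for the second parent of `v`. -/
def Entry (D : Digraph (Fin n)) (r : Fin n) (A B : Set (Fin n)) (v x y : Fin n) : Prop :=
  x ∈ A ∧ StrictDom D.Adj r x v ∧ ReflTransGen (fun a b => D.Adj a b ∧ b ∉ B) x y ∧ D.Adj y v

theorem probe_found (hs : Env D r k s) {x v : Fin n} (hx : s.arr .top 0 = x)
    (hv : s.arr .vtx 0 = v) :
    (∃ y : Fin n, (probe.sem n s).arr .found 0 = y ∧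
      Entry D r (flags n s .inside) (flags n s .block) v x y) ∨
    ((probe.sem n s).arr .found 0 = s.arr .found 0 ∧
      ∀ y, ¬ Entry D r (flags n s .inside) (flags n s .block) v x y) := by
  set s₁ := markTop.sem n s with hs₁
  set s₂ := (fillOr .covered (.and (.get .mark (.var .idx))
    (sdom (.var .top) (.var .idx)))).sem n s₁ with hs₂
  have he : Env D r k s₂ := (hs.sem _ (by decide) (by decide) (by decide)).sem _ (by decide)
    (by decide) (by decide)
  have hx₂ : s₂.arr .top 0 = x := by
    rw [hs₂, sem_arr_of_not_writes _ (by decide), hs₁, sem_arr_of_not_writes _ (by decide), hx]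
  have hv₂ : s₂.arr .vtx 0 = v := by
    rw [hs₂, sem_arr_of_not_writes _ (by decide), hs₁, sem_arr_of_not_writes _ (by decide), hv]
  have hf₂ : s₂.arr .found = s.arr .found := by
    rw [hs₂, sem_arr_of_not_writes _ (by decide), hs₁, sem_arr_of_not_writes _ (by decide)]
  have hi₂ : s₂.arr .inside = s.arr .inside := by
    rw [hs₂, sem_arr_of_not_writes _ (by decide), hs₁, sem_arr_of_not_writes _ (by decide)]
  have hm₂ : flags n s₂ .mark =
      {w | ReflTransGen (fun a b => D.Adj a b ∧ b ∉ flags n s .block) x w} := by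
    rw [hs₂, flags_sem _ (by decide), hs₁, markTop_spec hs.toCtx hx]
  have hc : (Exp.and (.get .inside (.var .top)) (sdom (.var .top) (.var .vtx))).Holds n s₂ ↔
      x ∈ flags n s .inside ∧ StrictDom D.Adj r x v := by
    rw [Exp.holds_and, holds_sdom he (e := .var .top) (e' := .var .vtx) hx₂ hv₂]
    simp [hx₂, hi₂, mem_flags]
  have heq : probe.sem n s = (ite (.and (.get .inside (.var .top)) (sdom (.var .top) (.var .vtx)))
      findEntry .skip).sem n s₂ := rfl
  rw [heq]
  by_cases h : x ∈ flags n s .inside ∧ StrictDom D.Adj r x v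
  · rw [sem_ite_of (hc.2 h)]
    rcases findEntry_spec he.toCtx hv₂ with ⟨y, h₁, h₂, h₃⟩ | ⟨h₁, h₂⟩
    · rw [hm₂] at h₂
      exact Or.inl ⟨y, h₁, h.1, h.2, h₂, h₃⟩
    · rw [hm₂] at h₂
      exact Or.inr ⟨by rw [h₁, hf₂], fun y hy => h₂ y hy.2.2.1 hy.2.2.2⟩
  · rw [sem_ite_of_not fun hh => h (hc.1 hh), sem_skip, hf₂]
    exact Or.inr ⟨rfl, fun y hy => h ⟨hy.1, hy.2.1⟩⟩

def explore : Cmd := .loop .top (.ite (.get .block (.var .top)) probe .skip)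

theorem explore_covered (hs : Env D r k s) :
    flags n (explore.sem n s) .covered =
      flags n s .covered ∪ {w | ∃ x, Witness D.Adj r (flags n s .block) x w} := by
  rw [explore, flags_loop (by decide) fun x => {w | Witness D.Adj r (flags n s .block) x w}]
  · congr 1
    ext w
    simp
  · intro x t hf hx
    have hb : flags n t .block = flags n s .block := flags_congr (hf _ (by decide))
    by_cases h : x ∈ flags n t .block
    · rw [sem_ite_of (by simpa [hx, mem_flags] using h),
        probe_covered (hs.frame hf (by decide) (by decide) (by decide)) hx]
      congr 1
      ext w
      rw [hb] at h ⊢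
      exact ⟨fun hh => ⟨h, hh⟩, fun hh => hh.2⟩
    · rw [sem_ite_of_not (by simpa [hx, mem_flags] using h), sem_skip]
      symm
      rw [Set.union_eq_left]
      intro w hw
      rw [hb] at h
      exact absurd hw.1 h

theorem explore_found (hs : Env D r k s) {v : Fin n} (hv : s.arr .vtx 0 = v)
    (hsub : flags n s .inside ⊆ flags n s .block) :
    (∃ x y : Fin n, (explore.sem n s).arr .found 0 = y ∧
      Entry D r (flags n s .inside) (flags n s .block) v x y) ∨
    ∀ x y, ¬ Entry D r (flags n s .inside) (flags n s .block) v x y := by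
  have := loop_frame (n := n) (a := .top) (P := .ite (.get .block (.var .top)) probe .skip)
    (s := s) (fun j t =>
      (∃ x y : Fin n, t.arr .found 0 = y ∧
        Entry D r (flags n s .inside) (flags n s .block) v x y) ∨
      ∀ x y : Fin n, (x : ℕ) < j → ¬ Entry D r (flags n s .inside) (flags n s .block) v x y)
    (Or.inr (by simp)) (fun x t hf ht => by
      have hf' := hf.put x
      have hb : flags n (t.put .top 0 x) .block = flags n s .block :=
        flags_congr (hf' _ (by decide))
      have hi : flags n (t.put .top 0 x) .inside = flags n s .inside :=
        flags_congr (hf' _ (by decide))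
      have hv' : (t.put .top 0 x).arr .vtx 0 = v := by rw [hf' _ (by decide), hv]
      have hkeep : ∀ {u : Store}, u.arr .found 0 = t.arr .found 0 →
          (∀ y, ¬ Entry D r (flags n s .inside) (flags n s .block) v x y) →
          ((∃ x y : Fin n, u.arr .found 0 = y ∧
            Entry D r (flags n s .inside) (flags n s .block) v x y) ∨
          ∀ z y : Fin n, (z : ℕ) < x + 1 →
            ¬ Entry D r (flags n s .inside) (flags n s .block) v z y) := by
        intro u hu hy
        rcases ht with h | h
        · exact Or.inl (by rwa [hu])
        · refine Or.inr fun z y hz => ?_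
          rcases Nat.lt_succ_iff_lt_or_eq.1 hz with h' | h'
          · exact h z y h'
          · rw [Fin.ext h']
            exact hy y
      by_cases h : x ∈ flags n s .block
      · rw [sem_ite_of (by rw [← hb] at h; simpa [mem_flags] using h)]
        rcases probe_found (hs.frame hf' (by decide) (by decide) (by decide)) (x := x) (by simp) hv'
          with ⟨y, h₁, h₂⟩ | ⟨h₁, h₂⟩
        · rw [hb, hi] at h₂
          exact Or.inl ⟨x, y, h₁, h₂⟩
        · rw [hb, hi] at h₂
          exact hkeep (by rw [h₁]; simp) h₂
      · rw [sem_ite_of_not (by rw [← hb] at h; simpa [mem_flags] using h), sem_skip]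
        exact hkeep (by simp) fun y hy => h (hsub hy.1))
  rcases this with h | h
  · exact Or.inl h
  · exact Or.inr fun x y => h x y x.2

/-- Add `vtx` with its two parents. -/
def commit : Cmd :=
  .seq (.put .inside (.var .vtx) (.const 1)) (.seq (.put .low (.var .vtx) (.var .first))
    (.seq (.put .high (.var .vtx) (.var .found)) (.put .done (.const 0) (.const 1))))

/-- Let `covered` be the set of the vertices that are not in the way of adding `vtx`. -/
def cover : Cmd :=
  .seq (fill .block (.or (.get .inside (.var .idx)) (.eq (.var .idx) (.var .vtx))))
    (.seq (fill .covered (.get .block (.var .idx))) explore)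

theorem flags_cover_block {v : Fin n} (hv : s.arr .vtx 0 = v) :
    flags n ((fill .block (.or (.get .inside (.var .idx)) (.eq (.var .idx) (.var .vtx)))).sem n s)
      .block = insert v (flags n s .inside) := by
  rw [flags_fill (by decide) (by decide)]
  ext w
  simp [hv, Fin.val_inj, mem_flags, or_comm]

/-- `covered` starts as the enlarged set, and each member of that set adds the vertices it is a
witness for. -/
theorem cover_covered (hs : Env D r k s) {v : Fin n} (hv : s.arr .vtx 0 = v) :
    flags n (cover.sem n s) .covered = Set.univ ↔
      Open D.Adj r (insert v (flags n s .inside)) := by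
  have hb := flags_cover_block hv
  set s₁ := (fill .block (.or (.get .inside (.var .idx)) (.eq (.var .idx) (.var .vtx)))).sem n s
    with hs₁
  have he₁ : Env D r k s₁ := hs.sem _ (by decide) (by decide) (by decide)
  set s₂ := (fill .covered (.get .block (.var .idx))).sem n s₁ with hs₂
  have he₂ : Env D r k s₂ := he₁.sem _ (by decide) (by decide) (by decide)
  have hb₂ : flags n s₂ .block = insert v (flags n s .inside) := by
    rw [hs₂, flags_sem _ (by decide), hb]
  have hc₂ : flags n s₂ .covered = insert v (flags n s .inside) := by
    rw [← hb, hs₂, flags_fill (by decide) (by decide)]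
    ext w
    simp [mem_flags]
  have heq : cover.sem n s = explore.sem n s₂ := rfl
  rw [heq, explore_covered he₂, hb₂, hc₂, Set.eq_univ_iff_forall]
  exact forall_congr' fun w => or_iff_not_imp_left

/-- An entry exists because `v` has a witness for the old set: cut its path at the first visit to
`v`. -/
theorem cover_found (hs : Env D r k s) {v : Fin n} (hv : s.arr .vtx 0 = v)
    (hopen : Open D.Adj r (flags n s .inside)) (hvA : v ∉ flags n s .inside) :
    ∃ x y : Fin n, (cover.sem n s).arr .found 0 = y ∧
      Entry D r (flags n s .inside) (insert v (flags n s .inside)) v x y := by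
  have hb := flags_cover_block hv
  set s₁ := (fill .block (.or (.get .inside (.var .idx)) (.eq (.var .idx) (.var .vtx)))).sem n s
    with hs₁
  have he₁ : Env D r k s₁ := hs.sem _ (by decide) (by decide) (by decide)
  set s₂ := (fill .covered (.get .block (.var .idx))).sem n s₁ with hs₂
  have he₂ : Env D r k s₂ := he₁.sem _ (by decide) (by decide) (by decide)
  have hb₂ : flags n s₂ .block = insert v (flags n s .inside) := by
    rw [hs₂, flags_sem _ (by decide), hb]
  have hi₂ : flags n s₂ .inside = flags n s .inside := by
    rw [hs₂, flags_sem _ (by decide), hs₁, flags_sem _ (by decide)]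
  have hv₂ : s₂.arr .vtx 0 = v := by
    rw [hs₂, sem_arr_of_not_writes _ (by decide), hs₁, sem_arr_of_not_writes _ (by decide), hv]
  have heq : cover.sem n s = explore.sem n s₂ := rfl
  rw [heq, ← hb₂, ← hi₂]
  refine (explore_found he₂ hv₂ ?_).resolve_right fun h => ?_
  · rw [hb₂, hi₂]
    exact Set.subset_insert _ _
  · obtain ⟨x, hx, hdom, hpath⟩ := hopen v hvA
    obtain ⟨y, hy, hyv⟩ := exists_last_arc hpath hdom.1
    refine h x y ⟨hi₂ ▸ hx, hdom, ?_, hyv⟩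
    rw [hb₂]
    exact hy

/-- Add `vtx` if that is possible and nothing has been added in this round. -/
def attempt : Cmd :=
  .ite (.not (.or (.var .done) (.get .inside (.var .vtx))))
    (.seq (search .first (.and (.get .inside (.var .idx)) (.arc (.var .idx) (.var .vtx))))
      (.ite (.lt (.var .first) .size)
        (.seq cover (.seq (search .third (.not (.get .covered (.var .idx))))
          (.ite (.eq (.var .third) .size) commit .skip))) .skip)) .skip

theorem search_covered (s : Store) :
    ((search .third (.not (.get .covered (.var .idx)))).sem n s).arr .third 0 = n ↔
      flags n s .covered = Set.univ := by
  have hc : ∀ y, (Exp.not (.get .covered (.var .idx))).Holds n (s.put .idx 0 y) ↔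
      s.arr .covered y = 0 := by
    intro y
    simp
  rw [Set.eq_univ_iff_forall]
  rcases search_arr (n := n) (w := .third) (c := .not (.get .covered (.var .idx))) s
    (by decide) (by decide) with ⟨h₁, h₂⟩ | ⟨h₁, h₂⟩
  · refine ⟨fun h => absurd h h₁.ne, fun h => ?_⟩
    exact absurd ((hc _).1 h₂) (h ⟨_, h₁⟩)
  · exact ⟨fun _ y => fun hy => h₂ y y.2 ((hc y).2 hy), fun _ => h₁⟩

/-- `v` can be added to `A`. -/
def Addable (D : Digraph (Fin n)) (r : Fin n) (A : Set (Fin n)) (v : Fin n) : Prop :=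
  v ∉ A ∧ (∃ u ∈ A, D.Adj u v) ∧ Open D.Adj r (insert v A)

/-- The arrays that describe the growing trees have not changed. -/
def SameTrees (s t : Store) : Prop :=
  t.arr .inside = s.arr .inside ∧ t.arr .low = s.arr .low ∧ t.arr .high = s.arr .high ∧
    t.arr .done = s.arr .done

theorem attempt_spec (hs : Env D r k s) {v : Fin n} (hv : s.arr .vtx 0 = v)
    (hopen : Open D.Adj r (flags n s .inside)) :
    (SameTrees s (attempt.sem n s) ∧
      (s.arr .done 0 ≠ 0 ∨ ¬ Addable D r (flags n s .inside) v)) ∨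
    (s.arr .done 0 = 0 ∧ v ∉ flags n s .inside ∧ Open D.Adj r (insert v (flags n s .inside)) ∧
      (attempt.sem n s).arr .done 0 ≠ 0 ∧ ∃ u x y : Fin n, u ∈ flags n s .inside ∧ D.Adj u v ∧
      Entry D r (flags n s .inside) (insert v (flags n s .inside)) v x y ∧ ∀ w : Fin n,
        (attempt.sem n s).arr .inside w = (if w = v then 1 else s.arr .inside w) ∧
        (attempt.sem n s).arr .low w = (if w = v then (u : ℕ) else s.arr .low w) ∧
        (attempt.sem n s).arr .high w = (if w = v then (y : ℕ) else s.arr .high w)) := by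
  by_cases hd : s.arr .done 0 = 0
  swap
  · rw [attempt, sem_ite_of_not (by simp [hd])]
    exact Or.inl ⟨⟨rfl, rfl, rfl, rfl⟩, Or.inl hd⟩
  by_cases hvA : v ∈ flags n s .inside
  · rw [attempt, sem_ite_of_not (by rw [mem_flags] at hvA; simp [hv, hvA])]
    exact Or.inl ⟨⟨rfl, rfl, rfl, rfl⟩, Or.inr fun h => h.1 hvA⟩
  rw [attempt, sem_ite_of (by rw [mem_flags] at hvA; simp [hd, hv, not_not.1 hvA]), sem_seq]
  have hc : ∀ y : Fin n, (Exp.and (.get .inside (.var .idx)) (.arc (.var .idx) (.var .vtx))).Holds n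
      (s.put .idx 0 y) ↔ y ∈ flags n s .inside ∧ D.Adj y v := by
    intro y
    rw [mem_flags, ← hs.arc]
    simp [hv, hs.mul]
  have hsearch := search_arr (n := n) (w := .first)
    (c := .and (.get .inside (.var .idx)) (.arc (.var .idx) (.var .vtx))) s (by decide) (by decide)
  set s₁ := (search .first (.and (.get .inside (.var .idx)) (.arc (.var .idx) (.var .vtx)))).sem n s
    with hs₁
  have f₁ : ∀ a, (search .first (.and (.get .inside (.var .idx))
      (.arc (.var .idx) (.var .vtx)))).writes a = false → s₁.arr a = s.arr a :=
    fun a ha => sem_arr_of_not_writes _ ha s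
  have hi₁ : flags n s₁ .inside = flags n s .inside := flags_congr (f₁ _ (by decide))
  rcases hsearch with ⟨h₁, h₂⟩ | ⟨h₁, h₂⟩
  swap
  · rw [sem_ite_of_not (by simpa using h₁.ge), sem_skip]
    refine Or.inl ⟨⟨f₁ _ (by decide), f₁ _ (by decide), f₁ _ (by decide), f₁ _ (by decide)⟩,
      Or.inr ?_⟩
    rintro ⟨-, ⟨u, hu, huv⟩, -⟩
    exact h₂ u u.2 ((hc u).2 ⟨hu, huv⟩)
  have hu := (hc ⟨_, h₁⟩).1 h₂
  rw [sem_ite_of (by simpa using h₁), sem_seq, sem_seq]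
  have he₁ : Env D r k s₁ := hs.sem _ (by decide) (by decide) (by decide)
  have hv₁ : s₁.arr .vtx 0 = v := by rw [f₁ _ (by decide), hv]
  have hcov := cover_covered he₁ hv₁
  have hfound := cover_found he₁ hv₁ (by rwa [hi₁]) (by rwa [hi₁])
  rw [hi₁] at hcov hfound
  have hthird := search_covered (n := n) (cover.sem n s₁)
  set s₂ := (search .third (.not (.get .covered (.var .idx)))).sem n (cover.sem n s₁) with hs₂
  have f₂ : ∀ a, (seq cover (search .third (.not (.get .covered (.var .idx))))).writes a = false →
      s₂.arr a = s₁.arr a :=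
    fun a ha => sem_arr_of_not_writes _ ha s₁
  have hfd : s₂.arr .found = (cover.sem n s₁).arr .found := sem_arr_of_not_writes _ (by decide) _
  rw [hcov] at hthird
  by_cases hop : Open D.Adj r (insert v (flags n s .inside))
  swap
  · rw [sem_ite_of_not (by simpa using fun h => hop (hthird.1 h)), sem_skip]
    refine Or.inl ⟨⟨?_, ?_, ?_, ?_⟩, Or.inr fun h => hop h.2.2⟩ <;>
    rw [f₂ _ (by decide), f₁ _ (by decide)]
  obtain ⟨x, y, hy, hentry⟩ := hfound
  rw [← hfd] at hy
  rw [sem_ite_of (by simpa using hthird.2 hop)]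
  have hv₂ : s₂.arr .vtx 0 = v := by rw [f₂ _ (by decide), hv₁]
  have hu₂ : s₂.arr .first 0 = s₁.arr .first 0 := by rw [f₂ _ (by decide)]
  have hin : s₂.arr .inside = s.arr .inside := by rw [f₂ _ (by decide), f₁ _ (by decide)]
  have hlow : s₂.arr .low = s.arr .low := by rw [f₂ _ (by decide), f₁ _ (by decide)]
  have hhigh : s₂.arr .high = s.arr .high := by rw [f₂ _ (by decide), f₁ _ (by decide)]
  refine Or.inr ⟨hd, hvA, hop, ?_, ⟨_, h₁⟩, x, y, hu.1, hu.2, hentry, fun w => ⟨?_, ?_, ?_⟩⟩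
  · simp [commit, sem_seq, sem_put]
  · simp [commit, sem_seq, sem_put, hv₂, hin, Fin.ext_iff]
  · simp [commit, sem_seq, sem_put, hv₂, hlow, hu₂, Fin.ext_iff]
  · simp [commit, sem_seq, sem_put, hv₂, hhigh, hy, Fin.ext_iff]

end LeafyKernel

/-! ### Computing the two independent trees -/

namespace LeafyKernel

open BoundedLoop Cmd Relation

variable {n : ℕ} {D : Digraph (Fin n)} {r : Fin n} {k : ℕ} {s t : Store}

/-- The array `a` is the function `f`. -/
def Stores (s : Store) (a : Cell) (f : Fin n → Fin n) : Prop := ∀ v : Fin n, s.arr a v = f v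

/-- The arrays hold a pair of trees that is still growing. -/
def Growing (D : Digraph (Fin n)) (r : Fin n) (s : Store) : Prop :=
  ∃ f b t, PartialLowHigh D.Adj r (flags n s .inside) f b t ∧ Stores s .low f ∧ Stores s .high b

theorem Growing.congr (h : Growing D r s) (h₁ : t.arr .inside = s.arr .inside)
    (h₂ : t.arr .low = s.arr .low) (h₃ : t.arr .high = s.arr .high) : Growing D r t := by
  simpa only [Growing, Stores, flags, h₁, h₂, h₃] using h

theorem attempt_growing (hs : Env D r k s) {v : Fin n} (hv : s.arr .vtx 0 = v)
    (hg : Growing D r s) :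
    Growing D r (attempt.sem n s) ∧
    ((flags n (attempt.sem n s) .inside = flags n s .inside ∧
      (attempt.sem n s).arr .done 0 = s.arr .done 0 ∧
      (s.arr .done 0 ≠ 0 ∨ ¬ Addable D r (flags n s .inside) v)) ∨
    (flags n s .inside ⊂ flags n (attempt.sem n s) .inside ∧
      (attempt.sem n s).arr .done 0 ≠ 0)) := by
  obtain ⟨f, b, t, h, hf, hb⟩ := hg
  rcases attempt_spec hs hv h.isOpen with ⟨⟨h₁, h₂, h₃, h₄⟩, h₅⟩ |
    ⟨-, hvA, hop, hdone, u, x, y, hu, huv, ⟨hx, hdom, hpath, hyv⟩, hw⟩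
  · refine ⟨Growing.congr ⟨f, b, t, h, hf, hb⟩ h₁ h₂ h₃, Or.inl ⟨flags_congr h₁, ?_, h₅⟩⟩
    rw [h₄]
  · have hins : flags n (attempt.sem n s) .inside = insert v (flags n s .inside) := by
      ext w
      rw [mem_flags, (hw w).1, Set.mem_insert_iff, mem_flags]
      by_cases hwv : w = v <;> simp [hwv]
    obtain ⟨t', ht'⟩ := h.insert hvA hu huv hx hdom hpath hyv hop
    refine ⟨⟨_, _, t', hins ▸ ht', fun w => ?_, fun w => ?_⟩, Or.inr ⟨?_, hdone⟩⟩
    · rw [(hw w).2.1, Function.update_apply, hf w]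
      split_ifs <;> rfl
    · rw [(hw w).2.2, Function.update_apply, hb w]
      split_ifs <;> rfl
    · rw [hins]
      exact Set.ssubset_insert hvA

/-- Add one vertex. -/
def growOnce : Cmd := .seq (.put .done (.const 0) (.const 0)) (.loop .vtx attempt)

theorem growOnce_spec (hs : Env D r k s) (hreach : ∀ v, ReflTransGen D.Adj r v)
    (hg : Growing D r s) :
    Growing D r (growOnce.sem n s) ∧ (flags n (growOnce.sem n s) .inside = Set.univ ∨
      (flags n s .inside).ncard < (flags n (growOnce.sem n s) .inside).ncard) := by
  have := loop_frame (n := n) (a := .vtx) (P := attempt) (s := s.put .done 0 0)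
    (fun j t => Growing D r t ∧
      ((flags n t .inside = flags n s .inside ∧ t.arr .done 0 = 0 ∧
        ∀ v : Fin n, (v : ℕ) < j → ¬ Addable D r (flags n s .inside) v) ∨
      (flags n s .inside ⊂ flags n t .inside ∧ t.arr .done 0 ≠ 0)))
    ⟨hg.congr (Store.put_arr_of_ne _ (by decide) _ _) (Store.put_arr_of_ne _ (by decide) _ _)
      (Store.put_arr_of_ne _ (by decide) _ _),
      Or.inl ⟨flags_put_of_ne (by decide) _ _, by simp, by simp⟩⟩ (fun v t hf ht => by
      have he : Env D r k (t.put .vtx 0 v) :=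
        (hs.put (a := .done) (by decide) (by decide) (by decide) 0 0).frame (hf.put v) (by decide)
          (by decide) (by decide)
      have hg' : Growing D r (t.put .vtx 0 v) :=
        ht.1.congr (Store.put_arr_of_ne _ (by decide) _ _) (Store.put_arr_of_ne _ (by decide) _ _)
          (Store.put_arr_of_ne _ (by decide) _ _)
      have hi : flags n (t.put .vtx 0 v) .inside = flags n t .inside :=
        flags_put_of_ne (by decide) _ _
      have hd : (t.put .vtx 0 v).arr .done 0 = t.arr .done 0 := by simp
      obtain ⟨h₁, h₂⟩ := attempt_growing he (v := v) (by simp) hg'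
      rw [hi, hd] at h₂
      refine ⟨h₁, ?_⟩
      rcases ht.2 with ⟨e₁, e₂, e₃⟩ | ⟨e₁, e₂⟩
      · rw [e₁] at h₂
        rcases h₂ with ⟨g₁, g₂, g₃⟩ | h₂
        · refine Or.inl ⟨g₁, g₂.trans e₂, fun w hw => ?_⟩
          rcases Nat.lt_succ_iff_lt_or_eq.1 hw with h' | h'
          · exact e₃ w h'
          · rw [Fin.ext h']
            exact g₃.resolve_left (not_not.2 e₂)
        · exact Or.inr h₂
      · rcases h₂ with ⟨g₁, g₂, -⟩ | ⟨g₁, g₂⟩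
        · exact Or.inr ⟨g₁ ▸ e₁, g₂ ▸ e₂⟩
        · exact Or.inr ⟨e₁.trans g₁, g₂⟩)
  refine ⟨this.1, ?_⟩
  rcases this.2 with ⟨e₁, -, e₃⟩ | ⟨e₁, -⟩
  · left
    by_contra hne
    obtain ⟨f, b, t, h, -, -⟩ := hg
    rw [growOnce, sem_seq] at hne
    change ¬ flags n ((loop .vtx attempt).sem n (s.put .done 0 0)) .inside = _ at hne
    rw [e₁, Set.eq_univ_iff_forall, not_forall] at hne
    -- If nothing was added, all vertices were tested against the same set, so none is addable; this
    -- is possible only for the full set.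
    obtain ⟨v, hv⟩ := exists_open_insert hreach h.root_mem h.isOpen hne
    exact e₃ v v.2 hv
  · exact Or.inr (Set.ncard_lt_ncard e₁ (Set.toFinite _))

/-- Compute the two trees `low` and `high`. -/
def grow : Cmd :=
  .seq (.seq (fill .inside (.eq (.var .idx) .root)) (.seq (fill .low .root) (fill .high .root)))
    (.loop .stp growOnce)

theorem growing_init (hs : Ctx D r k s) (hreach : ∀ v, ReflTransGen D.Adj r v) :
    Growing D r ((seq (fill .inside (.eq (.var .idx) .root))
      (.seq (fill .low .root) (fill .high .root))).sem n s) := by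
  have hr₁ : ((fill .inside (.eq (.var .idx) .root)).sem n s).arr .input 0 = r := by
    rw [sem_arr_of_not_writes _ (by decide), hs.root]
  have hr₂ : ((fill .low .root).sem n
      ((fill .inside (.eq (.var .idx) .root)).sem n s)).arr .input 0 = r := by
    rw [sem_arr_of_not_writes _ (by decide), hr₁]
  have hA : flags n ((seq (fill .inside (.eq (.var .idx) .root))
      (.seq (fill .low .root) (fill .high .root))).sem n s) .inside = {r} := by
    rw [sem_seq, flags_sem _ (by decide), flags_fill (by decide) (by decide)]
    ext v
    simp [hs.root, Fin.val_inj]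
  refine ⟨fun _ => r, fun _ => r, fun _ => 0, ?_, fun v => ?_, fun v => ?_⟩
  · rw [hA]
    exact ⟨rfl, open_singleton hreach, Set.injOn_singleton _ _, rfl, rfl,
      fun v hv hv' => absurd hv hv', fun v hv hv' => absurd hv hv',
      fun v hv hv' => absurd hv hv', fun v hv hv' => absurd hv hv'⟩
  · rw [sem_seq, sem_seq, sem_arr_of_not_writes (fill .high .root) (by decide),
      fill_arr _ (by decide) (by decide) _ v.2]
    simpa using hr₁
  · rw [sem_seq, sem_seq, fill_arr _ (by decide) (by decide) _ v.2]
    simpa using hr₂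

/-- Each round enlarges the set or finds it full, so `n` rounds suffice. -/
theorem grow_spec (hs : Env D r k s) (hreach : ∀ v, ReflTransGen D.Adj r v) :
    ∃ f b t, LowHigh D.Adj r f b t ∧ Stores (grow.sem n s) .low f ∧
      Stores (grow.sem n s) .high b := by
  set s₁ := (seq (fill .inside (.eq (.var .idx) .root))
    (.seq (fill .low .root) (fill .high .root))).sem n s with hs₁
  have he₁ : Env D r k s₁ := hs.sem _ (by decide) (by decide) (by decide)
  have := loop_frame (n := n) (a := .stp) (P := growOnce) (s := s₁)
    (fun j t => Growing D r t ∧ (flags n t .inside = Set.univ ∨ j ≤ (flags n t .inside).ncard))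
    ⟨growing_init hs.toCtx hreach, Or.inr (Nat.zero_le _)⟩ (fun j t hf ht => by
      have he : Env D r k (t.put .stp 0 j) :=
        he₁.frame (hf.put j) (by decide) (by decide) (by decide)
      have hg' : Growing D r (t.put .stp 0 j) :=
        ht.1.congr (Store.put_arr_of_ne _ (by decide) _ _) (Store.put_arr_of_ne _ (by decide) _ _)
          (Store.put_arr_of_ne _ (by decide) _ _)
      have hi : flags n (t.put .stp 0 j) .inside = flags n t .inside :=
        flags_put_of_ne (by decide) _ _
      obtain ⟨h₁, h₂⟩ := growOnce_spec he hreach hg'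
      rw [hi] at h₂
      refine ⟨h₁, h₂.imp_right fun h₂ => ?_⟩
      rcases ht.2 with h | h
      · rw [h, Set.ncard_univ, Nat.card_eq_fintype_card, Fintype.card_fin] at h₂
        exact j.2.trans h₂
      · omega)
  obtain ⟨⟨f, b, t, h, hf, hb⟩, hA⟩ := this
  have huniv : flags n ((loop .stp growOnce).sem n s₁) .inside = Set.univ :=
    hA.elim id fun hA => Set.eq_of_subset_of_ncard_le (Set.subset_univ _)
      (by simpa [Set.ncard_univ] using hA)
  rw [huniv] at h
  exact ⟨f, b, t, h.lowHigh, hf, hb⟩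

end LeafyKernel

namespace LeafyKernel

open BoundedLoop Cmd Relation

variable {n : ℕ} {D : Digraph (Fin n)} {r : Fin n} {k : ℕ} {s t : Store}

theorem Stores.congr {a : Cell} {f : Fin n → Fin n} (h : Stores s a f) (ht : t.arr a = s.arr a) :
    Stores t a f := fun v => by rw [ht, h v]

theorem Stores.sem {a : Cell} {f : Fin n → Fin n} (h : Stores s a f) (P : Cmd)
    (hP : P.writes a = false) : Stores (P.sem n s) a f :=
  h.congr (P.sem_arr_of_not_writes hP s)

theorem Stores.put {a b : Cell} {f : Fin n → Fin n} (h : Stores s a f) (hab : a ≠ b) (i x : ℕ) :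
    Stores (s.put b i x) a f :=
  h.congr (Store.put_arr_of_ne _ hab _ _)

/-! ### The order of a tree -/

/-- Tabulate in `anc` the ancestors in `tree` of the vertices. -/
def computeAnc : Cmd :=
  table .anc (.seq (.seq (fill .mark (.const 0)) (.put .cc (.const 0) (.var .vtx)))
    (.loop .idx (.seq (.put .mark (.var .cc) (.const 1))
      (.put .cc (.const 0) (.get .tree (.var .cc))))))

theorem computeAnc_spec (hs : Ctx D r k s) {p : Fin n → Fin n} (hp : Stores s .tree p)
    (v u : Fin n) : rel n (computeAnc.sem n s) .anc v u ↔ Anc p u v := by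
  refine table_spec hs (fun v u => Anc p u v) (by decide) (by decide) (by decide) (by decide)
    (by decide) (by decide) (by decide) (fun v t hf hv => ?_) v u
  set t₁ := (seq (fill .mark (.const 0)) (.put .cc (.const 0) (.var .vtx))).sem n t with ht₁
  have hm₁ : flags n t₁ .mark = ∅ := by
    have : flags n t₁ .mark = flags n ((fill .mark (.const 0)).sem n t) .mark :=
      flags_put_of_ne (by decide) _ _
    rw [this, flags_fill (by decide) (by decide)]
    ext w
    simp [Exp.Holds]
  have hc₁ : t₁.arr .cc 0 = v := by
    have : t₁.arr .cc 0 = ((fill .mark (.const 0)).sem n t).arr .vtx 0 := by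
      simp [ht₁, sem_seq, sem_put]
    rw [this, sem_arr_of_not_writes _ (by decide), hv]
  have hp₁ : Stores t₁ .tree p := (hp.congr (hf _ (by decide))).sem _ (by decide)
  have := loop_frame (n := n) (a := .idx) (P := .seq (.put .mark (.var .cc) (.const 1))
      (.put .cc (.const 0) (.get .tree (.var .cc)))) (s := t₁)
    (fun j t => t.arr .cc 0 = p^[j] v ∧ flags n t .mark = {u | ∃ m < j, p^[m] v = u})
    ⟨by simpa using hc₁, by simpa using hm₁⟩ (fun j t hf ht => by
      have hpt : Stores t .tree p := hp₁.congr (hf _ (by decide))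
      refine ⟨?_, ?_⟩
      · simp [sem_seq, sem_put, ht.1, hpt _, Function.iterate_succ_apply']
      · have hmark : ∀ w : Fin n, w ∈ flags n t .mark ↔ ∃ m < (j : ℕ), p^[m] v = w := by
          intro w
          rw [ht.2]
          rfl
        ext w
        simp only [mem_flags] at hmark
        simp only [mem_flags, sem_seq, sem_put, Store.put_arr, Exp.eval_var, Exp.eval_const,
          reduceCtorEq, false_and, if_false, true_and, ht.1, Fin.val_inj, Set.mem_ofPred_eq]
        by_cases hw : w = p^[j] v
        · rw [if_pos hw]
          exact iff_of_true one_ne_zero ⟨j, Nat.lt_succ_self _, hw.symm⟩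
        · rw [if_neg hw, hmark]
          constructor
          · rintro ⟨m, hm, h⟩
            exact ⟨m, by omega, h⟩
          · rintro ⟨m, hm, h⟩
            rcases Nat.lt_succ_iff_lt_or_eq.1 hm with h' | h'
            · exact ⟨m, h', h⟩
            · exact absurd (h' ▸ h.symm) hw)
  rw [sem_seq, ← ht₁, this.2]
  ext u
  constructor
  · rintro ⟨m, -, h⟩
    exact ⟨m, h⟩
  · intro h
    -- The `n` rounds record the iterates `0, …, n - 1`, which include all ancestors.
    simpa using h.exists_iterate_lt

/-- The order of the vertices, reversed unless `φ = 0`. -/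
def direction (φ : ℕ) (a b : Fin n) : Prop := (φ = 0 ∧ a < b) ∨ (φ ≠ 0 ∧ b < a)

/-- `cc` and `dd` are siblings in this order, and `vtx` lies below `cc`. -/
def siblingTest : Exp :=
  .and (.or (.and (.not (.var .flip)) (.lt (.var .cc) (.var .dd)))
      (.and (.var .flip) (.lt (.var .dd) (.var .cc))))
    (.and (.not (.eq (.var .cc) .root)) (.and (.not (.eq (.var .dd) .root))
      (.and (.eq (.get .tree (.var .cc)) (.get .tree (.var .dd)))
        (.entry .anc (.var .vtx) (.var .cc)))))

/-- Tabulate the order of the vertices of `tree`. -/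
def computeOrder : Cmd :=
  table .order (.seq (fill .mark (.and (.not (.eq (.var .vtx) (.var .idx)))
      (.entry .anc (.var .idx) (.var .vtx))))
    (.loop .cc (.loop .dd (.ite siblingTest (fillOr .mark (.entry .anc (.var .idx) (.var .dd)))
      .skip))))

theorem holds_siblingTest (hs : Ctx D r k s) {p : Fin n → Fin n} (hp : Stores s .tree p)
    (hanc : ∀ v u, rel n s .anc v u ↔ Anc p u v) {u c d : Fin n} (hu : s.arr .vtx 0 = u)
    (hc : s.arr .cc 0 = c) (hd : s.arr .dd 0 = d) :
    siblingTest.Holds n s ↔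
      direction (s.arr .flip 0) c d ∧ c ≠ r ∧ d ≠ r ∧ p c = p d ∧ Anc p c u := by
  rw [← hanc, rel]
  simp only [siblingTest, direction, Exp.holds_and, Exp.holds_or, Exp.holds_not, Exp.holds_var,
    Exp.holds_lt, Exp.holds_eq, Exp.holds_entry, Exp.eval_var, Exp.eval_get, Exp.eval_root, hu, hc,
    hd, hs.root, hs.mul, hp c, hp d, Fin.val_inj, Fin.val_fin_lt, ne_eq, not_not]

theorem computeOrder_spec (hs : Ctx D r k s) {p : Fin n → Fin n} (hp : Stores s .tree p)
    (hanc : ∀ v u, rel n s .anc v u ↔ Anc p u v) (u v : Fin n) :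
    rel n (computeOrder.sem n s) .order u v ↔
      SiblingOrder (direction (s.arr .flip 0)) r p u v := by
  refine table_spec hs _ (by decide) (by decide) (by decide) (by decide) (by decide) (by decide)
    (by decide) (fun u t hf hu => ?_) u v
  have hct : Ctx D r k t := hs.frame hf (by decide) (by decide)
  have hat : t.arr .anc = s.arr .anc := hf _ (by decide)
  set t₁ := (fill .mark (.and (.not (.eq (.var .vtx) (.var .idx)))
    (.entry .anc (.var .idx) (.var .vtx)))).sem n t with ht₁
  have hm₁ : flags n t₁ .mark = {v | u ≠ v ∧ Anc p u v} := by
    rw [ht₁, flags_fill (by decide) (by decide)]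
    ext v
    rw [Set.mem_ofPred_eq, Set.mem_ofPred_eq, ← hanc, rel]
    simp [hu, hct.mul, hat, Fin.val_inj]
  have hf₁ : ∀ a, a ≠ .mark → a ≠ .idx → t₁.arr a = t.arr a := fun a h₁ h₂ =>
    sem_arr_of_not_writes _ (by simp [fill, writes, h₁.symm, h₂.symm]) t
  rw [sem_seq, ← ht₁, flags_loop (by decide) (fun c => ⋃ d, {w | direction (s.arr .flip 0) c d ∧
    c ≠ r ∧ d ≠ r ∧ p c = p d ∧ Anc p c u ∧ Anc p d w})]
  · rw [hm₁]
    ext w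
    simp [SiblingOrder]
  · intro c t₂ hf₂ hc
    rw [flags_loop (by decide) (fun d => {w | direction (s.arr .flip 0) c d ∧
      c ≠ r ∧ d ≠ r ∧ p c = p d ∧ Anc p c u ∧ Anc p d w})]
    intro d t₃ hf₃ hd
    have hall : ∀ a, computeOrder.writes a = false → t₃.arr a = s.arr a := by
      intro a ha
      simp only [computeOrder, table, fill, fillOr, copyRow, writes, Bool.or_eq_false_iff,
        beq_eq_false_iff_ne] at ha
      rw [hf₃ a (by simp [writes, fillOr, fill, ha]), hf₂ a (by simp [writes, fillOr, fill, ha]),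
        hf₁ a (by tauto) (by tauto), hf a (by simp [table, writes, fillOr, fill, copyRow, ha])]
    have hctx₃ : Ctx D r k t₃ := hs.congr (hall _ (by decide)) (hall _ (by decide))
    have hanc₃ : ∀ v u, rel n t₃ .anc v u ↔ Anc p u v := by
      simpa only [rel, hall .anc (by decide)] using hanc
    have hu₃ : t₃.arr .vtx 0 = u := by
      rw [hf₃ _ (by decide), hf₂ _ (by decide), hf₁ _ (by decide) (by decide), hu]
    have hc₃ : t₃.arr .cc 0 = c := by rw [hf₃ _ (by decide), hc]
    have htest := holds_siblingTest hctx₃ (hp.congr (hall _ (by decide))) hanc₃ hu₃ hc₃ hd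
    rw [hall .flip (by decide)] at htest
    by_cases h : siblingTest.Holds n t₃
    · rw [sem_ite_of h, flags_fillOr (by decide) (by decide)]
      congr 1
      ext w
      rw [htest] at h
      rw [Set.mem_ofPred_eq, Set.mem_ofPred_eq, ← hanc₃ w d, rel]
      simp [h, hd, hctx₃.mul]
    · rw [sem_ite_of_not h, sem_skip]
      symm
      rw [Set.union_eq_left]
      rintro w ⟨h₁, h₂, h₃, h₄, h₅, -⟩
      exact absurd (htest.2 ⟨h₁, h₂, h₃, h₄, h₅⟩) h

/-! ### Local search -/

/-- Collect in `movable` the vertices that can be moved below `ll`. -/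
def markMovable : Cmd :=
  .loop .vtx (.seq
    (search .first (.and (.not (.eq (.var .idx) (.var .vtx))) (.and (.not (.eq (.var .idx) .root))
      (.eq (.get .parent (.var .idx)) (.get .parent (.var .vtx))))))
    (.put .movable (.var .vtx) (.and (.not (.eq (.var .vtx) .root))
      (.and (.and (.arc (.var .ll) (.var .vtx)) (.entry .order (.var .ll) (.var .vtx)))
        (.and (.not (.eq (.get .parent (.var .vtx)) (.var .ll)))
          (.eq (.var .first) .size))))))

/-- The state of the local search: the matrix `order` is `R` and the current tree is `p`. -/
structure Searching (D : Digraph (Fin n)) (r : Fin n) (k : ℕ) (R : Fin n → Fin n → Prop)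
    (s : Store) (p : Fin n → Fin n) : Prop extends Ctx D r k s where
  order : ∀ u v, rel n s .order u v ↔ R u v
  parent : Stores s .parent p

variable {R : Fin n → Fin n → Prop} {p : Fin n → Fin n}

theorem Searching.congr (h : Searching D r k R s p) (h₁ : t.arr .mulTable = s.arr .mulTable)
    (h₂ : t.arr .input = s.arr .input) (h₃ : t.arr .order = s.arr .order)
    (h₄ : t.arr .parent = s.arr .parent) : Searching D r k R t p :=
  ⟨h.toCtx.congr h₁ h₂, by simpa only [rel, h₃] using h.order, h.parent.congr h₄⟩

theorem Searching.frame (h : Searching D r k R s p) {P : Cmd} (ht : Frame P s t)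
    (h₁ : P.writes .mulTable = false) (h₂ : P.writes .input = false)
    (h₃ : P.writes .order = false) (h₄ : P.writes .parent = false) : Searching D r k R t p :=
  h.congr (ht _ h₁) (ht _ h₂) (ht _ h₃) (ht _ h₄)

theorem markMovable_spec (hs : Searching D r k R s p) {l : Fin n} (hl : s.arr .ll 0 = l) :
    flags n (markMovable.sem n s) .movable =
      {v | Movable (fun u v => D.Adj u v ∧ R u v) r p l v} := by
  have := loop_frame (n := n) (a := .vtx) (P := .seq
    (search .first (.and (.not (.eq (.var .idx) (.var .vtx))) (.and (.not (.eq (.var .idx) .root))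
      (.eq (.get .parent (.var .idx)) (.get .parent (.var .vtx))))))
    (.put .movable (.var .vtx) (.and (.not (.eq (.var .vtx) .root))
      (.and (.and (.arc (.var .ll) (.var .vtx)) (.entry .order (.var .ll) (.var .vtx)))
        (.and (.not (.eq (.get .parent (.var .vtx)) (.var .ll)))
          (.eq (.var .first) .size)))))) (s := s)
    (fun j t => ∀ v : Fin n, (v : ℕ) < j →
      (v ∈ flags n t .movable ↔ Movable (fun u v => D.Adj u v ∧ R u v) r p l v))
    (by simp) (fun v t hf ht w hw => by
      have hs₁ : Searching D r k R (t.put .vtx 0 v) p :=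
        hs.frame (hf.put v) (by decide) (by decide) (by decide) (by decide)
      have hl₁ : (t.put .vtx 0 v).arr .ll 0 = l := by rw [hf.put v _ (by decide), hl]
      have hv₁ : (t.put .vtx 0 v).arr .vtx 0 = v := by simp
      have ht₁ : flags n (t.put .vtx 0 v) .movable = flags n t .movable :=
        flags_put_of_ne (by decide) _ _
      rw [← ht₁] at ht
      set t₁ := t.put .vtx 0 v
      have hsearch := search_arr (n := n) (w := .first) (c := .and (.not (.eq (.var .idx)
        (.var .vtx))) (.and (.not (.eq (.var .idx) .root)) (.eq (.get .parent (.var .idx))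
          (.get .parent (.var .vtx))))) t₁ (by decide) (by decide)
      rw [sem_seq]
      set t₂ := (search .first (.and (.not (.eq (.var .idx) (.var .vtx)))
        (.and (.not (.eq (.var .idx) .root)) (.eq (.get .parent (.var .idx))
          (.get .parent (.var .vtx)))))).sem n t₁ with ht₂
      have hfr : ∀ a, a ≠ .first → a ≠ .idx → t₂.arr a = t₁.arr a := fun a h₁ h₂ =>
        sem_arr_of_not_writes _ (by simp [search, writes, h₁.symm, h₂.symm]) t₁
      have hs₂ : Searching D r k R t₂ p := hs₁.congr (hfr _ (by decide) (by decide))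
        (hfr _ (by decide) (by decide)) (hfr _ (by decide) (by decide))
        (hfr _ (by decide) (by decide))
      have hl₂ : t₂.arr .ll 0 = l := by rw [hfr _ (by decide) (by decide), hl₁]
      have hv₂ : t₂.arr .vtx 0 = v := by rw [hfr _ (by decide) (by decide), hv₁]
      have hm₂ : t₂.arr .movable = t₁.arr .movable := hfr _ (by decide) (by decide)
      have hc : ∀ y : Fin n, (Exp.and (.not (.eq (.var .idx) (.var .vtx)))
          (.and (.not (.eq (.var .idx) .root)) (.eq (.get .parent (.var .idx))
            (.get .parent (.var .vtx))))).Holds n (t₁.put .idx 0 y) ↔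
          y ≠ v ∧ y ≠ r ∧ p y = p v := by
        intro y
        have h₁ := hs₁.parent y
        have h₂ := hs₁.parent v
        simp [hv₁, hs₁.root, Fin.val_inj, h₁, h₂]
      have hfirst : t₂.arr .first 0 = n ↔ ∀ w, w ≠ r → p w = p v → w = v := by
        rcases hsearch with ⟨h₁, h₂⟩ | ⟨h₁, h₂⟩
        · refine ⟨fun h => absurd h h₁.ne, fun h => ?_⟩
          have := (hc ⟨_, h₁⟩).1 h₂
          exact absurd (h _ this.2.1 this.2.2) this.1
        · refine ⟨fun _ w hw hwv => ?_, fun _ => h₁⟩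
          by_contra hne
          exact h₂ w w.2 ((hc w).2 ⟨hne, hw, hwv⟩)
      by_cases hwv : w = v
      · subst hwv
        have hkey : (Exp.and (.not (.eq (.var .vtx) .root))
            (.and (.and (.arc (.var .ll) (.var .vtx)) (.entry .order (.var .ll) (.var .vtx)))
              (.and (.not (.eq (.get .parent (.var .vtx)) (.var .ll)))
                (.eq (.var .first) .size)))).Holds n t₂ ↔
            Movable (fun u v => D.Adj u v ∧ R u v) r p l w := by
          have h₂ := hs₂.parent w
          rw [Movable, ← hfirst, ← hs₂.order, rel, ← hs₂.arc]
          simp [hv₂, hl₂, hs₂.root, hs₂.mul, Fin.val_inj, h₂]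
        rw [← hkey, mem_flags, sem_put]
        simp only [Exp.eval_var, hv₂, Store.put_arr, and_self, if_true]
        rfl
      · have hne : (w : ℕ) ≠ v := fun h => hwv (Fin.ext h)
        rw [mem_flags, sem_put]
        simp only [Exp.eval_var, hv₂, Store.put_arr, hne, and_false, if_false, hm₂]
        exact ht w (by omega))
  ext v
  exact this v v.2

/-- Move the movable vertices below `ll`. -/
def moveAll : Cmd :=
  .loop .idx (.ite (.get .movable (.var .idx)) (.put .parent (.var .idx) (.var .ll)) .skip)

open Classical in
theorem moveAll_spec {l : Fin n} (hl : s.arr .ll 0 = l) (v : Fin n) :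
    (moveAll.sem n s).arr .parent v =
      if v ∈ flags n s .movable then (l : ℕ) else s.arr .parent v := by
  have := loop_frame (n := n) (a := .idx) (P := .ite (.get .movable (.var .idx))
      (.put .parent (.var .idx) (.var .ll)) .skip) (s := s)
    (fun j t => ∀ v : Fin n, t.arr .parent v =
      if (v : ℕ) < j ∧ v ∈ flags n s .movable then (l : ℕ) else s.arr .parent v)
    (by simp) (fun j t hf ht v => by
      have hm : t.arr .movable = s.arr .movable := hf _ (by decide)
      have hl' : t.arr .ll 0 = l := by rw [hf _ (by decide), hl]
      by_cases h : j ∈ flags n s .movable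
      · rw [sem_ite_of (by rw [mem_flags] at h; simpa [hm] using h), sem_put]
        simp only [Exp.eval_var, Store.put_arr, reduceCtorEq, false_and, if_false, and_self,
          if_true, true_and, hl', ht, Fin.val_inj, Nat.lt_succ_iff_lt_or_eq]
        by_cases hv : v = j
        · simp [hv, h]
        · simp [hv]
      · rw [sem_ite_of_not (by rw [mem_flags] at h; simpa [hm] using h), sem_skip,
          Store.put_arr_of_ne _ (by decide), ht]
        by_cases hv : v = j
        · simp [hv, h]
        · simp only [Nat.lt_succ_iff_lt_or_eq, Fin.val_inj, hv, or_false])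
  rw [moveAll, this]
  simp

/-- Move all movable vertices below `ll` if that creates a leaf. -/
def improve : Cmd :=
  .seq markMovable (.seq (search .second (.get .movable (.var .idx)))
    (.ite (.lt (.var .second) .size)
      (.seq (search .third (.and (.not (.eq (.var .idx) (.var .second)))
        (.and (.not (.eq (.var .idx) .root)) (.or (.get .movable (.var .idx))
          (.eq (.get .parent (.var .idx)) (.var .ll))))))
        (.ite (.lt (.var .third) .size) moveAll .skip)) .skip))

theorem improve_parent (hs : Searching D r k R s p) {l : Fin n} (hl : s.arr .ll 0 = l) :
    (Improvable (fun u v => D.Adj u v ∧ R u v) r p l ∧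
      Stores (improve.sem n s) .parent (move (fun u v => D.Adj u v ∧ R u v) r p l)) ∨
    (¬ Improvable (fun u v => D.Adj u v ∧ R u v) r p l ∧ Stores (improve.sem n s) .parent p) := by
  have hmov := markMovable_spec hs hl
  rw [improve, sem_seq, sem_seq]
  set s₁ := markMovable.sem n s with hs₁
  have hctx₁ : Ctx D r k s₁ := hs.toCtx.sem _ (by decide) (by decide)
  have hp₁ : Stores s₁ .parent p := hs.parent.sem _ (by decide)
  have hl₁ : s₁.arr .ll 0 = l := by rw [hs₁, sem_arr_of_not_writes _ (by decide), hl]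
  have hsearch := search_arr (n := n) (w := .second) (c := .get .movable (.var .idx)) s₁
    (by decide) (by decide)
  have hc : ∀ y : Fin n, (Exp.get .movable (.var .idx)).Holds n (s₁.put .idx 0 y) ↔
      Movable (fun u v => D.Adj u v ∧ R u v) r p l y := by
    intro y
    have : y ∈ flags n s₁ .movable ↔ Movable (fun u v => D.Adj u v ∧ R u v) r p l y := by
      rw [hmov]
      rfl
    rw [← this, mem_flags]
    simp
  set s₂ := (search .second (.get .movable (.var .idx))).sem n s₁ with hs₂
  have hctx₂ : Ctx D r k s₂ := hctx₁.sem _ (by decide) (by decide)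
  have hp₂ : Stores s₂ .parent p := hp₁.sem _ (by decide)
  have hl₂ : s₂.arr .ll 0 = l := by rw [hs₂, sem_arr_of_not_writes _ (by decide), hl₁]
  have hmov₂ : flags n s₂ .movable = {v | Movable (fun u v => D.Adj u v ∧ R u v) r p l v} := by
    rw [hs₂, flags_sem _ (by decide), hmov]
  rcases hsearch with ⟨h₁, h₂⟩ | ⟨h₁, h₂⟩
  swap
  · rw [sem_ite_of_not (by simpa using h₁.ge), sem_skip]
    refine Or.inr ⟨?_, hp₂⟩
    rintro ⟨v, hv, -⟩
    exact h₂ v v.2 ((hc v).2 hv)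
  rw [sem_ite_of (by simpa using h₁), sem_seq]
  obtain ⟨v, hv⟩ : ∃ v : Fin n, s₂.arr .second 0 = v := ⟨⟨_, h₁⟩, rfl⟩
  rw [hv, hc] at h₂
  have hsearch := search_arr (n := n) (w := .third) (c := .and (.not (.eq (.var .idx)
    (.var .second))) (.and (.not (.eq (.var .idx) .root)) (.or (.get .movable (.var .idx))
      (.eq (.get .parent (.var .idx)) (.var .ll))))) s₂ (by decide) (by decide)
  have hc₂ : ∀ y : Fin n, (Exp.and (.not (.eq (.var .idx)
      (.var .second))) (.and (.not (.eq (.var .idx) .root)) (.or (.get .movable (.var .idx))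
      (.eq (.get .parent (.var .idx)) (.var .ll))))).Holds n (s₂.put .idx 0 y) ↔
      y ≠ v ∧ y ≠ r ∧ (Movable (fun u v => D.Adj u v ∧ R u v) r p l y ∨ p y = l) := by
    intro y
    have : y ∈ flags n s₂ .movable ↔ Movable (fun u v => D.Adj u v ∧ R u v) r p l y := by
      rw [hmov₂]
      rfl
    have hy := hp₂ y
    rw [← this, mem_flags]
    simp [hv, hl₂, hctx₂.root, hy, Fin.val_inj]
  set s₃ := (search .third (.and (.not (.eq (.var .idx) (.var .second)))
    (.and (.not (.eq (.var .idx) .root)) (.or (.get .movable (.var .idx))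
      (.eq (.get .parent (.var .idx)) (.var .ll)))))).sem n s₂ with hs₃
  have hp₃ : Stores s₃ .parent p := hp₂.sem _ (by decide)
  have hl₃ : s₃.arr .ll 0 = l := by rw [hs₃, sem_arr_of_not_writes _ (by decide), hl₂]
  have hmov₃ : flags n s₃ .movable = {v | Movable (fun u v => D.Adj u v ∧ R u v) r p l v} := by
    rw [hs₃, flags_sem _ (by decide), hmov₂]
  rcases hsearch with ⟨g₁, g₂⟩ | ⟨g₁, g₂⟩
  · rw [sem_ite_of (by simpa using g₁)]
    refine Or.inl ⟨⟨v, h₂, ⟨_, g₁⟩, (hc₂ ⟨_, g₁⟩).1 g₂⟩, fun w => ?_⟩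
    rw [moveAll_spec hl₃, hmov₃, hp₃ w, move]
    by_cases hw : Movable (fun u v => D.Adj u v ∧ R u v) r p l w
    · rw [if_pos hw]
      exact if_pos hw
    · rw [if_neg hw]
      exact if_neg hw
  · rw [sem_ite_of_not (by simpa using g₁.ge), sem_skip]
    refine Or.inr ⟨?_, hp₃⟩
    rintro ⟨v', hv', w, hw⟩
    by_cases hvv : v' = v
    · subst hvv
      exact g₂ w w.2 ((hc₂ w).2 hw)
    -- Testing a single movable `v` is enough: any other movable `v'` is itself a partner for `v`.
    · exact g₂ v' v'.2 ((hc₂ v').2 ⟨hvv, hv'.1, Or.inl hv'⟩)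

end LeafyKernel

/-! ### Termination of the local search and its outcome -/

namespace LeafyKernel

open BoundedLoop Cmd Relation

variable {n : ℕ} {D : Digraph (Fin n)} {r : Fin n} {k : ℕ} {s t : Store}
  {R : Fin n → Fin n → Prop} {p : Fin n → Fin n}

theorem Searching.put (h : Searching D r k R s p) {a : Cell} (h₁ : a ≠ .mulTable)
    (h₂ : a ≠ .input) (h₃ : a ≠ .order) (h₄ : a ≠ .parent) (i x : ℕ) :
    Searching D r k R (s.put a i x) p :=
  h.congr (Store.put_arr_of_ne _ h₁.symm _ _) (Store.put_arr_of_ne _ h₂.symm _ _)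
    (Store.put_arr_of_ne _ h₃.symm _ _) (Store.put_arr_of_ne _ h₄.symm _ _)

theorem improve_spec (hs : Searching D r k R s p) {l : Fin n} (hl : s.arr .ll 0 = l) :
    (Improvable (fun u v => D.Adj u v ∧ R u v) r p l ∧
      Searching D r k R (improve.sem n s) (move (fun u v => D.Adj u v ∧ R u v) r p l)) ∨
    (¬ Improvable (fun u v => D.Adj u v ∧ R u v) r p l ∧
      Searching D r k R (improve.sem n s) p) := by
  have hctx : Ctx D r k (improve.sem n s) := hs.toCtx.sem _ (by decide) (by decide)
  have hord : ∀ u v, rel n (improve.sem n s) .order u v ↔ R u v := by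
    simpa only [rel, sem_arr_of_not_writes improve (a := .order) (by decide) s] using hs.order
  exact (improve_parent hs hl).imp (fun h => ⟨h.1, hctx, hord, h.2⟩)
    fun h => ⟨h.1, hctx, hord, h.2⟩

/-- All parents are chosen along arcs that respect `R`. -/
def Respects (D : Digraph (Fin n)) (r : Fin n) (R : Fin n → Fin n → Prop) (p : Fin n → Fin n) :
    Prop :=
  p r = r ∧ ∀ v, v ≠ r → D.Adj (p v) v ∧ R (p v) v

def sweep : Cmd := .loop .ll improve

/-- An improvement can make earlier targets improvable again, so local optimality is only certified
by a sweep without any change; every other sweep gains a leaf. -/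
theorem sweep_spec (hs : Searching D r k R s p) (hp : Respects D r R p) :
    ∃ q, Searching D r k R (sweep.sem n s) q ∧ Respects D r R q ∧
      ((q = p ∧ ∀ l, ¬ Improvable (fun u v => D.Adj u v ∧ R u v) r p l) ∨
        numLeaves r p < numLeaves r q ∧
          ∃ l, Improvable (fun u v => D.Adj u v ∧ R u v) r p l) := by
  have := loop_invariant (n := n) (a := .ll) (P := improve) (s := s)
    (fun j t => ∃ q, Searching D r k R t q ∧ Respects D r R q ∧
      ((q = p ∧ ∀ l : Fin n, (l : ℕ) < j →
          ¬ Improvable (fun u v => D.Adj u v ∧ R u v) r p l) ∨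
        numLeaves r p < numLeaves r q ∧
          ∃ l, Improvable (fun u v => D.Adj u v ∧ R u v) r p l))
    ⟨p, hs, hp, Or.inl ⟨rfl, by simp⟩⟩ (fun j hj t ht => by
      obtain ⟨q, hq, hqr, h⟩ := ht
      have hq' : Searching D r k R (t.put .ll 0 j) q :=
        hq.put (by decide) (by decide) (by decide) (by decide) _ _
      rcases improve_spec hq' (l := ⟨j, hj⟩) (by simp) with ⟨h₁, h₂⟩ | ⟨h₁, h₂⟩
      · refine ⟨_, h₂, ⟨move_root hqr.1,
          move_adj (E := fun u v => D.Adj u v ∧ R u v) hqr.2⟩, Or.inr ?_⟩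
        have hlt := numLeaves_lt_move h₁
        rcases h with ⟨rfl, -⟩ | ⟨h, h'⟩
        · exact ⟨hlt, _, h₁⟩
        · exact ⟨h.trans hlt, h'⟩
      · refine ⟨q, h₂, hqr, h.imp_left ?_⟩
        rintro ⟨rfl, h⟩
        refine ⟨rfl, fun l hl => ?_⟩
        rcases Nat.lt_succ_iff_lt_or_eq.1 hl with h' | h'
        · exact h l h'
        · rw [show l = ⟨j, hj⟩ from Fin.ext h']
          exact h₁)
  obtain ⟨q, h₁, h₂, h₃⟩ := this
  exact ⟨q, h₁, h₂, h₃.imp_left fun h => ⟨h.1, fun l => h.2 l l.2⟩⟩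

def optimize : Cmd := .loop .stp sweep

/-- If no sweep certified an optimum, then `n` sweeps have produced `n` leaves, and a further
improvement would need more leaves than vertices. -/
theorem optimize_spec (hs : Searching D r k R s p) (hp : Respects D r R p) :
    ∃ q, Searching D r k R (optimize.sem n s) q ∧ Respects D r R q ∧
      numLeaves r p ≤ numLeaves r q ∧
      ∀ l, ¬ Improvable (fun u v => D.Adj u v ∧ R u v) r q l := by
  have := loop_invariant (n := n) (a := .stp) (P := sweep) (s := s)
    (fun j t => ∃ q, Searching D r k R t q ∧ Respects D r R q ∧
      numLeaves r p ≤ numLeaves r q ∧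
      ((∀ l, ¬ Improvable (fun u v => D.Adj u v ∧ R u v) r q l) ∨ j ≤ numLeaves r q))
    ⟨p, hs, hp, le_rfl, Or.inr (Nat.zero_le _)⟩ (fun j hj t ht => by
      obtain ⟨q, hq, hqr, hle, h⟩ := ht
      have hq' : Searching D r k R (t.put .stp 0 j) q :=
        hq.put (by decide) (by decide) (by decide) (by decide) _ _
      obtain ⟨q', h₁, h₂, h₃⟩ := sweep_spec hq' hqr
      refine ⟨q', h₁, h₂, ?_⟩
      rcases h₃ with ⟨rfl, h₃⟩ | ⟨h₃, l, hl⟩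
      · exact ⟨hle, Or.inl h₃⟩
      · refine ⟨hle.trans h₃.le, Or.inr ?_⟩
        rcases h with h | h
        · exact absurd hl (h l)
        · omega)
  obtain ⟨q, h₁, h₂, h₃, h₄⟩ := this
  refine ⟨q, h₁, h₂, h₃, h₄.elim id fun h l hl => ?_⟩
  have := numLeaves_lt_move hl
  have := numLeaves_le (r := r) (p := move (fun u v => D.Adj u v ∧ R u v) r q l)
  rw [Fintype.card_fin] at this
  omega

/-- Count the leaves of `parent`. -/
def countLeaves : Cmd :=
  .seq (.put .acc (.const 0) (.const 0)) (.loop .vtx (.seq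
    (search .first (.and (.not (.eq (.var .idx) .root)) (.eq (.get .parent (.var .idx))
      (.var .vtx))))
    (.ite (.eq (.var .first) .size) (.put .acc (.const 0) (.add (.var .acc) (.const 1))) .skip)))

theorem countLeaves_spec (hs : Ctx D r k s) (hp : Stores s .parent p) :
    (countLeaves.sem n s).arr .acc 0 = numLeaves r p := by
  have := loop_frame (n := n) (a := .vtx) (P := .seq
    (search .first (.and (.not (.eq (.var .idx) .root)) (.eq (.get .parent (.var .idx))
      (.var .vtx))))
    (.ite (.eq (.var .first) .size) (.put .acc (.const 0) (.add (.var .acc) (.const 1))) .skip))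
    (s := s.put .acc 0 0)
    (fun j t => t.arr .acc 0 = {v : Fin n | (v : ℕ) < j ∧ outdeg r p v = 0}.ncard)
    (by simp) (fun v t hf ht => by
      have hs₁ : Ctx D r k (t.put .vtx 0 v) :=
        (hs.put (a := .acc) (by decide) (by decide) 0 0).frame (hf.put v) (by decide) (by decide)
      have hp₁ : Stores (t.put .vtx 0 v) .parent p :=
        (hp.put (b := .acc) (by decide) 0 0).congr (hf.put v _ (by decide))
      have hv₁ : (t.put .vtx 0 v).arr .vtx 0 = v := by simp
      have ha₁ : (t.put .vtx 0 v).arr .acc 0 = t.arr .acc 0 := by simp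
      rw [← ha₁] at ht
      rw [sem_seq]
      set t₁ := t.put .vtx 0 v
      have hsearch := search_arr (n := n) (w := .first) (c := .and (.not (.eq (.var .idx) .root))
        (.eq (.get .parent (.var .idx)) (.var .vtx))) t₁ (by decide) (by decide)
      have hacc : ((search .first (.and (.not (.eq (.var .idx) .root))
          (.eq (.get .parent (.var .idx)) (.var .vtx)))).sem n t₁).arr .acc 0 = t₁.arr .acc 0 := by
        rw [sem_arr_of_not_writes _ (by decide)]
      set t₂ := (search .first (.and (.not (.eq (.var .idx) .root))
        (.eq (.get .parent (.var .idx)) (.var .vtx)))).sem n t₁ with ht₂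
      have hc : ∀ y : Fin n, (Exp.and (.not (.eq (.var .idx) .root))
          (.eq (.get .parent (.var .idx)) (.var .vtx))).Holds n (t₁.put .idx 0 y) ↔
          y ≠ r ∧ p y = v := by
        intro y
        have h₁ := hp₁ y
        simp [hv₁, hs₁.root, Fin.val_inj, h₁]
      have hfirst : t₂.arr .first 0 = n ↔ outdeg r p v = 0 := by
        rw [outdeg_eq_zero]
        rcases hsearch with ⟨h₁, h₂⟩ | ⟨h₁, h₂⟩
        · refine ⟨fun h => absurd h h₁.ne, fun h => ?_⟩
          have := (hc ⟨_, h₁⟩).1 h₂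
          exact absurd this.2 (h _ this.1)
        · exact ⟨fun _ w hw hwv => h₂ w w.2 ((hc w).2 ⟨hw, hwv⟩), fun _ => h₁⟩
      by_cases h : outdeg r p v = 0
      · rw [sem_ite_of (by simpa using hfirst.2 h), sem_put]
        have hset : {w : Fin n | (w : ℕ) < v + 1 ∧ outdeg r p w = 0} =
            insert v {w : Fin n | (w : ℕ) < v ∧ outdeg r p w = 0} := by
          ext w
          simp only [Set.mem_ofPred_eq, Set.mem_insert_iff, Nat.lt_succ_iff_lt_or_eq, Fin.val_inj]
          constructor
          · rintro ⟨h₁ | h₁, h₂⟩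
            · exact Or.inr ⟨h₁, h₂⟩
            · exact Or.inl h₁
          · rintro (rfl | ⟨h₁, h₂⟩)
            · exact ⟨Or.inr rfl, h⟩
            · exact ⟨Or.inl h₁, h₂⟩
        rw [hset, Set.ncard_insert_of_notMem (by simp) (Set.toFinite _), ← ht, ← hacc]
        simp
      · rw [sem_ite_of_not (by simpa using fun hh => h (hfirst.1 hh)), sem_skip, hacc, ht]
        congr 1
        ext w
        simp only [Set.mem_ofPred_eq, Nat.lt_succ_iff_lt_or_eq, Fin.val_inj]
        constructor
        · exact fun hw => ⟨Or.inl hw.1, hw.2⟩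
        · rintro ⟨h₁ | rfl, h₂⟩
          · exact ⟨h₁, h₂⟩
          · exact absurd h₂ h)
  have heq : (countLeaves.sem n s).arr .acc 0 =
      {v : Fin n | (v : ℕ) < n ∧ outdeg r p v = 0}.ncard := this
  rw [heq, numLeaves, ← Set.ncard_coe_finset]
  congr 1
  ext v
  simp

/-- If `ok` is set, then `result` is a branching with at least `k` leaves. -/
def Sound (D : Digraph (Fin n)) (r : Fin n) (k : ℕ) (s : Store) : Prop :=
  s.arr .ok 0 ≠ 0 → ∃ p, Stores s .result p ∧ IsTreeMap r p ∧ (∀ v, v ≠ r → D.Adj (p v) v) ∧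
    k ≤ numLeaves r p

/-- Accept `parent` if it has enough leaves. -/
def accept : Cmd :=
  .ite (.lt (.var .acc) (.get .input (.const 1))) .skip
    (.seq (fill .result (.get .parent (.var .idx))) (.put .ok (.const 0) (.const 1)))

/-- Local search from `tree` for a branching with `k` leaves. -/
def searchTree : Cmd :=
  .seq (.seq computeAnc (.seq computeOrder (fill .parent (.get .tree (.var .idx)))))
    (.seq optimize (.seq countLeaves accept))

theorem direction_irrefl (φ : ℕ) (a : Fin n) : ¬ direction φ a a := by
  simp [direction]

theorem direction_trans (φ : ℕ) (a b c : Fin n) (h₁ : direction φ a b) (h₂ : direction φ b c) :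
    direction φ a c := by
  rcases h₁ with ⟨h, h₁⟩ | ⟨h, h₁⟩ <;> rcases h₂ with ⟨h', h₂⟩ | ⟨h', h₂⟩
  · exact Or.inl ⟨h, h₁.trans h₂⟩
  · exact absurd h h'
  · exact absurd h' h
  · exact Or.inr ⟨h, h₂.trans h₁⟩

theorem searchTree_spec (hs : Ctx D r k s) (hp : Stores s .tree p) (htree : IsTreeMap r p)
    (hadj : ∀ v, v ≠ r → D.Adj (p v) v) (hsound : Sound D r k s) :
    Sound D r k (searchTree.sem n s) ∧
      (s.arr .ok 0 ≠ 0 → (searchTree.sem n s).arr .ok 0 ≠ 0) ∧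
      (Stuck D.Adj r k (direction (s.arr .flip 0)) p ∨ (searchTree.sem n s).arr .ok 0 ≠ 0) := by
  set s₁ := computeAnc.sem n s with hs₁
  have hctx₁ : Ctx D r k s₁ := hs.sem _ (by decide) (by decide)
  have hanc₁ := computeAnc_spec hs hp
  have hp₁ : Stores s₁ .tree p := hp.sem _ (by decide)
  set s₂ := computeOrder.sem n s₁ with hs₂
  have hctx₂ : Ctx D r k s₂ := hctx₁.sem _ (by decide) (by decide)
  have hord₂ := computeOrder_spec hctx₁ hp₁ hanc₁
  rw [sem_arr_of_not_writes computeAnc (a := .flip) (by decide) s, ← hs₂] at hord₂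
  have hp₂ : Stores s₂ .tree p := hp₁.sem _ (by decide)
  set s₃ := (fill .parent (.get .tree (.var .idx))).sem n s₂ with hs₃
  have hs₃' : Searching D r k (SiblingOrder (direction (s.arr .flip 0)) r p) s₃ p := by
    refine ⟨hctx₂.sem _ (by decide) (by decide), ?_, fun v => ?_⟩
    · simpa only [rel, hs₃, sem_arr_of_not_writes (fill .parent (.get .tree (.var .idx)))
        (a := .order) (by decide) s₂] using hord₂
    · rw [hs₃, fill_arr _ (by decide) (by decide) _ v.2]
      simpa using hp₂ v
  obtain ⟨q, hq, hqr, hle, hopt⟩ := optimize_spec hs₃'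
    ⟨htree.root, fun v hv => ⟨hadj v hv, siblingOrder_parent htree hv⟩⟩
  set s₄ := optimize.sem n s₃ with hs₄
  have hcount := countLeaves_spec hq.toCtx hq.parent
  set s₅ := countLeaves.sem n s₄ with hs₅
  have hctx₅ : Ctx D r k s₅ := hq.toCtx.sem _ (by decide) (by decide)
  have hq₅ : Stores s₅ .parent q := hq.parent.sem _ (by decide)
  have heq : searchTree.sem n s = accept.sem n s₅ := rfl
  have hframe : ∀ a, (seq (.seq computeAnc (.seq computeOrder (fill .parent
      (.get .tree (.var .idx))))) (.seq optimize countLeaves)).writes a = false →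
      s₅.arr a = s.arr a := fun a ha => sem_arr_of_not_writes _ ha s
  rw [heq]
  by_cases hk : numLeaves r q < k
  · rw [accept, sem_ite_of (by simpa [hcount, hctx₅.bound] using hk), sem_skip]
    have hok : s₅.arr .ok = s.arr .ok := hframe _ (by decide)
    have hres : s₅.arr .result = s.arr .result := hframe _ (by decide)
    refine ⟨?_, fun h => by rwa [hok], Or.inl ⟨q, hle, hk, hopt⟩⟩
    simpa only [Sound, Stores, hok, hres] using hsound
  · rw [accept, sem_ite_of_not (by simpa [hcount, hctx₅.bound] using hk), sem_seq, sem_put]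
    have hok : (((fill .result (.get .parent (.var .idx))).sem n s₅).put .ok
        ((Exp.const 0).eval n ((fill .result (.get .parent (.var .idx))).sem n s₅))
        ((Exp.const 1).eval n ((fill .result (.get .parent (.var .idx))).sem n s₅))).arr .ok 0
        ≠ 0 := by simp
    refine ⟨fun _ => ⟨q, ?_, ?_, fun v hv => (hqr.2 v hv).1, not_lt.1 hk⟩, fun _ => hok, Or.inr hok⟩
    · refine Stores.put (fun v => ?_) (by decide) _ _
      rw [fill_arr _ (by decide) (by decide) _ v.2]
      simpa using hq₅ v
    -- The moves may change ancestors, but all parents still precede their children in the order of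
    -- the initial tree, so no cycle arises.
    · exact .of_wellFounded (siblingOrder_wellFounded htree (direction_irrefl _)
        (direction_trans _)) hqr.1 fun v hv => (hqr.2 v hv).2

/-- Local search from `a` in the direction `φ`. -/
def searchFrom (a : Cell) (φ : ℕ) : Cmd :=
  .seq (.seq (fill .tree (.get a (.var .idx))) (.put .flip (.const 0) (.const φ))) searchTree

theorem searchFrom_spec {a : Cell} (ha : a ≠ .tree) (ha' : a ≠ .idx) (φ : ℕ) (hs : Ctx D r k s)
    (hp : Stores s a p) (htree : IsTreeMap r p)
    (hadj : ∀ v, v ≠ r → D.Adj (p v) v) (hsound : Sound D r k s) :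
    Sound D r k ((searchFrom a φ).sem n s) ∧
      (s.arr .ok 0 ≠ 0 → ((searchFrom a φ).sem n s).arr .ok 0 ≠ 0) ∧
      (Stuck D.Adj r k (direction φ) p ∨ ((searchFrom a φ).sem n s).arr .ok 0 ≠ 0) := by
  rw [searchFrom, sem_seq]
  set s₁ := (seq (fill .tree (.get a (.var .idx))) (.put .flip (.const 0) (.const φ))).sem n s
    with hs₁
  have hframe : ∀ b, b ≠ .tree → b ≠ .idx → b ≠ .flip → s₁.arr b = s.arr b := fun b h₁ h₂ h₃ =>
    sem_arr_of_not_writes _ (by simp [fill, writes, h₁.symm, h₂.symm, h₃.symm]) s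
  have hctx : Ctx D r k s₁ := hs.congr (hframe _ (by decide) (by decide) (by decide))
    (hframe _ (by decide) (by decide) (by decide))
  have hok : s₁.arr .ok = s.arr .ok := hframe _ (by decide) (by decide) (by decide)
  have hres : s₁.arr .result = s.arr .result := hframe _ (by decide) (by decide) (by decide)
  have hflip : s₁.arr .flip 0 = φ := by simp [hs₁, sem_seq, sem_put]
  have hp₁ : Stores s₁ .tree p := by
    refine Stores.put (fun v => ?_) (by decide) _ _
    rw [fill_arr _ (by decide) (by simp [Exp.reads, Exp.var, ha]) _ v.2]
    simpa [ha'] using hp v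
  have hsound₁ : Sound D r k s₁ := by simpa only [Sound, Stores, hok, hres] using hsound
  have := searchTree_spec hctx hp₁ htree hadj hsound₁
  rwa [hok, hflip] at this

end LeafyKernel

namespace LeafyKernel

open BoundedLoop Cmd Relation

variable {n : ℕ} {D : Digraph (Fin n)} {r : Fin n} {k : ℕ} {s t : Store}

/-! ### Encodings -/

theorem length_matrix {α : Type*} (f : ℕ → ℕ → α) (m n : ℕ) :
    ((List.range m).flatMap fun i => (List.range n).map (f i)).length = m * n := by
  simp [List.length_flatMap]

theorem getElem?_matrix {α : Type*} (f : ℕ → ℕ → α) {m n u v : ℕ} (hu : u < m) (hv : v < n) :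
    ((List.range m).flatMap fun i => (List.range n).map (f i))[u * n + v]? = some (f u v) := by
  induction m with
  | zero => exact absurd hu (Nat.not_lt_zero _)
  | succ m ih =>
    rw [List.range_succ, List.flatMap_append]
    rcases Nat.lt_succ_iff_lt_or_eq.1 hu with h | rfl
    · rw [List.getElem?_append_left, ih h]
      rw [length_matrix]
      have : (u + 1) * n ≤ m * n := Nat.mul_le_mul_right n h
      rw [add_mul, one_mul] at this
      omega
    · rw [List.getElem?_append_right (by rw [length_matrix]; omega), length_matrix]
      simp [hv]

open Classical in
/-- The entries of the adjacency matrix. -/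
noncomputable def matrixEntry (D : Digraph (Fin n)) (u v : ℕ) : ℕ :=
  if ∃ (hu : u < n) (hv : v < n), D.Adj ⟨u, hu⟩ ⟨v, hv⟩ then 1 else 0

theorem encode_eq (D : Digraph (Fin n)) : D.encode =
    n :: (List.range n).flatMap fun u => (List.range n).map (matrixEntry D u) := by
  classical
  rw [Digraph.encode, ← List.map_coe_finRange_eq_range, List.flatMap_map]
  simp only [List.map_map]
  congr 3
  funext u
  congr 1
  funext v
  refine if_congr ?_ rfl rfl
  exact ⟨fun h => ⟨u.2, v.2, h⟩, fun ⟨_, _, h⟩ => h⟩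

/-- The offset `3` skips the two leading words and the number of vertices. -/
theorem getD_encode (D : Digraph (Fin n)) (a b : ℕ) (u v : Fin n) :
    (a :: b :: D.encode).getD (3 + (u * n + v)) 0 = matrixEntry D u v := by
  rw [encode_eq, List.getD_eq_getElem?_getD, add_comm]
  simp only [List.getElem?_cons_succ]
  rw [getElem?_matrix _ u.2 v.2]
  rfl

theorem length_encode (D : Digraph (Fin n)) (a b : ℕ) :
    (a :: b :: D.encode).length = n * n + 3 := by
  rw [encode_eq]
  simp only [List.length_cons, length_matrix]

theorem matrixEntry_ne_zero {u v : Fin n} : matrixEntry D u v ≠ 0 ↔ D.Adj u v := by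
  simp [matrixEntry]

theorem ctx_multiples (D : Digraph (Fin n)) (r : Fin n) (k : ℕ) :
    Ctx D r k (multiples.sem n (inputStore (r :: k :: D.encode))) := by
  have h : (multiples.sem n (inputStore (r :: k :: D.encode))).arr .input =
      (inputStore (r :: k :: D.encode)).arr .input := sem_arr_of_not_writes _ (by decide) _
  refine ⟨multiples_spec rfl, ?_, ?_, fun u v => ?_⟩
  · rw [h]
    rfl
  · rw [h]
    rfl
  · have : (inputStore (r :: k :: D.encode)).arr .input (3 + (u * n + v)) = matrixEntry D u v :=
      getD_encode D r k u v
    rw [h, this, matrixEntry_ne_zero]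

/-- Output the matrix with the entries `c`, and its size. -/
def emitMatrix (c : Exp) : Cmd :=
  .seq (.emit .size) (.loop .vtx (.loop .idx (.emit c)))

theorem emitMatrix_spec {c : Exp} (T : Digraph (Fin n))
    (h : ∀ t : Store, (∀ a, a ≠ .vtx → a ≠ .idx → t.arr a = s.arr a) → ∀ u v : Fin n,
      t.arr .vtx 0 = u → t.arr .idx 0 = v → c.eval n t = matrixEntry T u v) :
    ((emitMatrix c).sem n s).out = s.out ++ T.encode := by
  have key : ∀ u : Fin n, ∀ t : Store, (∀ a, a ≠ .vtx → a ≠ .idx → t.arr a = s.arr a) →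
      t.arr .vtx 0 = u →
      ((loop .idx (.emit c)).sem n t).out = t.out ++ (List.range n).map (matrixEntry T u) := by
    intro u t ht hu
    have := loop_frame (n := n) (a := .idx) (P := .emit c) (s := t)
      (fun j t' => t'.out = t.out ++ (List.range j).map (matrixEntry T u)) (by simp)
      (fun v t' hf hout => by
        have := h (t'.put .idx 0 v) (fun a h₁ h₂ => by
          rw [hf.put v a (by simp [writes, h₂.symm]), ht a h₁ h₂]) u v
          (by rw [hf.put v .vtx rfl, hu]) (by simp)
        rw [List.range_succ, List.map_append, ← List.append_assoc, ← hout]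
        simp only [sem, this]
        rfl)
    exact this
  have := loop_frame (n := n) (a := .vtx) (P := .loop .idx (.emit c))
    (s := (emit .size).sem n s)
    (fun j t => t.out = s.out ++ [n] ++
      (List.range j).flatMap fun u => (List.range n).map (matrixEntry T u)) (by simp [sem])
    (fun u t hf hout => by
      rw [key u _ (fun a h₁ h₂ => by
        rw [hf.put u a (by simp [writes, h₁.symm, h₂.symm])]
        rfl) (by simp), Store.put_out, hout, List.range_succ, List.flatMap_append]
      simp)
  rw [emitMatrix, sem_seq, this, encode_eq]
  simp

theorem eval_and_eq {e f : Exp} {P : Prop} [Decidable P]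
    (h : (Exp.and e f).Holds n s ↔ P) : (Exp.and e f).eval n s = if P then 1 else 0 := by
  have hle : (Exp.and e f).eval n s ≤ 1 := Nat.sub_le _ _
  rw [Exp.Holds] at h
  split_ifs with hP
  · have := h.2 hP
    omega
  · by_contra hne
    exact hP (h.1 hne)

theorem matrixEntry_eq {T : Digraph (Fin n)} {u v : Fin n} [Decidable (T.Adj u v)] :
    matrixEntry T u v = if T.Adj u v then 1 else 0 := by
  simp [matrixEntry]

def emitBranching : Cmd :=
  .seq (.emit (.const 0)) (emitMatrix (.and (.not (.eq (.var .idx) .root))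
    (.eq (.get .result (.var .idx)) (.var .vtx))))

theorem emitBranching_spec (hs : Ctx D r k s) {p : Fin n → Fin n} (hp : Stores s .result p) :
    (emitBranching.sem n s).out = s.out ++ 0 :: (branching r p).encode := by
  classical
  rw [emitBranching, sem_seq, emitMatrix_spec (branching r p)]
  · simp [sem]
  · intro t ht u v hu hv
    have h₁ : t.arr .input 0 = r := by
      rw [ht _ (by decide) (by decide)]
      exact hs.root
    have h₂ : t.arr .result v = p v := by
      rw [ht _ (by decide) (by decide)]
      exact hp v
    rw [matrixEntry_eq]
    refine eval_and_eq ?_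
    simp [hu, hv, h₁, h₂, Fin.val_inj, branching]

def emitUseful : Cmd :=
  .seq (.seq (.emit (.const 1)) (.emit .root))
    (emitMatrix (.and (.arc (.var .vtx) (.var .idx)) (.entry .avoid (.var .idx) (.var .vtx))))

theorem emitUseful_spec (hs : Env D r k s) :
    (emitUseful.sem n s).out = s.out ++ 1 :: (r : ℕ) :: (useful D r).encode := by
  classical
  rw [emitUseful, sem_seq, emitMatrix_spec (useful D r)]
  · have : s.arr .input 0 = r := hs.root
    simp [sem, this]
  · intro t ht u v hu hv
    have he : Env D r k t := Env.congr (s := s) hs (ht _ (by decide) (by decide))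
      (ht _ (by decide) (by decide)) (ht _ (by decide) (by decide))
    rw [matrixEntry_eq]
    refine eval_and_eq ?_
    have : (useful D r).Adj u v ↔ D.Adj u v ∧ ReachAvoiding D.Adj r v u := Iff.rfl
    rw [this, ← he.avoid, ← he.arc, rel]
    simp [hu, hv, he.mul]

/-- Output a digraph with two vertices and no arcs. -/
def emitTrivial : Cmd :=
  .seq (.emit (.const 1)) (.seq (.emit (.const 0)) (.seq (.emit (.const 2)) (.seq (.emit (.const 0))
    (.seq (.emit (.const 0)) (.seq (.emit (.const 0)) (.emit (.const 0)))))))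

theorem emitTrivial_spec :
    (emitTrivial.sem n s).out = s.out ++ 1 :: 0 :: twoIsolated.encode := by
  rw [encode_eq]
  simp [emitTrivial, sem, matrixEntry, twoIsolated, List.range_succ]

/-! ### The complete algorithm -/

def searchAll : Cmd :=
  .seq (.seq (searchFrom .low 0) (searchFrom .low 1))
    (.seq (searchFrom .high 0) (searchFrom .high 1))

theorem searchAll_spec (hs : Ctx D r k s) {f b : Fin n → Fin n} {τ : Fin n → ℕ}
    (h : LowHigh D.Adj r f b τ) (hf : Stores s .low f) (hb : Stores s .high b)
    (hok : s.arr .ok 0 = 0) :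
    Sound D r k (searchAll.sem n s) ∧ ((searchAll.sem n s).arr .ok 0 ≠ 0 ∨
      (Stuck D.Adj r k (· < ·) f ∧ Stuck D.Adj r k (fun a b => b < a) f ∧
        Stuck D.Adj r k (· < ·) b ∧ Stuck D.Adj r k (fun a b => b < a) b)) := by
  have hd₀ : direction (n := n) 0 = (· < ·) := by
    funext a b
    simp [direction]
  have hd₁ : direction (n := n) 1 = fun a b => b < a := by
    funext a b
    simp [direction]
  have h₁ := searchFrom_spec (by decide) (by decide) 0 hs hf h.isTreeMap_f h.f_adj
    (fun hh => absurd hok hh)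
  set s₁ := (searchFrom .low 0).sem n s with hs₁
  have hctx₁ : Ctx D r k s₁ := hs.sem _ (by decide) (by decide)
  have h₂ := searchFrom_spec (by decide) (by decide) 1 hctx₁
    (hf.sem (searchFrom .low 0) (by decide))
    h.isTreeMap_f h.f_adj h₁.1
  set s₂ := (searchFrom .low 1).sem n s₁ with hs₂
  have hctx₂ : Ctx D r k s₂ := hctx₁.sem _ (by decide) (by decide)
  have hb₂ : Stores s₂ .high b :=
    (hb.sem (searchFrom .low 0) (by decide)).sem (searchFrom .low 1) (by decide)
  have h₃ := searchFrom_spec (by decide) (by decide) 0 hctx₂ hb₂ h.isTreeMap_b h.b_adj h₂.1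
  set s₃ := (searchFrom .high 0).sem n s₂ with hs₃
  have hctx₃ : Ctx D r k s₃ := hctx₂.sem _ (by decide) (by decide)
  have h₄ := searchFrom_spec (by decide) (by decide) 1 hctx₃
    (hb₂.sem (searchFrom .high 0) (by decide))
    h.isTreeMap_b h.b_adj h₃.1
  have heq : searchAll.sem n s = (searchFrom .high 1).sem n s₃ := rfl
  rw [heq]
  rw [hd₀] at h₁ h₃
  rw [hd₁] at h₂ h₄
  refine ⟨h₄.1, ?_⟩
  by_cases hfin : ((searchFrom .high 1).sem n s₃).arr .ok 0 = 0
  · have e₃ : s₃.arr .ok 0 = 0 := by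
      by_contra hh
      exact h₄.2.1 hh hfin
    have e₂ : s₂.arr .ok 0 = 0 := by
      by_contra hh
      exact h₃.2.1 hh e₃
    have e₁ : s₁.arr .ok 0 = 0 := by
      by_contra hh
      exact h₂.2.1 hh e₂
    exact Or.inr ⟨h₁.2.2.resolve_right (not_not.2 e₁), h₂.2.2.resolve_right (not_not.2 e₂),
      h₃.2.2.resolve_right (not_not.2 e₃), h₄.2.2.resolve_right (not_not.2 hfin)⟩
  · exact Or.inl hfin

/-- The algorithm on a digraph all of whose vertices are reachable from the root. -/
def solveReachable : Cmd :=
  .seq (.seq computeAvoid (.seq grow searchAll)) (.ite (.var .ok) emitBranching emitUseful)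

theorem solveReachable_spec (hs : Ctx D r k s) (hreach : ∀ v, ReflTransGen D.Adj r v)
    (hk : 0 < k) (hok : s.arr .ok 0 = 0) :
    (∃ p, (solveReachable.sem n s).out = s.out ++ 0 :: (branching r p).encode ∧ IsTreeMap r p ∧
      (∀ v, v ≠ r → D.Adj (p v) v) ∧ k ≤ numLeaves r p) ∨
    ((solveReachable.sem n s).out = s.out ++ 1 :: (r : ℕ) :: (useful D r).encode ∧
      ∃ f b S, Skeleton D.Adj r f b S ∧ S.ncard ≤ 15 * k) := by
  set s₁ := computeAvoid.sem n s with hs₁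
  have he₁ : Env D r k s₁ := ⟨hs.sem _ (by decide) (by decide), computeAvoid_spec hs⟩
  obtain ⟨f, b, τ, h, hf, hb⟩ := grow_spec he₁ hreach
  set s₂ := grow.sem n s₁ with hs₂
  have he₂ : Env D r k s₂ := he₁.sem _ (by decide) (by decide) (by decide)
  have hok₂ : s₂.arr .ok 0 = 0 := by
    rw [hs₂, sem_arr_of_not_writes _ (by decide), hs₁, sem_arr_of_not_writes _ (by decide), hok]
  obtain ⟨hsound, hres⟩ := searchAll_spec he₂.toCtx h hf hb hok₂
  set s₃ := searchAll.sem n s₂ with hs₃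
  have he₃ : Env D r k s₃ := he₂.sem _ (by decide) (by decide) (by decide)
  have hout : s₃.out = s.out :=
    sem_out_of_silent (.seq computeAvoid (.seq grow searchAll)) (by decide) s
  have heq : solveReachable.sem n s = (ite (.var .ok) emitBranching emitUseful).sem n s₃ := rfl
  rw [heq]
  by_cases hfin : s₃.arr .ok 0 = 0
  · rw [sem_ite_of_not (by simpa using hfin), emitUseful_spec he₃, hout]
    obtain ⟨e₁, e₂, e₃, e₄⟩ := hres.resolve_left (not_not.2 hfin)
    obtain ⟨S, hS⟩ := exists_skeleton h hk e₁ e₂ e₃ e₄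
    exact Or.inr ⟨rfl, f, b, S, hS⟩
  · obtain ⟨p, hp, hp'⟩ := hsound hfin
    rw [sem_ite_of (by simpa using hfin), emitBranching_spec he₃.toCtx hp, hout]
    exact Or.inl ⟨p, rfl, hp'⟩

def solve : Cmd :=
  .seq (.seq multiples (.seq reachRoot (search .first (.not (.get .mark (.var .idx))))))
    (.ite (.lt (.var .first) .size) emitTrivial solveReachable)

theorem solve_spec (D : Digraph (Fin n)) (r : Fin n) {k : ℕ} (hk : 0 < k) :
    ((¬ ∀ v, ReflTransGen D.Adj r v) ∧
      (solve.sem n (inputStore (r :: k :: D.encode))).out = 1 :: 0 :: twoIsolated.encode) ∨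
    (∃ p, (solve.sem n (inputStore (r :: k :: D.encode))).out = 0 :: (branching r p).encode ∧
      IsTreeMap r p ∧ (∀ v, v ≠ r → D.Adj (p v) v) ∧ k ≤ numLeaves r p) ∨
    ((solve.sem n (inputStore (r :: k :: D.encode))).out = 1 :: (r : ℕ) :: (useful D r).encode ∧
      ∃ f b S, Skeleton D.Adj r f b S ∧ S.ncard ≤ 15 * k) := by
  have hctx₁ := ctx_multiples D r k
  set s₁ := multiples.sem n (inputStore (r :: k :: D.encode)) with hs₁
  have hmark := reachRoot_spec hctx₁
  set s₂ := reachRoot.sem n s₁ with hs₂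
  have hsearch := search_arr (n := n) (w := .first) (c := .not (.get .mark (.var .idx))) s₂
    (by decide) (by decide)
  have hc : ∀ y : Fin n, (Exp.not (.get .mark (.var .idx))).Holds n (s₂.put .idx 0 y) ↔
      ¬ ReflTransGen D.Adj r y := by
    intro y
    have : y ∈ flags n s₂ .mark ↔ ReflTransGen D.Adj r y := by
      rw [hmark]
      rfl
    rw [← this, mem_flags]
    simp
  set s₃ := (search .first (.not (.get .mark (.var .idx)))).sem n s₂ with hs₃
  have hctx₃ : Ctx D r k s₃ :=
    (hctx₁.sem reachRoot (by decide) (by decide)).sem _ (by decide) (by decide)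
  have hout : s₃.out = [] := sem_out_of_silent (.seq multiples (.seq reachRoot
    (search .first (.not (.get .mark (.var .idx)))))) (by decide) _
  have hok : s₃.arr .ok 0 = 0 := by
    rw [show s₃.arr .ok = (inputStore (r :: k :: D.encode)).arr .ok from
      sem_arr_of_not_writes (.seq multiples (.seq reachRoot
        (search .first (.not (.get .mark (.var .idx)))))) (by decide) _]
    rfl
  have heq : solve.sem n (inputStore (r :: k :: D.encode)) =
      (ite (.lt (.var .first) .size) emitTrivial solveReachable).sem n s₃ := rfl
  rw [heq]
  rcases hsearch with ⟨h₁, h₂⟩ | ⟨h₁, h₂⟩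
  · rw [sem_ite_of (by simpa using h₁), emitTrivial_spec, hout]
    exact Or.inl ⟨fun h => (hc ⟨_, h₁⟩).1 h₂ (h _), rfl⟩
  · rw [sem_ite_of_not (by simpa using h₁.ge)]
    have hreach : ∀ v, ReflTransGen D.Adj r v := fun v => by
      by_contra hv
      exact h₂ v v.2 ((hc v).2 hv)
    right
    simpa only [hout, List.nil_append] using solveReachable_spec hctx₃ hreach hk hok

end LeafyKernel

/-! ### The main theorem -/

open LeafyKernel BoundedLoop

theorem mainTheorem6 :
    ∃ (P : RAM.Program) (p : Polynomial ℕ) (C : ℕ),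
      ∀ (W : Type) [Finite W] (H : SimpleGraph W)
        (n : ℕ) (D : Digraph (Fin n)) (r : Fin n) (k : ℕ),
        0 < k → ¬ H.IsMinorOf D.underlying →
        ∃ out : List ℕ,
          P.OutputsWithin ((r : ℕ) :: k :: D.encode) out (p.eval n) ∧
          ((∃ T : Digraph (Fin n),
              out = 0 :: T.encode ∧ D.IsOutBranching r T ∧ k ≤ T.leaves.ncard) ∨
            ∃ (n' : ℕ) (D' : Digraph (Fin n')) (r' : Fin n'),
              out = 1 :: (r' : ℕ) :: D'.encode ∧
              ¬ H.IsMinorOf D'.underlying ∧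
              (D.HasLeafyOutBranching r k ↔ D'.HasLeafyOutBranching r' k) ∧
              ∃ S : Set (Fin n'),
                S.ncard ≤ C * k ∧ (D'.inducedOn Sᶜ).underlying.treewidth ≤ 3) := by
  obtain ⟨Q, q, hQ⟩ := exists_program solve
  refine ⟨Q, q, 45, fun W _ H n D r k hk hH => ⟨_, hQ _ n (length_encode D r k) rfl, ?_⟩⟩
  rcases solve_spec D r hk with ⟨hreach, hout⟩ | ⟨p, hout, hp, hadj, hleaves⟩ |
    ⟨hout, f, b, S, hS, hcard⟩
  · right
    obtain ⟨v, hv⟩ := not_forall.1 hreach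
    -- An unreachable vertex provides the second vertex of `D` on which two isolated vertices can be
    -- modelled; removing both vertices of the output costs `2 ≤ 45 * k`.
    have hrv : r ≠ v := fun h => hv (h ▸ .refl)
    refine ⟨2, twoIsolated, 0, hout, fun h => hH (isMinorOf_of_twoIsolated hrv h),
      iff_of_false (fun h => hreach (reflTransGen_of_hasLeafyOutBranching h))
        (not_hasLeafyOutBranching_twoIsolated k), Set.univ, ?_, ?_⟩
    · rw [Set.ncard_univ, Nat.card_eq_fintype_card, Fintype.card_fin]
      omega
    · have : IsEmpty ((Set.univ : Set (Fin 2))ᶜ : Set (Fin 2)) := ⟨fun x => x.2 trivial⟩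
      exact treewidth_le_of_isEmpty _ 3
  · exact Or.inl ⟨branching r p, hout, hp.isOutBranching hadj,
      hleaves.trans_eq numLeaves_eq_ncard⟩
  · right
    obtain ⟨S', hS', htw⟩ := hS.exists_modulator
    refine ⟨n, useful D r, r, hout, fun h => hH (isMinorOf_mono ?_ h),
      hasLeafyOutBranching_useful, S', by omega, htw⟩
    intro u v huv
    rw [underlying_adj] at huv ⊢
    exact ⟨huv.1, huv.2.imp (useful_le D r ·) (useful_le D r ·)⟩
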